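/- **Conventions.** All multi-hypergraphs are finite. A multi-hypergraph $X$ consists of a vertex set $V(X)$ and a multiset of subsets of $V(X)$, its edges; parallel edges are regarded as distinct edges, and isolated vertices are allowed. We write $v(X)$ for the number of vertices, and identify $X$ with its set of edges. A subgraph $H$ of $X$ consists of a set $V(H)\subseteq V(X)$ and a set of edges of $X$ contained in $V(H)$, with $v(H)$ vertices and $e(H)$ edges. For $S\subseteq V(X)$ let $|X(S)|$ be the number of edges of $X$ containing $S$. $X$ is $r$-uniform if all its edges have size $r$; it then has multiplicity at most $m$ if $|X(S)|\le m$ for all $r$-sets $S$, and $\Delta(X)$ is the maximum of $|X(S)|$ over all $(r-1)$-sets $S\subseteq V(X)$. For $Y\subseteq V(X)$, $X$ is $i$-flat to $Y$ if $|e\setminus Y|\le i$ for every edge $e$. For integers $q>r\ge 1$, an $r$-uniform $L$ is $K_q^r$-divisible if $\binom{q-i}{r-i}$ divides $|L(S)|$ for all $0\le i\le r-1$ and all $i$-sets $S$ of vertices, and $M(q,r):=\operatorname{lcm}\left(\binom{q-i}{r-i}: 0\le i\le r-1\right)$. A family $\mathcal H$ of subgraphs of $G$ is $C$-refined if every edge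 of $G$ lies in at most $C$ members of $\mathcal H$ and $\max\{v(H),e(H)\}\le C$ for all $H\in\mathcal H$. Its refinement degree $\Delta(\mathcal H)$ is the maximum over all $(r-1)$-sets $S\subseteq V(G)$ of the number of $H\in\mathcal H$ with $S\subseteq V(H)$. Let $X$ and $R$ be edge-disjoint $r$-uniform multi-hypergraphs with $V(R)=V(X)$ (edges of $X$ and $R$ may be parallel), let $X'$ be a subgraph of $X\cup R$, and let $\mathcal H$ be a family of subgraphs of $X\cup R$. $R$ is a *$K_q^r$-multi-refiner of $X$ with remainder $X'$ and refinement family $\mathcal H$* if $R$ and every $H\in\mathcal H$ are $K_q^r$-divisible, $|H\cap X|\le 1$ and $H\cap X\cap X'=\emptyset$ for every $H\in\mathcal H$, and for every $K_q^r$-divisible subgraph $L$ of $X$ there is a set $\mathcal Q(L)\subseteq\mathcal H$ of pairwise edge-disjoint subgraphs with $(L\cup R)\setminus X'\subseteq\bigcup\mathcal Q(L)\subseteq L\cup R$. It is $C$-refined if $\mathcal H$ is. For $q>r\ge1$, let $\mathrm{MultiOmni}(q,r)$ be the assertion: there is an integer $C\ge 1$ such that for every $r$-uniform multi-hypergraph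 $X$ of multiplicity at most $M(q,r)$ with $v(X)\ge C$ and every $Y\subseteq V(X)$ with $|Y|\ge v(X)/3$ there are a multi-hypergraph $A$ with $V(A)=V(X)$, edge-disjoint from $X$, and a family $\mathcal H$ of subgraphs of $X\cup A$, each isomorphic to the complete $r$-uniform hypergraph $K_q^r$ on $q$ vertices and each with at most one edge in $X$, such that for every $K_q^r$-divisible subgraph $L$ of $X$ there is a set of pairwise edge-disjoint members of $\mathcal H$ whose union is $L\cup A$; every edge of $X\cup A$ lies in at most $C$ members of $\mathcal H$; $\Delta(A)\le C\cdot\max\{\Delta(X),\,v(X)^{1-1/r}\log v(X)\}$; and $A$ is $(r-1)$-flat to $Y$. **Refine Down Lemma.** For all integers $q>r\ge 2$ there exists an integer $C\ge1$ such that the following holds. Suppose that $\mathrm{MultiOmni}(q',r')$ holds for all $r'\in\{1,\dots,r-1\}$ and all $q'>r'$. Let $X$ be an $r$-uniform multi-hypergraph of multiplicity at most $M(q,r)$ and let $\Delta:=\max\{\Delta(X),\,v(X)^{1-1/r}\log v(X)\}$. If $Y\subseteq V(X)$ with $|Y|\ge C$, then there exists a $C$-refined $K_q^r$-multi-refiner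 $R$ of $X$ with remainder $X'$ and refinement family $\mathcal H$ such that 1. $\Delta(\mathcal H)\le C\cdot\left(\frac{v(X)}{|Y|}\right)^{\binom r2}\cdot\Delta$, 2. $R$ is $(r-1)$-flat to $Y$, 3. $\Delta(X')\le C\cdot\left(\frac{v(X)}{|Y|}\right)^{\binom r2}\cdot\Delta$, and 4. $X'$ is an $r$-uniform multi-hypergraph of multiplicity at most $M(q,r)$ with $V(X')\subseteq Y$. -/

import Mathlib

universe u

/-- A multi-hypergraph on the vertex set `V` (isolated vertices are allowed): a family of subsets of
`V` indexed by the labels `E`. Edges with distinct labels are distinct edges, even if they have the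
same vertices, so the multiset of edges is `{edge e | e : E}` with repetitions. -/
structure MultiHypergraph (V E : Type u) where
  /-- The set of vertices of an edge. -/
  edge : E → Finset V

namespace MultiHypergraph

variable {V E F : Type u}

/-- Every edge has exactly `r` vertices. -/
def Uniform (G : MultiHypergraph V E) (r : ℕ) : Prop :=
  ∀ e, (G.edge e).card = r

open Classical in
/-- For a set `L` of edges of `G`, the number `|L(S)|` of edges of `L` that contain `S`. -/
noncomputable def deg (G : MultiHypergraph V E) (L : Finset E) (S : Finset V) : ℕ :=
  (L.filter fun e => S ⊆ G.edge e).card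

/-- A set `L` of edges of an `r`-uniform multi-hypergraph has multiplicity at most `m`: every `r`-set
of vertices carries at most `m` edges of `L`. -/
def MultiplicityLE (G : MultiHypergraph V E) (L : Finset E) (r m : ℕ) : Prop :=
  ∀ S : Finset V, S.card = r → G.deg L S ≤ m

/-- The maximum `(r-1)`-degree `Δ(L)` of a set `L` of edges. -/
noncomputable def maxDeg [Fintype V] (G : MultiHypergraph V E) (L : Finset E) (r : ℕ) : ℕ :=
  (Finset.univ.powersetCard (r - 1)).sup fun S => G.deg L S

/-- `K_q^r`-divisibility of the subgraph with edge set `L`: for all `0 ≤ i ≤ r - 1` and every `i`-set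
`S` of vertices, `(q - i).choose (r - i)` divides the number of edges of `L` containing `S`. (An `S`
that is not contained in the vertex set of the subgraph has degree `0` and imposes no condition.) -/
def Divisible (G : MultiHypergraph V E) (L : Finset E) (q r : ℕ) : Prop :=
  ∀ S : Finset V, S.card < r → (q - S.card).choose (r - S.card) ∣ G.deg L S

open Classical in
/-- `G` is `i`-flat to `Y`: every edge has at most `i` vertices outside `Y`. -/
def Flat (G : MultiHypergraph V E) (i : ℕ) (Y : Finset V) : Prop :=
  ∀ e, (G.edge e \ Y).card ≤ i

/-- The edge-disjoint union of two multi-hypergraphs on the same vertex set. -/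
def union (X : MultiHypergraph V E) (R : MultiHypergraph V F) : MultiHypergraph V (E ⊕ F) where
  edge := Sum.elim X.edge R.edge

/-- A subgraph of a multi-hypergraph. -/
structure Sub (G : MultiHypergraph V E) where
  /-- The vertex set of the subgraph. -/
  verts : Finset V
  /-- The edge set of the subgraph. -/
  edges : Finset E
  edge_subset : ∀ e ∈ edges, G.edge e ⊆ verts

/-- The subgraph `H` is isomorphic to `K_q^r`: it has `q` vertices, its edges are `r`-sets and every
`r`-subset of its vertex set is the vertex set of exactly one of its edges. -/
def Sub.IsClique {G : MultiHypergraph V E} (H : G.Sub) (q r : ℕ) : Prop :=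
  H.verts.card = q ∧ (∀ e ∈ H.edges, (G.edge e).card = r) ∧
    ∀ T : Finset V, T ⊆ H.verts → T.card = r → ∃! e, e ∈ H.edges ∧ G.edge e = T

/-- The members of a family of subgraphs are pairwise edge-disjoint. -/
def EdgeDisjoint {G : MultiHypergraph V E} (Q : Finset G.Sub) : Prop :=
  ∀ H ∈ Q, ∀ H' ∈ Q, H ≠ H' → Disjoint H.edges H'.edges

open Classical in
/-- The number `|ℋ(e)|` of members of the family `ℋ` that contain the edge `e`. -/
noncomputable def edgeCount {G : MultiHypergraph V E} (ℋ : Finset G.Sub) (e : E) : ℕ :=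
  (ℋ.filter fun H => e ∈ H.edges).card

/-- The family `ℋ` of subgraphs is `C`-refined. -/
def Refined {G : MultiHypergraph V E} (C : ℝ) (ℋ : Finset G.Sub) : Prop :=
  (∀ e, (edgeCount ℋ e : ℝ) ≤ C) ∧
    ∀ H ∈ ℋ, (H.verts.card : ℝ) ≤ C ∧ (H.edges.card : ℝ) ≤ C

open Classical in
/-- The refinement degree `Δ_ℋ(S)` of a set `S` of vertices. -/
noncomputable def refDeg {G : MultiHypergraph V E} (ℋ : Finset G.Sub) (S : Finset V) : ℕ :=
  (ℋ.filter fun H => S ⊆ H.verts).card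

/-- The refinement degree `Δ(ℋ)`: the maximum of `Δ_ℋ(S)` over all `(r-1)`-sets `S`. -/
noncomputable def maxRefDeg [Fintype V] {G : MultiHypergraph V E} (ℋ : Finset G.Sub) (r : ℕ) : ℕ :=
  (Finset.univ.powersetCard (r - 1)).sup fun S => refDeg ℋ S

/-- `A` is a `K_q^r`-multi-omni-absorber for `X` with decomposition family `ℋ`. The vertex sets of
`X` and `A` agree and `X`, `A` are edge-disjoint in `X.union A`; `H.edges.toLeft` is `H ∩ X` and
`L.disjSum Finset.univ` is `L ∪ A`. -/
structure IsMultiOmniAbsorber [Fintype F] (q r : ℕ) (X : MultiHypergraph V E)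
    (A : MultiHypergraph V F) (ℋ : Finset (X.union A).Sub) : Prop where
  clique : ∀ H ∈ ℋ, H.IsClique q r
  inter_card : ∀ H ∈ ℋ, H.edges.toLeft.card ≤ 1
  decomp : ∀ L : Finset E, X.Divisible L q r → ∃ Q ⊆ ℋ, EdgeDisjoint Q ∧
    ∀ e, (∃ H ∈ Q, e ∈ H.edges) ↔ e ∈ L.disjSum (Finset.univ : Finset F)

/-- `R` is a `K_q^r`-multi-refiner of `X` with remainder `X' ⊆ X ∪ R` and refinement family `ℋ`.
Again the vertex sets of `X` and `R` agree, `X` and `R` are edge-disjoint in `X.union R`,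
`H.edges.toLeft` is `H ∩ X` and `L.disjSum Finset.univ` is `L ∪ R`. The last condition gives, for
every `K_q^r`-divisible subgraph `L` of `X`, the value `Q ⊆ ℋ` at `L` of a refinement function: `Q`
consists of pairwise edge-disjoint subgraphs and `(L ∪ R) \ X' ⊆ ⋃ Q ⊆ L ∪ R`. -/
structure IsMultiRefiner [Fintype F] (q r : ℕ) (X : MultiHypergraph V E)
    (R : MultiHypergraph V F) (X' : (X.union R).Sub) (ℋ : Finset (X.union R).Sub) : Prop where
  uniform : R.Uniform r
  divisible : R.Divisible Finset.univ q r
  family_divisible : ∀ H ∈ ℋ, (X.union R).Divisible H.edges q r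
  inter_card : ∀ H ∈ ℋ, H.edges.toLeft.card ≤ 1
  inter_remainder : ∀ H ∈ ℋ, Disjoint H.edges.toLeft X'.edges.toLeft
  refines : ∀ L : Finset E, X.Divisible L q r → ∃ Q ⊆ ℋ, EdgeDisjoint Q ∧
    (∀ e ∈ L.disjSum (Finset.univ : Finset F), e ∉ X'.edges → ∃ H ∈ Q, e ∈ H.edges) ∧
    ∀ H ∈ Q, H.edges ⊆ L.disjSum (Finset.univ : Finset F)

/-- The number `M(q,r)`, the least common multiple of `(q - i).choose (r - i)` for `0 ≤ i ≤ r - 1`. -/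
def M (q r : ℕ) : ℕ := (Finset.range r).lcm fun i => (q - i).choose (r - i)

/-- The quantity `Δ = max {Δ(X), v(X)^(1 - 1/r) * log v(X)}`. -/
noncomputable def Delta [Fintype V] [Fintype E] (X : MultiHypergraph V E) (r : ℕ) : ℝ :=
  max (X.maxDeg Finset.univ r : ℝ)
    ((Fintype.card V : ℝ) ^ (1 - 1 / (r : ℝ)) * Real.log (Fintype.card V))

/-- The assertion of the Refined Multi-Omni-Absorber Theorem for the parameters `q > r ≥ 1`. -/
def MultiOmniTheorem (q r : ℕ) : Prop :=
  ∃ C : ℕ, 1 ≤ C ∧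
    ∀ (V E : Type u) [Fintype V] [Fintype E] (X : MultiHypergraph V E) (Y : Finset V),
      X.Uniform r → X.MultiplicityLE Finset.univ r (M q r) → C ≤ Fintype.card V →
      (Fintype.card V : ℝ) / 3 ≤ Y.card →
      ∃ (F : Type u) (_ : Fintype F) (A : MultiHypergraph V F) (ℋ : Finset (X.union A).Sub),
        IsMultiOmniAbsorber q r X A ℋ ∧
        (∀ e, (edgeCount ℋ e : ℝ) ≤ C) ∧
        (A.maxDeg Finset.univ r : ℝ) ≤ C * X.Delta r ∧
        A.Flat (r - 1) Y

end MultiHypergraph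

/-! For s = r, r-1, ..., 1, the remaining edges with exactly s vertices outside `Y` are eliminated,
one trace S = e \ Y at a time. For a fixed S only the degree conditions at sets containing S are
available, so refinement is treated relative to S (`Ref`): S-divisible sets are covered as far as
their edges containing S are concerned. New edges lie in S ∪ Y; those not containing S have fewer
vertices outside `Y` and wait for a later level. `Ref.step` chains such refinements. What is left at
the end lies inside `Y`, and `exists_parallel` trades it for new edges of multiplicity at most `M q
r`.

Local absorption. Let i = |S|. The link of S in an S-divisible set is divisible for (q-i, r-i). The
omni-absorber assertion in lower uniformity implies that divisible functions are integer
combinations of cliques; adding S to each (q-i)-clique of the link gives q-cliques, so an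
S-divisible set becomes divisible after adding edges that do not contain S (`exists_completion`).
This is the only use of the hypothesis. In a window of constant size it gives a bounded family
(`Absorbs.zero`). Larger windows are reached by factors ρ: a smaller window W' ⊆ W is chosen and the
vertices of W \ W' are swept out (`Absorbs.sweep`, `Absorbs.succ`). The number of rounds depends
only on r.

Large degrees. For |S| < r the edges at S are coloured so that each class has degree at most 1 at
the (r-1)-sets containing S (`Absorbs.top`). A colour class of an S-divisible set need not be
S-divisible; the defect is passed from class to class by a carry. Carry edges are S ∪ h, where h
runs over sets with vertex sum in a short interval modulo |Y|. Via octahedra these sets generate all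
degree vectors (`exists_sumSets_combination`), yet each set one vertex smaller lies in boundedly
many of them.

Degree control. Windows and shifts of the interval would naturally be random; the choice is
derandomised. For an (r-1)-set T, `kap θ T A` is 1 if T ⊆ A and otherwise weights each missed vertex
by θ, which is 1/|W| on the current window, so that it estimates the chance that T will be covered
later. The potential is the sum over T of w(T) exp(a · Cost_T). By `exists_Pot_le` a choice can be
made that is no worse than twice the average in the exponent, provided `a` times the load of every
outcome is at most 1. With the weights w(T) normalised, `le_add_log_of_Pot` bounds every cost by its
predicted value plus r log(v)/a. The window sizes permit 1/a of order B ≤ v^(1-1/r), so the additive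
error is of order v^(1-1/r) log v, which `Δ` dominates. -/

namespace RefineDown
open Finset
-- Labelled edges, relative refiners and their composition
section Labels
variable {V : Type u} [DecidableEq V]

/-- An edge label carrying its own vertex set. -/
abbrev Lab (V : Type u) := Finset V × ℕ

/-- The number of edges of `L` containing `T`. -/
def ldeg (L : Finset (Lab V)) (T : Finset V) : ℕ := (L.filter fun x => T ⊆ x.1).card

/-- The divisor required of the degrees of `t`-sets. -/
def ch (q r t : ℕ) : ℕ := (q - t).choose (r - t)

/-- The degree conditions of `K_q^r`-divisibility at the sets containing `S`. -/
def SDiv (q r : ℕ) (S : Finset V) (L : Finset (Lab V)) : Prop :=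
  ∀ T, S ⊆ T → T.card < r → ch q r T.card ∣ ldeg L T

/-- The number of members of `ℋ` containing the edge `x`. -/
def cnt (ℋ : Finset (Finset (Lab V))) (x : Lab V) : ℕ := (ℋ.filter fun H => x ∈ H).card

/-- Every member of `ℋ` has at most one edge in `X`. -/
def Thin (X : Finset (Lab V)) (ℋ : Finset (Finset (Lab V))) : Prop :=
  ∀ H ∈ ℋ, (H ∩ X).card ≤ 1

/-- `R` with the family `ℋ` refines the `S`-divisible subgraphs of `X`, up to the remainder `X'`,
as far as edges containing `S` are concerned. -/
structure Ref (q r C : ℕ) (S : Finset V) (X R : Finset (Lab V))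
    (ℋ : Finset (Finset (Lab V))) (X' : Finset (Lab V)) : Prop where
  disj : Disjoint X R
  unif : ∀ x ∈ R, x.1.card = r
  -- Full divisibility is asked of `R` and of the members of `ℋ`, although `L` only satisfies the
  -- conditions above `S`: a refiner built for one `S` can then be inserted into a refiner for any
  -- smaller set.
  rdiv : SDiv q r ∅ R
  sub : ∀ H ∈ ℋ, H ⊆ X ∪ R
  hdiv : ∀ H ∈ ℋ, SDiv q r ∅ H
  hcard : ∀ H ∈ ℋ, H.card ≤ C
  hcnt : ∀ x, cnt ℋ x ≤ C
  cover : ∀ L ⊆ X, SDiv q r S L → ∃ Q ⊆ ℋ, (Q : Set (Finset (Lab V))).PairwiseDisjoint id ∧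
    (∀ H ∈ Q, H ⊆ L ∪ R) ∧ ∀ x ∈ L ∪ R, S ⊆ x.1 → x ∉ X' → ∃ H ∈ Q, x ∈ H

lemma ldeg_union {A B : Finset (Lab V)} (h : Disjoint A B) (T : Finset V) :
    ldeg (A ∪ B) T = ldeg A T + ldeg B T := by
  unfold ldeg
  rw [filter_union, card_union_of_disjoint (disjoint_filter_filter h)]

lemma ldeg_mono {A B : Finset (Lab V)} (h : A ⊆ B) (T : Finset V) : ldeg A T ≤ ldeg B T :=
  card_le_card (filter_subset_filter _ h)

lemma ldeg_anti (A : Finset (Lab V)) {T T' : Finset V} (h : T ⊆ T') : ldeg A T' ≤ ldeg A T := by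
  unfold ldeg
  apply card_le_card
  intro x hx
  rw [mem_filter] at hx ⊢
  exact ⟨hx.1, h.trans hx.2⟩

lemma ldeg_sdiff {A B : Finset (Lab V)} (h : B ⊆ A) (T : Finset V) :
    ldeg A T = ldeg (A \ B) T + ldeg B T := by
  rw [← ldeg_union sdiff_disjoint, sdiff_union_of_subset h]

lemma ldeg_biUnion {ι : Type*} [DecidableEq ι] (Q : Finset ι) (f : ι → Finset (Lab V))
    (h : (Q : Set ι).PairwiseDisjoint f) (T : Finset V) :
    ldeg (Q.biUnion f) T = ∑ i ∈ Q, ldeg (f i) T := by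
  unfold ldeg
  rw [filter_biUnion, card_biUnion]
  intro i hi j hj hij
  exact disjoint_filter_filter (h hi hj hij)

lemma SDiv.mono {q r : ℕ} {S S' : Finset V} {L : Finset (Lab V)} (h : SDiv q r S L)
    (hS : S ⊆ S') : SDiv q r S' L := fun T hT hc => h T (hS.trans hT) hc

lemma SDiv.union {q r : ℕ} {S : Finset V} {A B : Finset (Lab V)} (hA : SDiv q r S A)
    (hB : SDiv q r S B) (h : Disjoint A B) : SDiv q r S (A ∪ B) := fun T hT hc => by
  rw [ldeg_union h]; exact dvd_add (hA T hT hc) (hB T hT hc)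

lemma SDiv.sdiff {q r : ℕ} {S : Finset V} {A B : Finset (Lab V)} (hA : SDiv q r S A)
    (hB : SDiv q r S B) (h : B ⊆ A) : SDiv q r S (A \ B) := fun T hT hc => by
  have h1 := ldeg_sdiff h T
  have h2 := hA T hT hc
  rw [h1] at h2
  exact (Nat.dvd_add_left (hB T hT hc)).1 h2

lemma SDiv.biUnion {q r : ℕ} {S : Finset V} {ι : Type*} [DecidableEq ι] {Q : Finset ι}
    {f : ι → Finset (Lab V)} (h : (Q : Set ι).PairwiseDisjoint f)
    (hd : ∀ i ∈ Q, SDiv q r S (f i)) : SDiv q r S (Q.biUnion f) := fun T hT hc => by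
  rw [ldeg_biUnion Q f h]; exact dvd_sum fun i hi => hd i hi T hT hc

lemma cnt_union_le (A B : Finset (Finset (Lab V))) (x : Lab V) :
    cnt (A ∪ B) x ≤ cnt A x + cnt B x := by
  unfold cnt; rw [filter_union]; exact card_union_le _ _

lemma cnt_eq_zero {A : Finset (Finset (Lab V))} {x : Lab V} (h : ∀ H ∈ A, x ∉ H) :
    cnt A x = 0 := by
  unfold cnt; rw [card_eq_zero, filter_eq_empty_iff]; exact fun H hH => h H hH

lemma Ref.cnt_zero {q r C : ℕ} {S : Finset V} {X R X' : Finset (Lab V)}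
    {ℋ : Finset (Finset (Lab V))} (h : Ref q r C S X R ℋ X') {x : Lab V} (hx : x ∉ X ∪ R) :
    cnt ℋ x = 0 := cnt_eq_zero fun H hH hxH => hx (h.sub H hH hxH)

lemma Ref.le {q r C C' : ℕ} {S : Finset V} {X R X' : Finset (Lab V)}
    {ℋ : Finset (Finset (Lab V))} (h : Ref q r C S X R ℋ X') (hC : C ≤ C') :
    Ref q r C' S X R ℋ X' :=
  { h with
    hcard := fun H hH => (h.hcard H hH).trans hC
    hcnt := fun x => (h.hcnt x).trans hC }

/-- Refine the part `X₂` of the remainder that consists of the edges containing `S₂ ⊇ S`. -/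
theorem Ref.step {q r C c C₂ C' : ℕ} {S S₂ : Finset V} {X R X' X₂ R₂ X₂' X'' : Finset (Lab V)}
    {ℋ ℋ₂ : Finset (Finset (Lab V))} (h : Ref q r C S X R ℋ X')
    (hc : ∀ x ∈ X₂, cnt ℋ x ≤ c)
    (h₂ : Ref q r C₂ S₂ X₂ R₂ ℋ₂ X₂') (hS : S ⊆ S₂)
    (hX₂ : X₂ ⊆ X ∪ R) (hX₂S : ∀ x ∈ X₂, S₂ ⊆ x.1)
    (hres : ∀ x ∈ X', x ∉ X₂ → ¬ S₂ ⊆ x.1)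
    (hR₂ : Disjoint (X ∪ R) R₂)
    (hC : C ≤ C') (hC₂ : c + C₂ ≤ C')
    (h1 : ∀ x ∈ X', S ⊆ x.1 → x ∉ X₂ → x ∈ X'') (h2 : X₂' ⊆ X'')
    (h3 : ∀ x ∈ R₂, S ⊆ x.1 → ¬ S₂ ⊆ x.1 → x ∈ X'') :
    Ref q r C' S X (R ∪ R₂) (ℋ ∪ ℋ₂) X'' := by
  have hXR₂ : Disjoint X R₂ := disjoint_of_subset_left subset_union_left hR₂
  have hRR₂ : Disjoint R R₂ := disjoint_of_subset_left subset_union_right hR₂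
  have hC₂' : C₂ ≤ C' := (Nat.le_add_left _ _).trans hC₂
  refine ⟨disjoint_union_right.2 ⟨h.disj, hXR₂⟩, ?_, h.rdiv.union h₂.rdiv hRR₂, ?_, ?_, ?_, ?_, ?_⟩
  · intro x hx
    rcases mem_union.1 hx with hx | hx
    exacts [h.unif x hx, h₂.unif x hx]
  · intro H hH
    rcases mem_union.1 hH with hH | hH
    · exact (h.sub H hH).trans (union_subset_union_right subset_union_left)
    · refine (h₂.sub H hH).trans (union_subset (hX₂.trans ?_) ?_)
      · exact union_subset_union_right subset_union_left
      · exact subset_union_right.trans subset_union_right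
  · intro H hH
    rcases mem_union.1 hH with hH | hH
    exacts [h.hdiv H hH, h₂.hdiv H hH]
  · intro H hH
    rcases mem_union.1 hH with hH | hH
    exacts [(h.hcard H hH).trans hC, (h₂.hcard H hH).trans hC₂']
  · intro x
    refine (cnt_union_le _ _ _).trans ?_
    by_cases hx2 : x ∈ X₂
    · exact (Nat.add_le_add (hc x hx2) (h₂.hcnt x)).trans hC₂
    by_cases hxR : x ∈ R₂
    · have : x ∉ X ∪ R := fun hx => disjoint_left.1 hR₂ hx hxR
      rw [h.cnt_zero this, zero_add]
      exact (h₂.hcnt x).trans hC₂'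
    · rw [h₂.cnt_zero (by simp [hx2, hxR]), add_zero]
      exact (h.hcnt x).trans hC
  · intro L hL hLd
    obtain ⟨Q, hQ, hQd, hQL, hQc⟩ := h.cover L hL hLd
    have hLR : Disjoint L R := disjoint_of_subset_left hL h.disj
    have hUQ : Q.biUnion id ⊆ L ∪ R := biUnion_subset.2 hQL
    -- The part left uncovered by the first refinement. It is again `S`-divisible, being obtained
    -- from `L ∪ R` by removing disjoint divisible subgraphs, and its edges containing `S` lie in
    -- `X'`.
    set L' := (L ∪ R) \ Q.biUnion id with hL'
    have hL'd : SDiv q r S L' :=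
      ((hLd.union (h.rdiv.mono (empty_subset _)) hLR)).sdiff
        (SDiv.biUnion hQd fun H hH => (h.hdiv H (hQ hH)).mono (empty_subset _)) hUQ
    have hL'X : ∀ x ∈ L', S ⊆ x.1 → x ∈ X' := by
      intro x hx hSx
      by_contra hxX
      obtain ⟨H, hH, hxH⟩ := hQc x (mem_sdiff.1 hx).1 hSx hxX
      exact (mem_sdiff.1 hx).2 (mem_biUnion.2 ⟨H, hH, hxH⟩)
    -- A set `T ⊇ S₂` has the same degree in `L'` and in `L' ∩ X₂`, because by `hres` every edge of
    -- the remainder that contains `S₂` belongs to `X₂`.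
    have hL₂d : SDiv q r S₂ (L' ∩ X₂) := by
      intro T hT hTc
      have : ldeg (L' ∩ X₂) T = ldeg L' T := by
        unfold ldeg
        congr 1
        ext x
        simp only [mem_filter, mem_inter]
        constructor
        · rintro ⟨⟨a, -⟩, b⟩; exact ⟨a, b⟩
        · rintro ⟨a, b⟩
          refine ⟨⟨a, ?_⟩, b⟩
          by_contra hx2
          exact hres x (hL'X x a (hS.trans (hT.trans b))) hx2 (hT.trans b)
      rw [this]
      exact hL'd T (hS.trans hT) hTc
    obtain ⟨Q₂, hQ₂, hQ₂d, hQ₂L, hQ₂c⟩ := h₂.cover _ inter_subset_right hL₂d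
    have hcross : ∀ H ∈ Q, ∀ H' ∈ Q₂, Disjoint H H' := by
      intro H hH H' hH'
      rw [disjoint_left]
      intro x hx hx'
      rcases mem_union.1 (hQ₂L H' hH' hx') with hx2 | hx2
      · exact (mem_sdiff.1 (mem_inter.1 hx2).1).2 (mem_biUnion.2 ⟨H, hH, hx⟩)
      · exact disjoint_left.1 hR₂ (h.sub H (hQ hH) hx) hx2
    refine ⟨Q ∪ Q₂, union_subset_union hQ hQ₂, ?_, ?_, ?_⟩
    · intro A hA B hB hAB
      simp only [coe_union, Set.mem_union, mem_coe] at hA hB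
      rcases hA with hA | hA <;> rcases hB with hB | hB
      · exact hQd hA hB hAB
      · exact hcross A hA B hB
      · exact (hcross B hB A hA).symm
      · exact hQ₂d hA hB hAB
    · intro H hH
      rcases mem_union.1 hH with hH | hH
      · exact (hQL H hH).trans (union_subset_union_right subset_union_left)
      · refine (hQ₂L H hH).trans (union_subset ?_ ?_)
        · exact (inter_subset_left.trans sdiff_subset).trans
            (union_subset_union_right subset_union_left)
        · exact subset_union_right.trans subset_union_right
    · intro x hx hSx hxX
      have key : x ∈ (L' ∩ X₂) ∪ R₂ → S₂ ⊆ x.1 → ∃ H ∈ Q ∪ Q₂, x ∈ H := by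
        intro ha hb
        obtain ⟨H, hH, hxH⟩ := hQ₂c x ha hb (fun hh => hxX (h2 hh))
        exact ⟨H, mem_union_right _ hH, hxH⟩
      rw [← union_assoc, mem_union] at hx
      rcases hx with hx | hx
      · by_cases hxQ : x ∈ Q.biUnion id
        · obtain ⟨H, hH, hxH⟩ := mem_biUnion.1 hxQ
          exact ⟨H, mem_union_left _ hH, hxH⟩
        · have hxL' : x ∈ L' := mem_sdiff.2 ⟨hx, hxQ⟩
          have hxX' := hL'X x hxL' hSx
          have hx2 : x ∈ X₂ := by
            by_contra hx2; exact hxX (h1 x hxX' hSx hx2)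
          exact key (mem_union_left _ (mem_inter.2 ⟨hxL', hx2⟩)) (hX₂S x hx2)
      · have : S₂ ⊆ x.1 := by
          by_contra hh; exact hxX (h3 x hx hSx hh)
        exact key (mem_union_right _ hx) this

lemma exists_fresh (A : Finset (Lab V)) (E : Finset (Finset V)) (d : Finset V → ℕ) :
    ∃ Z : Finset (Lab V), Disjoint Z A ∧ (∀ x ∈ Z, x.1 ∈ E) ∧
      ∀ e ∈ E, (Z.filter fun x => x.1 = e).card = d e := by
  -- Every label from `k` on is unused in `A`.
  set k := A.sup (fun x => x.2) + 1
  refine ⟨E.biUnion fun e => (range (d e)).image fun j => (e, k + j), ?_, ?_, ?_⟩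
  · rw [disjoint_left]
    intro x hx hxA
    simp only [mem_biUnion, mem_image, mem_range] at hx
    obtain ⟨e, -, j, -, rfl⟩ := hx
    have : k + j ≤ A.sup (fun x => x.2) := le_sup (f := fun x : Lab V => x.2) hxA
    omega
  · intro x hx
    simp only [mem_biUnion, mem_image, mem_range] at hx
    obtain ⟨e, he, j, -, rfl⟩ := hx
    exact he
  · intro e he
    have : (filter (fun x : Lab V => x.1 = e)
        (E.biUnion fun e => (range (d e)).image fun j => (e, k + j)))
        = (range (d e)).image fun j => (e, k + j) := by
      ext x
      simp only [mem_filter, mem_biUnion, mem_image, mem_range]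
      constructor
      · rintro ⟨⟨e', -, j, hj, rfl⟩, h⟩
        simp only at h; subst h
        exact ⟨j, hj, rfl⟩
      · rintro ⟨j, hj, rfl⟩
        exact ⟨⟨e, he, j, hj, rfl⟩, rfl⟩
    rw [this, card_image_of_injective, card_range]
    intro a b hab
    simpa using hab

lemma ldeg_eq_sum {Z : Finset (Lab V)} {E : Finset (Finset V)} (hE : ∀ x ∈ Z, x.1 ∈ E)
    (T : Finset V) :
    ldeg Z T = ∑ e ∈ E with T ⊆ e, (Z.filter fun x => x.1 = e).card := by
  unfold ldeg
  rw [card_eq_sum_card_fiberwise (f := Prod.fst) (t := E.filter fun e => T ⊆ e)]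
  · refine sum_congr rfl fun e he => ?_
    congr 1
    ext x
    simp only [mem_filter] at he ⊢
    constructor
    · rintro ⟨⟨a, -⟩, b⟩; exact ⟨a, b⟩
    · rintro ⟨a, b⟩; exact ⟨⟨a, b ▸ he.2⟩, b⟩
  · intro x hx
    simp only [coe_filter, Set.mem_ofPred_eq] at hx ⊢
    exact ⟨hE x hx.1, hx.2⟩

lemma exists_partition_card {α : Type*} [DecidableEq α] {m : ℕ} :
    ∀ (k : ℕ) (D : Finset α), D.card = k * m → ∃ Q ⊆ D.powersetCard m,
      (Q : Set (Finset α)).PairwiseDisjoint id ∧ ∀ x ∈ D, ∃ H ∈ Q, x ∈ H := by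
  intro k
  induction k with
  | zero =>
    intro D hD
    have : D = ∅ := by simpa using hD
    subst this
    exact ⟨∅, by simp, by simp, by simp⟩
  | succ k ih =>
    intro D hD
    obtain ⟨H, hH, hHc⟩ := exists_subset_card_eq (s := D) (n := m) (by rw [hD]; nlinarith)
    obtain ⟨Q, hQ, hQd, hQc⟩ := ih (D \ H) (by
      rw [card_sdiff_of_subset hH, hD, hHc, Nat.succ_mul, Nat.add_sub_cancel])
    have hdis : ∀ B ∈ Q, Disjoint H B := fun B hB =>
      disjoint_of_subset_right (mem_powersetCard.1 (hQ hB)).1 disjoint_sdiff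
    refine ⟨insert H Q, ?_, ?_, ?_⟩
    · intro B hB
      rcases mem_insert.1 hB with rfl | hB
      · exact mem_powersetCard.2 ⟨hH, hHc⟩
      · have := mem_powersetCard.1 (hQ hB)
        exact mem_powersetCard.2 ⟨this.1.trans sdiff_subset, this.2⟩
    · rw [coe_insert, Set.pairwiseDisjoint_insert]
      exact ⟨hQd, fun B hB _ => hdis B hB⟩
    · intro x hx
      by_cases hxH : x ∈ H
      · exact ⟨H, mem_insert_self _ _, hxH⟩
      · obtain ⟨B, hB, hxB⟩ := hQc x (mem_sdiff.2 ⟨hx, hxH⟩)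
        exact ⟨B, mem_insert_of_mem hB, hxB⟩

end Labels
end RefineDown

/-! ### Reducing the multiplicity of parallel edges -/

namespace RefineDown
open Finset
section Parallel
variable {V : Type u} [DecidableEq V]

/-- The set of vertices covered by the edges in `H`. -/
def verts (H : Finset (Lab V)) : Finset V := H.biUnion Prod.fst

lemma subset_verts {H : Finset (Lab V)} {x : Lab V} (hx : x ∈ H) : x.1 ⊆ verts H :=
  subset_biUnion_of_mem Prod.fst hx

/-- The total cost of the vertex sets of a family and of the edges of `R`. -/
def Cost (c : Finset V → ℝ) (R : Finset (Lab V)) (ℋ : Finset (Finset (Lab V))) : ℝ :=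
  ∑ H ∈ ℋ, c (verts H) + ∑ x ∈ R, c x.1

lemma sum_union_le_add {α : Type*} [DecidableEq α] {f : α → ℝ} (hf : ∀ a, 0 ≤ f a)
    (s t : Finset α) : ∑ x ∈ s ∪ t, f x ≤ ∑ x ∈ s, f x + ∑ x ∈ t, f x := by
  rw [← sum_union_inter]
  exact le_add_of_nonneg_right (sum_nonneg fun _ _ => hf _)

lemma Cost_union_le {c : Finset V → ℝ} (hc : ∀ A, 0 ≤ c A) (R R' : Finset (Lab V))
    (ℋ ℋ' : Finset (Finset (Lab V))) :
    Cost c (R ∪ R') (ℋ ∪ ℋ') ≤ Cost c R ℋ + Cost c R' ℋ' := by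
  unfold Cost
  have h1 := sum_union_le_add (f := fun H => c (verts H)) (fun _ => hc _) ℋ ℋ'
  have h2 := sum_union_le_add (f := fun x : Lab V => c x.1) (fun _ => hc _) R R'
  linarith

lemma Cost_mono {c c' : Finset V → ℝ} (hc : ∀ A, c A ≤ c' A) (R : Finset (Lab V))
    (ℋ : Finset (Finset (Lab V))) : Cost c R ℋ ≤ Cost c' R ℋ :=
  add_le_add (sum_le_sum fun _ _ => hc _) (sum_le_sum fun _ _ => hc _)

lemma Cost_le_of_subset {c : Finset V → ℝ} (hc : ∀ A, 0 ≤ c A) {R : Finset (Lab V)}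
    {ℋ : Finset (Finset (Lab V))} : ∑ x ∈ R, c x.1 ≤ Cost c R ℋ :=
  le_add_of_nonneg_left (sum_nonneg fun _ _ => hc _)

lemma verts_eq_of_forall {H : Finset (Lab V)} {g : Finset V} (hne : H.Nonempty)
    (h : ∀ x ∈ H, x.1 = g) : verts H = g := by
  obtain ⟨y, hy⟩ := hne
  apply subset_antisymm
  · exact biUnion_subset.2 fun x hx => (h x hx).subset
  · exact (h y hy).symm.subset.trans (subset_verts hy)

/-- All degrees of a set of parallel edges are 0 or its cardinality, so it suffices that the
cardinality is a common multiple of the required divisors. This is why parallel edges are grouped in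
batches of `M q r`. -/
lemma sDiv_of_parallel {q r m : ℕ} (hch : ∀ t < r, ch q r t ∣ m) {H : Finset (Lab V)}
    {g : Finset V} (h : ∀ x ∈ H, x.1 = g) (hm : m ∣ H.card) (S : Finset V) : SDiv q r S H := by
  intro T _ hT
  refine (hch _ hT).trans ?_
  unfold ldeg
  by_cases hTg : T ⊆ g
  · rw [filter_true_of_mem fun x hx => by rw [h x hx]; exact hTg]
    exact hm
  · rw [filter_false_of_mem fun x hx => by rw [h x hx]; exact hTg]
    simp

/-- Parallel edges can be grouped into sets of `m`, leaving at most `m` new edges on each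
vertex set. -/
theorem exists_parallel {q r m : ℕ} (hm : 1 ≤ m) (hch : ∀ t < r, ch q r t ∣ m)
    (X : Finset (Lab V)) (hX : ∀ x ∈ X, x.1.card = r) (A : Finset (Lab V)) :
    ∃ (R : Finset (Lab V)) (ℋ : Finset (Finset (Lab V))) (X' : Finset (Lab V)),
      (∀ S, Ref q r (2 * 2 ^ (2 * m + 1)) S X R ℋ X') ∧
      (∀ L ⊆ X, ∃ Q ⊆ ℋ, (Q : Set (Finset (Lab V))).PairwiseDisjoint id ∧
        (∀ H ∈ Q, H ⊆ L ∪ R) ∧ ∀ x ∈ L ∪ R, x ∉ X' → ∃ H ∈ Q, x ∈ H) ∧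
      Thin X ℋ ∧ Disjoint R A ∧ X' ⊆ R ∧
      (∀ e, (X'.filter fun x => x.1 = e).card ≤ m) ∧
      (∀ x ∈ X', cnt ℋ x ≤ 2 ^ (2 * m + 1)) ∧ (∀ x ∈ R, ∃ y ∈ X, x.1 = y.1) ∧
      ∀ c : Finset V → ℝ, (∀ B, 0 ≤ c B) →
        Cost c R ℋ ≤ (2 ^ (2 * m + 1) + m : ℕ) * ∑ x ∈ X, c x.1 := by
  induction X using Finset.induction_on generalizing A with
  | empty =>
    refine ⟨∅, ∅, ∅, fun S => ⟨by simp, by simp, fun T _ _ => by simp [ldeg], by simp, by simp,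
      by simp, by simp [cnt], fun L hL _ => ⟨∅, by simp, by simp, by simp, ?_⟩⟩,
      fun L hL => ⟨∅, by simp, by simp, by simp, ?_⟩, ?_, by simp,
      by simp, by simp, by simp, by simp, by simp [Cost]⟩
    · rw [subset_empty.1 hL]; simp
    · rw [subset_empty.1 hL]; simp
    · intro H hH; simp at hH
  | insert x X hx ih =>
    obtain ⟨R, ℋ, X', hR, hcov, hT, hA, hX'R, hmult, hcX', hRX, hcost⟩ :=
      ih (fun y hy => hX y (mem_insert_of_mem hy)) (insert x A)
    have hR0 := hR ∅
    set K := 2 ^ (2 * m + 1) with hK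
    set g := x.1 with hg
    have hxR : x ∉ R := fun h => disjoint_left.1 hA h (mem_insert_self _ _)
    -- For each edge `x`, `m` new parallel edges are created. They become the remainder on `g`,
    -- while the previous remainder `Z` on `g` is cleared together with `x`.
    obtain ⟨Y, hYA, hYE, hYc⟩ := exists_fresh (A ∪ (insert x X ∪ R)) {g} (fun _ => m)
    have hYg : ∀ z ∈ Y, z.1 = g := fun z hz => by simpa using hYE z hz
    have hYcard : Y.card = m := by
      have := hYc g (mem_singleton_self _)
      rwa [filter_true_of_mem hYg] at this
    rw [disjoint_union_right, disjoint_union_right] at hYA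
    obtain ⟨hYA, hYX, hYR⟩ := hYA
    have hYx : x ∉ Y := fun h => disjoint_left.1 hYX h (mem_insert_self _ _)
    set Z := X'.filter fun z => z.1 = g with hZ
    have hZg : ∀ z ∈ Z, z.1 = g := fun z hz => (mem_filter.1 hz).2
    have hZle : Z.card ≤ m := hmult g
    have hZR : Z ⊆ R := (filter_subset _ _).trans hX'R
    -- The ground set has at most 2m+1 elements, so at most `K` subsets arise. An edge takes part in
    -- at most two rounds, once as a new remainder edge and once when it is cleared, whence the
    -- factor 2 in the bound on `cnt`.
    set 𝒩 := (Z ∪ ({x} ∪ Y)).powersetCard m with h𝒩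
    have hBg : ∀ z ∈ Z ∪ ({x} ∪ Y), z.1 = g := by
      intro z hz
      simp only [mem_union, mem_singleton] at hz
      rcases hz with hz | rfl | hz
      exacts [hZg z hz, rfl, hYg z hz]
    have hHg : ∀ H ∈ 𝒩, ∀ z ∈ H, z.1 = g := fun H hH z hz =>
      hBg z ((mem_powersetCard.1 hH).1 hz)
    have hHc : ∀ H ∈ 𝒩, H.card = m := fun H hH => (mem_powersetCard.1 hH).2
    have h𝒩c : 𝒩.card ≤ K := by
      calc 𝒩.card ≤ ((Z ∪ ({x} ∪ Y)).powerset).card := by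
            apply card_le_card
            intro H hH
            exact mem_powerset.2 (mem_powersetCard.1 hH).1
        _ = 2 ^ (Z ∪ ({x} ∪ Y)).card := card_powerset _
        _ ≤ K := by
            apply Nat.pow_le_pow_right (by norm_num)
            have h1 := card_union_le Z ({x} ∪ Y)
            have h2 := card_union_le {x} Y
            rw [card_singleton] at h2
            omega
    have hcn : ∀ z, cnt 𝒩 z ≤ K := fun z => (card_filter_le _ _).trans h𝒩c
    have hcn0 : ∀ z, z ∉ Z ∪ ({x} ∪ Y) → cnt 𝒩 z = 0 := fun z hz =>
      cnt_eq_zero fun H hH hzH => hz ((mem_powersetCard.1 hH).1 hzH)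
    have hmK : m ≤ 2 * K := by
      have : 2 * m + 1 < K := Nat.lt_two_pow_self
      omega
    have hXR' : Disjoint (insert x X) (R ∪ Y) := by
      rw [disjoint_union_right, disjoint_insert_left]
      exact ⟨⟨hxR, hR0.disj⟩, hYX.symm⟩
    have hcov' : ∀ L ⊆ insert x X, ∃ Q ⊆ ℋ ∪ 𝒩,
        (Q : Set (Finset (Lab V))).PairwiseDisjoint id ∧ (∀ H ∈ Q, H ⊆ L ∪ (R ∪ Y)) ∧
        ∀ z ∈ L ∪ (R ∪ Y), z ∉ (X' \ Z) ∪ Y → ∃ H ∈ Q, z ∈ H := by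
      intro L hL
      have hL0 : L.erase x ⊆ X := by
        intro z hz
        rw [mem_erase] at hz
        exact (mem_insert.1 (hL hz.2)).resolve_left hz.1
      obtain ⟨Q, hQ, hQd, hQL, hQc⟩ := hcov (L.erase x) hL0
      set D := (Z \ Q.biUnion id) ∪ (({x} ∩ L) ∪ Y) with hD
      have hYD : Y ⊆ D := subset_union_right.trans subset_union_right
      -- The residue of `D.card` modulo `m` is left uncovered inside `Y`; the rest of `D` then
      -- splits into `m`-sets without any divisibility assumption on `L`.
      obtain ⟨c', hc'Y, hc'⟩ := exists_subset_card_eq (s := Y) (n := D.card % m)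
        (by rw [hYcard]; exact (Nat.mod_lt _ hm).le)
      obtain ⟨Q1, hQ1, hQ1d, hQ1c⟩ := exists_partition_card (m := m) (D.card / m) (D \ c') (by
        rw [card_sdiff_of_subset (hc'Y.trans hYD), hc']
        have := Nat.div_add_mod' D.card m
        omega)
      have hDsub : D ⊆ Z ∪ ({x} ∪ Y) :=
        union_subset_union sdiff_subset (union_subset_union inter_subset_left subset_rfl)
      have hQ1D : ∀ H ∈ Q1, H ⊆ D := fun H hH =>
        (mem_powersetCard.1 (hQ1 hH)).1.trans sdiff_subset
      have hDL : D ⊆ L ∪ (R ∪ Y) :=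
        union_subset ((sdiff_subset.trans hZR).trans (subset_union_left.trans subset_union_right))
          (union_subset (inter_subset_right.trans subset_union_left)
            (subset_union_right.trans subset_union_right))
      have hcross : ∀ H ∈ Q, ∀ H' ∈ Q1, Disjoint H H' := by
        intro H hH H' hH'
        rw [disjoint_left]
        intro z hz hz'
        have h1 := hQ1D H' hH' hz'
        have h2 := hQL H hH hz
        simp only [hD, mem_union, mem_sdiff, mem_inter, mem_singleton] at h1
        rcases h1 with h1 | ⟨rfl, -⟩ | h1
        · exact h1.2 (mem_biUnion.2 ⟨H, hH, hz⟩)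
        · rcases mem_union.1 h2 with h2 | h2
          exacts [(mem_erase.1 h2).1 rfl, hxR h2]
        · rcases mem_union.1 h2 with h2 | h2
          · exact disjoint_left.1 hYX h1 (mem_insert_of_mem (hL0 h2))
          · exact disjoint_left.1 hYR h1 h2
      refine ⟨Q ∪ Q1, union_subset_union hQ ?_, ?_, ?_, ?_⟩
      · intro H hH
        exact mem_powersetCard.2 ⟨(hQ1D H hH).trans hDsub, (mem_powersetCard.1 (hQ1 hH)).2⟩
      · intro A hA B hB hAB
        simp only [coe_union, Set.mem_union, mem_coe] at hA hB
        rcases hA with hA | hA <;> rcases hB with hB | hB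
        · exact hQd hA hB hAB
        · exact hcross A hA B hB
        · exact (hcross B hB A hA).symm
        · exact hQ1d hA hB hAB
      · intro H hH
        rcases mem_union.1 hH with hH | hH
        · exact (hQL H hH).trans (union_subset_union (erase_subset _ _) subset_union_left)
        · exact (hQ1D H hH).trans hDL
      · intro z hz hzX
        have hzY : z ∉ Y := fun h => hzX (mem_union_right _ h)
        have key : z ∈ D → ∃ H ∈ Q ∪ Q1, z ∈ H := by
          intro h
          obtain ⟨H, hH, hzH⟩ := hQ1c z (mem_sdiff.2 ⟨h, fun h' => hzY (hc'Y h')⟩)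
          exact ⟨H, mem_union_right _ hH, hzH⟩
        by_cases hzQ : z ∈ Q.biUnion id
        · obtain ⟨H, hH, hzH⟩ := mem_biUnion.1 hzQ
          exact ⟨H, mem_union_left _ hH, hzH⟩
        by_cases hzx : z = x
        · subst hzx
          refine key (mem_union_right _ (mem_union_left _ (mem_inter.2 ⟨mem_singleton_self _, ?_⟩)))
          rcases mem_union.1 hz with h | h
          · exact h
          · exact absurd h (disjoint_left.1 hXR' (mem_insert_self _ _))
        by_cases hzZ : z ∈ Z
        · exact key (mem_union_left _ (mem_sdiff.2 ⟨hzZ, hzQ⟩))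
        · have hz2 : z ∈ L.erase x ∪ R := by
            simp only [mem_union, mem_erase] at hz ⊢
            tauto
          obtain ⟨H, hH, hzH⟩ := hQc z hz2 fun h => hzX (mem_union_left _ (mem_sdiff.2 ⟨h, hzZ⟩))
          exact ⟨H, mem_union_left _ hH, hzH⟩
    refine ⟨R ∪ Y, ℋ ∪ 𝒩, (X' \ Z) ∪ Y, fun S => ⟨hXR', ?_, ?_, ?_, ?_, ?_, ?_, ?_⟩,
      ?_, ?_, ?_, ?_, ?_, ?_, ?_, ?_⟩
    · intro z hz
      rcases mem_union.1 hz with hz | hz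
      · exact hR0.unif z hz
      · rw [hYg z hz]; exact hX x (mem_insert_self _ _)
    · exact hR0.rdiv.union (sDiv_of_parallel hch hYg (by rw [hYcard]) _) hYR.symm
    · intro H hH
      rcases mem_union.1 hH with hH | hH
      · exact (hR0.sub H hH).trans (union_subset_union (subset_insert _ _) subset_union_left)
      · refine (mem_powersetCard.1 hH).1.trans ?_
        refine union_subset ((hZR.trans subset_union_left).trans subset_union_right)
          (union_subset ?_ (subset_union_right.trans subset_union_right))
        rw [singleton_subset_iff]
        exact mem_union_left _ (mem_insert_self _ _)
    · intro H hH
      rcases mem_union.1 hH with hH | hH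
      · exact hR0.hdiv H hH
      · exact sDiv_of_parallel hch (hHg H hH) (by rw [hHc H hH]) _
    · intro H hH
      rcases mem_union.1 hH with hH | hH
      · exact hR0.hcard H hH
      · rw [hHc H hH]; exact hmK
    · intro z
      refine (cnt_union_le _ _ _).trans ?_
      by_cases hz : z ∈ Z ∪ ({x} ∪ Y)
      · have h1 : cnt ℋ z ≤ K := by
          by_cases hzZ : z ∈ Z
          · exact hcX' z (mem_filter.1 hzZ).1
          · rw [hR0.cnt_zero]
            · exact Nat.zero_le _
            · simp only [mem_union, mem_singleton, hzZ, false_or] at hz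
              rcases hz with rfl | hz
              · simp [hx, hxR]
              · intro h
                rcases mem_union.1 h with h | h
                · exact disjoint_left.1 hYX hz (mem_insert_of_mem h)
                · exact disjoint_left.1 hYR hz h
        have := hcn z
        omega
      · rw [hcn0 z hz, add_zero]
        exact hR0.hcnt z
    · intro L hL _
      obtain ⟨Q, h1, h2, h3, h4⟩ := hcov' L hL
      exact ⟨Q, h1, h2, h3, fun z hz _ hzX => h4 z hz hzX⟩
    · exact hcov'
    · intro H hH
      rcases mem_union.1 hH with hH | hH
      · have : H ∩ insert x X = H ∩ X := by
          rw [inter_insert_of_notMem]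
          intro hxH
          rcases mem_union.1 (hR0.sub H hH hxH) with h | h
          exacts [hx h, hxR h]
        rw [this]; exact hT H hH
      · have : H ∩ insert x X ⊆ {x} := by
          intro z hz
          rw [mem_inter] at hz
          have h1 := (mem_powersetCard.1 hH).1 hz.1
          simp only [mem_union, mem_singleton] at h1
          rcases h1 with h1 | h1 | h1
          · exact absurd (mem_union_left Y (hZR h1)) (disjoint_left.1 hXR' hz.2)
          · simpa using h1
          · exact absurd (mem_union_right R h1) (disjoint_left.1 hXR' hz.2)
        exact (card_le_card this).trans (by simp)
    · rw [disjoint_union_left]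
      exact ⟨disjoint_of_subset_right (subset_insert _ _) hA, hYA⟩
    · exact union_subset_union (sdiff_subset.trans hX'R) subset_rfl
    · intro e
      by_cases he : e = g
      · subst he
        have : filter (fun x => x.1 = g) (X' \ Z ∪ Y) ⊆ Y := by
          intro z hz
          simp only [mem_filter, mem_union, mem_sdiff, hZ] at hz
          tauto
        exact (card_le_card this).trans hYcard.le
      · have : filter (fun x => x.1 = e) (X' \ Z ∪ Y) ⊆ X'.filter fun x => x.1 = e := by
          intro z hz
          simp only [mem_filter, mem_union, mem_sdiff] at hz ⊢
          rcases hz with ⟨hz | hz, hze⟩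
          · exact ⟨hz.1, hze⟩
          · exact absurd (hze.symm.trans (hYg z hz)) he
        exact (card_le_card this).trans (hmult e)
    · intro z hz
      refine (cnt_union_le _ _ _).trans ?_
      rcases mem_union.1 hz with hz | hz
      · rw [mem_sdiff] at hz
        rw [hcn0 z, add_zero]
        · exact hcX' z hz.1
        · intro h
          exact hz.2 (mem_filter.2 ⟨hz.1, hBg z h⟩)
      · rw [hR0.cnt_zero, zero_add]
        · exact hcn z
        · intro h
          rcases mem_union.1 h with h | h
          · exact disjoint_left.1 hYX hz (mem_insert_of_mem h)
          · exact disjoint_left.1 hYR hz h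
    · intro z hz
      rcases mem_union.1 hz with hz | hz
      · obtain ⟨y, hy, hzy⟩ := hRX z hz
        exact ⟨y, mem_insert_of_mem hy, hzy⟩
      · exact ⟨x, mem_insert_self _ _, hYg z hz⟩
    · intro c hc
      refine (Cost_union_le hc _ _ _ _).trans ?_
      rw [sum_insert hx]
      have h1 := hcost c hc
      have h2 : Cost c Y 𝒩 ≤ (K + m : ℕ) * c g := by
        unfold Cost
        have e1 : ∑ H ∈ 𝒩, c (verts H) = 𝒩.card * c g := by
          rw [sum_congr rfl (g := fun _ => c g), sum_const, nsmul_eq_mul]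
          intro H hH
          rw [verts_eq_of_forall (card_pos.1 (by rw [hHc H hH]; omega)) (hHg H hH)]
        have e2 : ∑ z ∈ Y, c z.1 = m * c g := by
          rw [sum_congr rfl (g := fun _ => c g), sum_const, nsmul_eq_mul, hYcard]
          intro z hz
          rw [hYg z hz]
        rw [e1, e2]
        push_cast
        have : (𝒩.card : ℝ) ≤ K := by exact_mod_cast h𝒩c
        nlinarith [hc g]
      rw [mul_add]
      linarith
end Parallel
end RefineDown

/-! ### Weights, revealed windows and the exponential potential -/

namespace RefineDown
open Finset
section Potential
variable {V : Type u} [DecidableEq V]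

/-- The weight of the part of the test set `T` that is missed by `A`. -/
def kap (θ : V → ℝ) (T A : Finset V) : ℝ := ∏ y ∈ T \ A, θ y

/-- The total weight at `T` of the edges in `X`. -/
def load (θ : V → ℝ) (X : Finset (Lab V)) (T : Finset V) : ℝ := ∑ x ∈ X, kap θ T x.1

lemma kap_nonneg {θ : V → ℝ} (h : ∀ y, 0 ≤ θ y) (T A : Finset V) : 0 ≤ kap θ T A :=
  prod_nonneg fun y _ => h y

lemma kap_le_one {θ : V → ℝ} (h : ∀ y, 0 ≤ θ y) (h1 : ∀ y, θ y ≤ 1) (T A : Finset V) :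
    kap θ T A ≤ 1 := prod_le_one (fun y _ => h y) fun y _ => h1 y

lemma kap_mono {θ θ' : V → ℝ} (h : ∀ y, 0 ≤ θ y) (h1 : ∀ y, θ y ≤ θ' y) (T A : Finset V) :
    kap θ T A ≤ kap θ' T A := prod_le_prod (fun y _ => h y) fun y _ => h1 y

lemma kap_anti {θ : V → ℝ} (h : ∀ y, 0 ≤ θ y) (h1 : ∀ y, θ y ≤ 1) (T : Finset V)
    {A B : Finset V} (hAB : A ⊆ B) : kap θ T A ≤ kap θ T B :=
  prod_le_prod_of_subset_of_le_one (sdiff_subset_sdiff subset_rfl hAB) (fun y _ => h y)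
    fun y _ _ => h1 y

lemma load_nonneg {θ : V → ℝ} (h : ∀ y, 0 ≤ θ y) (X : Finset (Lab V)) (T : Finset V) :
    0 ≤ load θ X T := sum_nonneg fun _ _ => kap_nonneg h _ _

lemma load_mono {θ : V → ℝ} (h : ∀ y, 0 ≤ θ y) {X X' : Finset (Lab V)} (hX : X ⊆ X')
    (T : Finset V) : load θ X T ≤ load θ X' T :=
  sum_le_sum_of_subset_of_nonneg hX fun _ _ _ => kap_nonneg h _ _

lemma load_union_le {θ : V → ℝ} (h : ∀ y, 0 ≤ θ y) (X X' : Finset (Lab V))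
    (T : Finset V) : load θ (X ∪ X') T ≤ load θ X T + load θ X' T :=
  sum_union_le_add (f := fun x : Lab V => kap θ T x.1) (fun _ => kap_nonneg h _ _) _ _

lemma load_le_Cost {θ : V → ℝ} (h : ∀ y, 0 ≤ θ y) (R : Finset (Lab V))
    (ℋ : Finset (Finset (Lab V))) (T : Finset V) : load θ R T ≤ Cost (kap θ T) R ℋ :=
  Cost_le_of_subset (c := kap θ T) fun _ => kap_nonneg h _ _

/-- The contributions of the edges are grouped by their intersection with `T`. -/
lemma load_le_sum {θ : V → ℝ} (h : ∀ y, 0 ≤ θ y) (X : Finset (Lab V)) (T : Finset V) :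
    load θ X T ≤ ∑ J ∈ T.powerset, (ldeg X J : ℝ) * ∏ y ∈ T \ J, θ y := by
  have e : ∀ J ∈ T.powerset, (ldeg X J : ℝ) * ∏ y ∈ T \ J, θ y
      = ∑ x ∈ X, if J ⊆ x.1 then ∏ y ∈ T \ J, θ y else 0 := by
    intro J _
    rw [← sum_filter, sum_const, nsmul_eq_mul, ldeg]
  rw [sum_congr rfl e, sum_comm]
  refine sum_le_sum fun x _ => ?_
  have : kap θ T x.1 = if T ∩ x.1 ⊆ x.1 then ∏ y ∈ T \ (T ∩ x.1), θ y else 0 := by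
    rw [if_pos inter_subset_right, kap, sdiff_inter_self_left]
  rw [this]
  exact single_le_sum (f := fun J => if J ⊆ x.1 then ∏ y ∈ T \ J, θ y else 0)
    (fun J _ => by split_ifs; exacts [prod_nonneg fun y _ => h y, le_rfl])
    (mem_powerset.2 inter_subset_left)

/-- While `U` has fewer than r-1 vertices, an edge containing it has a further vertex in `W`, which
costs a factor `W.card`; at size r-1 the degree bound `G` takes over. -/
lemma ldeg_le_pow {r G : ℕ} {S W : Finset V} {X : Finset (Lab V)} (hS : S.card < r)
    (hX : ∀ x ∈ X, x.1.card = r ∧ x.1 ⊆ S ∪ W)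
    (hG : ∀ T, S ⊆ T → T.card = r - 1 → ldeg X T ≤ G) :
    ∀ (k : ℕ) (U : Finset V), S ⊆ U → r - 1 - U.card = k → ldeg X U ≤ G * W.card ^ k := by
  intro k
  induction k with
  | zero =>
    intro U hSU hU
    have h1 : S.card ≤ r - 1 := Nat.le_sub_one_of_lt hS
    have h2 : r - 1 ≤ U.card := Nat.sub_eq_zero_iff_le.1 hU
    obtain ⟨T, hST, hTU, hT⟩ := exists_subsuperset_card_eq hSU h1 h2
    simpa using (ldeg_anti X hTU).trans (hG T hST hT)
  | succ k ih =>
    intro U hSU hU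
    have : ldeg X U ≤ ∑ y ∈ W \ U, ldeg X (insert y U) := by
      unfold ldeg
      have hb := card_biUnion_le (s := W \ U)
        (t := fun y => X.filter fun x : Lab V => insert y U ⊆ x.1)
      refine le_trans (card_le_card ?_) hb
      intro x hx
      rw [mem_filter] at hx
      have hlt : U.card < x.1.card := by
        have := (hX x hx.1).1
        omega
      obtain ⟨y, hyx, hyU⟩ := exists_mem_notMem_of_card_lt_card hlt
      rw [mem_biUnion]
      refine ⟨y, mem_sdiff.2 ⟨?_, hyU⟩, mem_filter.2 ⟨hx.1, insert_subset hyx hx.2⟩⟩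
      exact (mem_union.1 ((hX x hx.1).2 hyx)).resolve_left fun h => hyU (hSU h)
    refine this.trans ?_
    calc ∑ y ∈ W \ U, ldeg X (insert y U) ≤ ∑ y ∈ W \ U, G * W.card ^ k := by
          refine sum_le_sum fun y hy => ih _ (hSU.trans (subset_insert _ _)) ?_
          rw [card_insert_of_notMem (mem_sdiff.1 hy).2]; omega
      _ ≤ W.card * (G * W.card ^ k) := by
          rw [sum_const, smul_eq_mul]
          exact Nat.mul_le_mul_right _ (card_le_card sdiff_subset)
      _ = _ := by ring

/-- A bound for the load of a set of edges of small degree, for weights at most `1 / m`. -/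
lemma load_le_of_deg {r G m : ℕ} {S W : Finset V} {X : Finset (Lab V)} {θ : V → ℝ}
    (hm : 1 ≤ m) (hmW : m ≤ W.card) (hSX : ∀ x ∈ X, S ⊆ x.1)
    (hdeg : ∀ U, S ⊆ U → ldeg X U ≤ G * W.card ^ (r - 1 - U.card))
    (hθ : ∀ y, 0 ≤ θ y) (hθm : ∀ y, θ y ≤ 1 / m) {T : Finset V} (hT : T.card = r - 1) :
    load θ X T ≤ 2 ^ (r - 1) * G * ((W.card : ℝ) / m) ^ (r - 1 - S.card) := by
  have hm0 : (0 : ℝ) < m := by exact_mod_cast hm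
  have hWm : 1 ≤ (W.card : ℝ) / m := by
    rw [le_div_iff₀ hm0, one_mul]; exact_mod_cast hmW
  refine (load_le_sum hθ X T).trans ?_
  -- Edges containing `J` also contain `S`. The degree bound contributes |W| for each vertex missing
  -- from `J ∪ S`, and the weights contribute at least as many factors 1/m.
  have key : ∀ J ∈ T.powerset, (ldeg X J : ℝ) * ∏ y ∈ T \ J, θ y
      ≤ G * ((W.card : ℝ) / m) ^ (r - 1 - S.card) := by
    intro J hJ
    have hJT := mem_powerset.1 hJ
    have e1 : ldeg X J = ldeg X (J ∪ S) := by
      unfold ldeg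
      congr 1
      refine filter_congr fun x hx => ?_
      rw [union_subset_iff, and_iff_left (hSX x hx)]
    have e2 : (ldeg X J : ℝ) ≤ G * (W.card : ℝ) ^ (r - 1 - (J ∪ S).card) := by
      rw [e1]; exact_mod_cast hdeg _ subset_union_right
    have e3 : ∏ y ∈ T \ J, θ y ≤ (1 / m : ℝ) ^ (r - 1 - (J ∪ S).card) := by
      refine (prod_le_prod (fun y _ => hθ y) fun y _ => hθm y).trans ?_
      rw [prod_const]
      refine pow_le_pow_of_le_one (by positivity) ?_ ?_
      · rw [div_le_one hm0]; exact_mod_cast hm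
      · rw [card_sdiff_of_subset hJT, hT]
        have := card_le_card (subset_union_left (s₁ := J) (s₂ := S))
        omega
    calc (ldeg X J : ℝ) * ∏ y ∈ T \ J, θ y
        ≤ (G * (W.card : ℝ) ^ (r - 1 - (J ∪ S).card)) * (1 / m : ℝ) ^ (r - 1 - (J ∪ S).card) :=
          mul_le_mul e2 e3 (prod_nonneg fun y _ => hθ y) (by positivity)
      _ = G * ((W.card : ℝ) / m) ^ (r - 1 - (J ∪ S).card) := by
          rw [mul_assoc, ← mul_pow, mul_one_div]
      _ ≤ _ := by
          refine mul_le_mul_of_nonneg_left (pow_le_pow_right₀ hWm ?_) (Nat.cast_nonneg _)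
          have := card_le_card (subset_union_right (s₁ := J) (s₂ := S))
          omega
  calc _ ≤ ∑ J ∈ T.powerset, G * ((W.card : ℝ) / m) ^ (r - 1 - S.card) := sum_le_sum key
    _ = _ := by
      rw [sum_const, card_powerset, hT, nsmul_eq_mul]; push_cast; ring

/-- `θ` with the value on `W` replaced by `1 / |W|`. -/
noncomputable def reveal (θ : V → ℝ) (W : Finset V) (y : V) : ℝ :=
  if y ∈ W then 1 / (W.card : ℝ) else θ y

/-- `θ` is a weight for the window `W`. -/
structure Weight (W : Finset V) (θ : V → ℝ) : Prop where
  nonneg : ∀ y, 0 ≤ θ y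
  le : ∀ y, θ y ≤ 1 / (W.card : ℝ)
  eq : ∀ y ∈ W, θ y = 1 / (W.card : ℝ)

omit [DecidableEq V] in
lemma Weight.le_one {W : Finset V} {θ : V → ℝ} (h : Weight W θ) (y : V) : θ y ≤ 1 := by
  refine (h.le y).trans ?_
  rcases Nat.eq_zero_or_pos W.card with h0 | h0
  · simp [h0]
  · rw [div_le_one (by exact_mod_cast h0)]; exact_mod_cast h0

lemma Weight.reveal {W W' : Finset V} {θ : V → ℝ} (h : Weight W θ) (hW : W' ⊆ W)
    (hne : 1 ≤ W'.card) : Weight W' (reveal θ W') := by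
  have : ∀ y, θ y ≤ 1 / (W'.card : ℝ) := fun y => (h.le y).trans (by
    gcongr)
  refine ⟨fun y => ?_, fun y => ?_, fun y hy => ?_⟩
  · unfold RefineDown.reveal; split_ifs
    · positivity
    · exact h.nonneg y
  · unfold RefineDown.reveal; split_ifs
    · exact le_rfl
    · exact this y
  · simp [RefineDown.reveal, hy]

/-- Revealing a window only raises weights, so a cost bound for the revealed weight is also one for
`θ`. -/
lemma Weight.le_reveal {W W' : Finset V} {θ : V → ℝ} (h : Weight W θ) (hW : W' ⊆ W)
    (y : V) : θ y ≤ RefineDown.reveal θ W' y := by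
  unfold RefineDown.reveal; split_ifs with hy
  · refine (h.le y).trans ?_
    have : 0 < W'.card := card_pos.2 ⟨y, hy⟩
    gcongr
  · exact le_rfl

/-- In other terms, a random `m`-subset of an `n`-set contains a given `j`-set with probability at
most (m/n)^j. Each further vertex changes the ratio of binomials by at most m/n. -/
lemma choose_sub_mul_pow_le {n m : ℕ} (hmn : m ≤ n) :
    ∀ j ≤ m, (n - j).choose (m - j) * n ^ j ≤ m ^ j * n.choose m := by
  intro j
  induction j with
  | zero => simp
  | succ j ih =>
    intro hj
    have ih := ih (by omega)
    obtain ⟨a, ha⟩ : ∃ a, n - j = a + 1 := ⟨n - j - 1, by omega⟩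
    obtain ⟨b, hb⟩ : ∃ b, m - j = b + 1 := ⟨m - j - 1, by omega⟩
    have h1 : n - (j + 1) = a := by omega
    have h2 : m - (j + 1) = b := by omega
    rw [ha, hb] at ih
    rw [h1, h2]
    have h3 := Nat.add_one_mul_choose_eq a b
    have h4 : n * (b + 1) ≤ m * (a + 1) := by
      have e1 : n = a + 1 + j := by omega
      have e2 : m = b + 1 + j := by omega
      have : b ≤ a := by omega
      rw [e1, e2]; nlinarith
    have h5 : a.choose b * n ≤ m * (a + 1).choose (b + 1) := by
      refine Nat.le_of_mul_le_mul_left (c := a + 1) ?_ (by omega)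
      calc (a + 1) * (a.choose b * n) = (a + 1).choose (b + 1) * (n * (b + 1)) := by
            rw [← mul_assoc, h3]; ring
        _ ≤ (a + 1).choose (b + 1) * (m * (a + 1)) := Nat.mul_le_mul_left _ h4
        _ = _ := by ring
    calc a.choose b * n ^ (j + 1) = (a.choose b * n) * n ^ j := by ring
      _ ≤ (m * (a + 1).choose (b + 1)) * n ^ j := Nat.mul_le_mul_right _ h5
      _ = m * ((a + 1).choose (b + 1) * n ^ j) := by ring
      _ ≤ m * (m ^ j * n.choose m) := Nat.mul_le_mul_left _ ih
      _ = _ := by ring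

lemma card_supersets_mul_pow_le {W : Finset V} {m : ℕ} (hm : m ≤ W.card) {J : Finset V}
    (hJ : J ⊆ W) : ((W.powersetCard m).filter fun W' => J ⊆ W').card * W.card ^ J.card
      ≤ m ^ J.card * W.card.choose m := by
  by_cases hJm : J.card ≤ m
  · rw [card_filter_powersetCard_subset _ _ _ hJ hJm]
    exact choose_sub_mul_pow_le hm _ hJm
  · rw [filter_false_of_mem]
    · simp
    · intro W' hW' hJW
      exact hJm ((card_le_card hJW).trans (mem_powersetCard.1 hW').2.le)

/-- A vertex of `W` enters the random window with probability about m/|W|, and its weight then grows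
by |W|/m, so revealing is harmless on average. The loss `2 ^ T.card` comes from expanding over the
subsets of the missed part of `T`. -/
lemma sum_kap_reveal_le {W : Finset V} {θ : V → ℝ} (hθ : Weight W θ) {m : ℕ} (hm1 : 1 ≤ m)
    (hm : m ≤ W.card) (T A : Finset V) :
    ∑ W' ∈ W.powersetCard m, kap (reveal θ W') T A
      ≤ (W.powersetCard m).card * (2 ^ T.card * kap θ T A) := by
  have hm0 : (0 : ℝ) < m := by exact_mod_cast hm1
  have hn0 : (0 : ℝ) < W.card := hm0.trans_le (by exact_mod_cast hm)
  have hκ := kap_nonneg hθ.nonneg T A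
  -- The growth factor is |W|/m to the number of missed vertices in `W'`. It is one term of a sum
  -- over subsets `J` of `(T \ A) ∩ W`, and each `J` contributes at most 1 on average by `h2`.
  have h1 : ∀ W' ∈ W.powersetCard m, kap (reveal θ W') T A
      ≤ kap θ T A * ∑ J ∈ ((T \ A) ∩ W).powerset,
        if J ⊆ W' then ((W.card : ℝ) / m) ^ J.card else 0 := by
    intro W' hW'
    obtain ⟨hW'W, hW'm⟩ := mem_powersetCard.1 hW'
    have e1 : kap (reveal θ W') T A = kap θ T A * ((W.card : ℝ) / m) ^ ((T \ A) ∩ W').card := by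
      unfold kap
      have := prod_ite_mem (T \ A) W' fun _ => (W.card : ℝ) / m
      rw [← prod_const, ← this, ← prod_mul_distrib]
      refine prod_congr rfl fun y _ => ?_
      unfold reveal
      by_cases hy : y ∈ W'
      · rw [if_pos hy, if_pos hy, hθ.eq y (hW'W hy), hW'm]
        field_simp
      · rw [if_neg hy, if_neg hy, mul_one]
    rw [e1]
    refine mul_le_mul_of_nonneg_left ?_ hκ
    have : ((W.card : ℝ) / m) ^ ((T \ A) ∩ W').card
        = if (T \ A) ∩ W' ⊆ W' then ((W.card : ℝ) / m) ^ ((T \ A) ∩ W').card else 0 := by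
      rw [if_pos inter_subset_right]
    rw [this]
    refine single_le_sum (f := fun J => if J ⊆ W' then ((W.card : ℝ) / m) ^ J.card else 0)
      (fun J _ => by
        split_ifs
        exacts [pow_nonneg (div_nonneg hn0.le hm0.le) _, le_rfl])
      (mem_powerset.2 (inter_subset_inter_left hW'W))
  have h2 : ∀ J ∈ ((T \ A) ∩ W).powerset, ∑ W' ∈ W.powersetCard m,
      (if J ⊆ W' then ((W.card : ℝ) / m) ^ J.card else 0) ≤ (W.powersetCard m).card := by
    intro J hJ
    have hJW : J ⊆ W := (mem_powerset.1 hJ).trans inter_subset_right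
    have hmJ : (0 : ℝ) < (m : ℝ) ^ J.card := pow_pos hm0 _
    rw [← sum_filter, sum_const, nsmul_eq_mul, div_pow, ← mul_div_assoc, div_le_iff₀ hmJ,
      card_powersetCard, mul_comm (_ : ℝ) ((m : ℝ) ^ _)]
    exact_mod_cast card_supersets_mul_pow_le hm hJW
  calc _ ≤ ∑ W' ∈ W.powersetCard m, kap θ T A * ∑ J ∈ ((T \ A) ∩ W).powerset,
        (if J ⊆ W' then ((W.card : ℝ) / m) ^ J.card else 0) := sum_le_sum h1
    _ = kap θ T A * ∑ J ∈ ((T \ A) ∩ W).powerset, ∑ W' ∈ W.powersetCard m,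
        (if J ⊆ W' then ((W.card : ℝ) / m) ^ J.card else 0) := by
        rw [← mul_sum, sum_comm]
    _ ≤ kap θ T A * ∑ J ∈ ((T \ A) ∩ W).powerset, ((W.powersetCard m).card : ℝ) :=
        mul_le_mul_of_nonneg_left (sum_le_sum h2) hκ
    _ = (W.powersetCard m).card * (2 ^ ((T \ A) ∩ W).card * kap θ T A) := by
        rw [sum_const, card_powerset, nsmul_eq_mul]; push_cast; ring
    _ ≤ _ := by
        gcongr
        · norm_num
        · exact inter_subset_left.trans sdiff_subset

omit [DecidableEq V]
variable [Fintype V]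

/-- The potential of a cost function on the `(r-1)`-sets. -/
noncomputable def Pot (r : ℕ) (w f : Finset V → ℝ) : ℝ :=
  ∑ T ∈ (univ : Finset V).powersetCard (r - 1), w T * Real.exp (f T)

lemma Pot_mono {r : ℕ} {w f g : Finset V → ℝ} (hw : ∀ T, 0 ≤ w T)
    (h : ∀ T, T.card = r - 1 → f T ≤ g T) : Pot r w f ≤ Pot r w g :=
  sum_le_sum fun T hT => mul_le_mul_of_nonneg_left
    (Real.exp_le_exp.2 (h T (mem_powersetCard.1 hT).2)) (hw T)

lemma Pot_add (r : ℕ) (w f g : Finset V → ℝ) :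
    Pot r w (fun T => f T + g T) = Pot r (fun T => w T * Real.exp (f T)) g :=
  sum_congr rfl fun T _ => by rw [Real.exp_add]; ring

/-- Some outcome is as good as twice the average. -/
lemma exists_Pot_le {ι : Type*} {r : ℕ} {w : Finset V → ℝ} (hw : ∀ T, 0 ≤ w T) {Ω : Finset ι}
    (hΩ : Ω.Nonempty) (f : ι → Finset V → ℝ) (g : Finset V → ℝ)
    (h0 : ∀ ω ∈ Ω, ∀ T, T.card = r - 1 → 0 ≤ f ω T)
    (h1 : ∀ ω ∈ Ω, ∀ T, T.card = r - 1 → f ω T ≤ 1)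
    (hg : ∀ T, T.card = r - 1 → ∑ ω ∈ Ω, f ω T ≤ Ω.card * g T) :
    ∃ ω ∈ Ω, Pot r w (f ω) ≤ Pot r w fun T => 2 * g T := by
  -- For exponents in [0,1] the exponential lies below a chord of slope 2, and 1 + 2g ≤ exp(2g):
  -- hence the hypothesis `h1` and the factor 2 in the conclusion.
  have hexp : ∀ x : ℝ, 0 ≤ x → x ≤ 1 → Real.exp x ≤ 1 + 2 * x := by
    intro x hx0 hx1
    have h := Real.abs_exp_sub_one_le (x := x) (by rw [abs_of_nonneg hx0]; exact hx1)
    rw [abs_of_nonneg hx0] at h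
    linarith [le_abs_self (Real.exp x - 1)]
  refine exists_le_of_sum_le hΩ ?_
  unfold Pot
  rw [sum_comm, sum_const, nsmul_eq_mul, mul_sum]
  refine sum_le_sum fun T hT => ?_
  have hTc := (mem_powersetCard.1 hT).2
  rw [← mul_sum, mul_left_comm]
  refine mul_le_mul_of_nonneg_left ?_ (hw T)
  calc ∑ ω ∈ Ω, Real.exp (f ω T) ≤ ∑ ω ∈ Ω, (1 + 2 * f ω T) :=
        sum_le_sum fun ω hω => hexp _ (h0 ω hω T hTc) (h1 ω hω T hTc)
    _ = Ω.card + 2 * ∑ ω ∈ Ω, f ω T := by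
        rw [sum_add_distrib, ← mul_sum]; simp
    _ ≤ Ω.card + 2 * (Ω.card * g T) := by linarith [hg T hTc]
    _ = Ω.card * (2 * g T + 1) := by ring
    _ ≤ _ := mul_le_mul_of_nonneg_left (Real.add_one_le_exp _) (Nat.cast_nonneg _)

variable [DecidableEq V]

/-- A smaller window can be revealed at the price of a constant factor. -/
theorem exists_reveal {r m : ℕ} (hr : 1 ≤ r) {w : Finset V → ℝ} (hw : ∀ T, 0 ≤ w T) {W : Finset V} {θ : V → ℝ}
    (hθ : Weight W θ) (hm1 : 1 ≤ m) (hm : m ≤ W.card) (X : Finset (Lab V)) {a : ℝ} (ha : 0 ≤ a)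
    (hload : ∀ W' ∈ W.powersetCard m, ∀ T, T.card = r - 1 → a * load (reveal θ W') X T ≤ 1) :
    ∃ W' ⊆ W, W'.card = m ∧ Pot r w (fun T => a * load (reveal θ W') X T)
      ≤ Pot r w fun T => 2 ^ r * a * load θ X T := by
  have hc : ∀ W' ∈ W.powersetCard m, Weight W' (reveal θ W') := fun W' hW' =>
    hθ.reveal (mem_powersetCard.1 hW').1 (by rw [(mem_powersetCard.1 hW').2]; exact hm1)
  -- The averaging bound gives 2^(r-1), as |T| = r-1; the factor 2 of `exists_Pot_le` turns it into
  -- 2^r.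
  obtain ⟨W', hW', hP⟩ := exists_Pot_le (r := r) hw (powersetCard_nonempty.2 hm)
    (fun W' T => a * load (reveal θ W') X T) (fun T => 2 ^ (r - 1) * a * load θ X T)
    (fun W' hW' T _ => mul_nonneg ha (load_nonneg (hc W' hW').nonneg _ _)) hload (by
      intro T hT
      rw [← mul_sum]
      unfold load
      rw [sum_comm]
      calc a * ∑ x ∈ X, ∑ W' ∈ W.powersetCard m, kap (reveal θ W') T x.1
          ≤ a * ∑ x ∈ X, (W.powersetCard m).card * (2 ^ T.card * kap θ T x.1) :=
            mul_le_mul_of_nonneg_left (sum_le_sum fun x _ => sum_kap_reveal_le hθ hm1 hm _ _) ha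
        _ = _ := by
            rw [← mul_sum, ← mul_sum, hT]; ring)
  refine ⟨W', (mem_powersetCard.1 hW').1, (mem_powersetCard.1 hW').2, hP.trans ?_⟩
  refine Pot_mono hw fun T _ => ?_
  have h2 : (2 : ℝ) ^ r = 2 * 2 ^ (r - 1) := by
    rw [← pow_succ', Nat.sub_add_cancel hr]
  rw [h2]
  apply le_of_eq
  ring

end Potential
end RefineDown

/-! ### Sweeping the vertices outside a smaller window -/

namespace RefineDown
open Finset
section Sweep
variable {V : Type u} [DecidableEq V] [Fintype V]

omit [Fintype V] in
lemma Thin.union {X X₂ R₂ : Finset (Lab V)} {ℋ ℋ₂ : Finset (Finset (Lab V))} (h : Thin X ℋ)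
    (h₂ : Thin X₂ ℋ₂) (hsub : ∀ H ∈ ℋ₂, H ⊆ X₂ ∪ R₂) (hd : Disjoint X R₂) :
    Thin X (ℋ ∪ ℋ₂) := by
  intro H hH
  rcases mem_union.1 hH with hH | hH
  · exact h H hH
  · refine (card_le_card ?_).trans (h₂ H hH)
    intro x hx
    rw [mem_inter] at hx ⊢
    refine ⟨hx.1, ?_⟩
    rcases mem_union.1 (hsub H hH hx.1) with h | h
    · exact h
    · exact absurd h (disjoint_left.1 hd hx.2)

/-- Refine, one after the other, the parts of the remainder given by the intersections of size `s`
with `B`. -/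
theorem exists_level {q r c s : ℕ} {S B : Finset V} {X R X' : Finset (Lab V)}
    {ℋ : Finset (Finset (Lab V))} {P : Lab V → Prop} {κ : Finset V → Finset V → ℝ}
    {p : Finset V → Finset V → ℝ} {a : ℝ} (ha : 0 ≤ a) (hκ : ∀ T A, 0 ≤ κ T A)
    (h : Ref q r (2 * c) S X R ℋ X') (hth : Thin X ℋ) (hX' : X' ⊆ X ∪ R)
    (hcnt : ∀ x ∈ X', cnt ℋ x ≤ c) (hs : ∀ x ∈ X', S ⊆ x.1 ∧ (x.1 ∩ B).card ≤ s)
    (unit : ∀ S' ⊆ B, S'.card = s → ∀ (w : Finset V → ℝ), (∀ T, 0 ≤ w T) →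
      ∀ A : Finset (Lab V), ∃ R₂ ℋ₂,
        Ref q r c (S ∪ S') (X'.filter fun x => x.1 ∩ B = S') R₂ ℋ₂ ∅ ∧
        Thin (X'.filter fun x => x.1 ∩ B = S') ℋ₂ ∧ Disjoint R₂ A ∧
        (∀ x ∈ R₂, x.1 ∩ B ⊆ S' ∧ P x) ∧
        Pot r w (fun T => a * Cost (κ T) R₂ ℋ₂) ≤ Pot r w (p S'))
    (A : Finset (Lab V)) :
    ∀ 𝒮 ⊆ B.powersetCard s, ∀ w : Finset V → ℝ, (∀ T, 0 ≤ w T) → ∃ R₂ ℋ₂ X'',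
      Ref q r (2 * c) S X (R ∪ R₂) (ℋ ∪ ℋ₂) X'' ∧
      (∀ x ∈ X'', (x ∈ X' ∧ x.1 ∩ B ∉ 𝒮) ∨ (x ∈ R₂ ∧ S ⊆ x.1 ∧ (x.1 ∩ B).card < s)) ∧
      (∀ x ∈ X', x.1 ∩ B ∉ 𝒮 → x ∈ X'') ∧
      Thin X (ℋ ∪ ℋ₂) ∧ Disjoint R₂ A ∧ Disjoint R₂ (X ∪ R) ∧
      (∀ x ∈ R₂, (x.1 ∩ B).card ≤ s ∧ P x) ∧ (∀ x ∈ X'', cnt (ℋ ∪ ℋ₂) x ≤ c) ∧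
      Pot r w (fun T => a * Cost (κ T) R₂ ℋ₂) ≤ Pot r w (fun T => ∑ S' ∈ 𝒮, p S' T) := by
  intro 𝒮
  induction 𝒮 using Finset.induction_on with
  | empty =>
    intro _ w _
    refine ⟨∅, ∅, X', by simpa using h, fun x hx => Or.inl ⟨hx, by simp⟩, fun x hx _ => hx,
      by simpa using hth, by simp, by simp, by simp, by simpa using hcnt, by simp [Cost]⟩
  | insert S' 𝒮 hS' ih =>
    intro h𝒮 w hw
    obtain ⟨hS'B, hS's⟩ := mem_powersetCard.1 (h𝒮 (mem_insert_self _ _))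
    -- The earlier parts are refined against a weight that already contains the predicted cost `p
    -- S'` of the present one; the present part is then refined against a weight containing the
    -- actual cost of the earlier ones. Adaptive choices can thus be chained.
    obtain ⟨R₂, ℋ₂, X'', hR, hX1, hX2, hT, hA, hXR, hP, hcn, hpot⟩ :=
      ih ((subset_insert _ _).trans h𝒮) (fun T => w T * Real.exp (p S' T))
        (fun T => mul_nonneg (hw T) (Real.exp_nonneg _))
    obtain ⟨R₃, ℋ₃, uR, uT, uA, uP, upot⟩ := unit S' hS'B hS's
      (fun T => w T * Real.exp (a * Cost (κ T) R₂ ℋ₂))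
      (fun T => mul_nonneg (hw T) (Real.exp_nonneg _)) (A ∪ (X ∪ (R ∪ R₂)))
    rw [disjoint_union_right] at uA
    set X₂ := X'.filter fun x => x.1 ∩ B = S' with hX₂
    have hX₂XR : X₂ ⊆ X ∪ (R ∪ R₂) := by
      rw [← union_assoc]
      exact ((filter_subset _ _).trans hX').trans subset_union_left
    have hX₂X'' : X₂ ⊆ X'' := by
      intro x hx
      obtain ⟨hx, hxB⟩ := mem_filter.1 hx
      exact hX2 x hx (by rw [hxB]; exact hS')
    -- A new edge containing `S` but not all of `S'` meets `B` in a proper subset of `S'`, so it is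
    -- left to the lower levels.
    have hsub : ∀ x ∈ R₃, S ⊆ x.1 → ¬ S ∪ S' ⊆ x.1 → (x.1 ∩ B).card < s := by
      intro x hx hSx hn
      refine lt_of_le_of_ne ((card_le_card (uP x hx).1).trans hS's.le) fun he => hn ?_
      have := eq_of_subset_of_card_le (uP x hx).1 (by rw [he, hS's])
      exact union_subset hSx (this ▸ inter_subset_left)
    have hcross : ∀ x ∈ R₃, cnt (ℋ ∪ ℋ₂) x = 0 := fun x hx =>
      hR.cnt_zero fun hx' => disjoint_left.1 uA.2 hx hx'
    refine ⟨R₂ ∪ R₃, ℋ₂ ∪ ℋ₃, (X'' \ X₂) ∪ R₃.filter fun x => S ⊆ x.1 ∧ (x.1 ∩ B).card < s,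
      ?_, ?_, ?_, ?_, ?_, ?_, ?_, ?_, ?_⟩
    · rw [← union_assoc, ← union_assoc]
      refine hR.step (c := c) (fun x hx => hcn x (hX₂X'' hx)) uR subset_union_left hX₂XR ?_ ?_
        uA.2.symm le_rfl (by omega) ?_ (by simp) ?_
      · intro x hx
        obtain ⟨hx, hxB⟩ := mem_filter.1 hx
        exact union_subset (hs x hx).1 (hxB ▸ inter_subset_left)
      -- A remainder edge containing `S'` must belong to `X₂`: an original one meets `B` in at most
      -- `s` vertices, hence exactly in `S'`, and a new one meets `B` in fewer than `s` vertices.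
      · intro x hx hx2 hn
        have hS'x : S' ⊆ x.1 ∩ B := subset_inter (subset_union_right.trans hn) hS'B
        rcases hX1 x hx with ⟨hx', -⟩ | ⟨-, -, hlt⟩
        · exact hx2 (mem_filter.2 ⟨hx', (eq_of_subset_of_card_le hS'x
            (by rw [hS's]; exact (hs x hx').2)).symm⟩)
        · have := card_le_card hS'x
          omega
      · intro x hx _ hx2
        exact mem_union_left _ (mem_sdiff.2 ⟨hx, hx2⟩)
      · intro x hx hSx hn
        exact mem_union_right _ (mem_filter.2 ⟨hx, hSx, hsub x hx hSx hn⟩)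
    · intro x hx
      rcases mem_union.1 hx with hx | hx
      · obtain ⟨hx, hx2⟩ := mem_sdiff.1 hx
        rcases hX1 x hx with ⟨hx', hx𝒮⟩ | ⟨hx', hx3⟩
        · refine Or.inl ⟨hx', fun hm => ?_⟩
          rcases mem_insert.1 hm with hm | hm
          · exact hx2 (mem_filter.2 ⟨hx', hm⟩)
          · exact hx𝒮 hm
        · exact Or.inr ⟨mem_union_left _ hx', hx3⟩
      · obtain ⟨hx, hx3⟩ := mem_filter.1 hx
        exact Or.inr ⟨mem_union_right _ hx, hx3⟩
    · intro x hx hn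
      rw [mem_insert, not_or] at hn
      exact mem_union_left _ (mem_sdiff.2 ⟨hX2 x hx hn.2, fun h => hn.1 (mem_filter.1 h).2⟩)
    · rw [← union_assoc]
      refine hT.union (uT) uR.sub ?_
      exact (disjoint_of_subset_right subset_union_left uA.2).symm
    · exact disjoint_union_left.2 ⟨hA, uA.1⟩
    · refine disjoint_union_left.2 ⟨hXR, disjoint_of_subset_right ?_ uA.2⟩
      exact union_subset_union_right subset_union_left
    · intro x hx
      rcases mem_union.1 hx with hx | hx
      · exact hP x hx
      · exact ⟨(card_le_card (uP x hx).1).trans hS's.le, (uP x hx).2⟩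
    · intro x hx
      rw [← union_assoc]
      refine (cnt_union_le _ _ _).trans ?_
      rcases mem_union.1 hx with hx | hx
      · obtain ⟨hx, hx2⟩ := mem_sdiff.1 hx
        rw [uR.cnt_zero, add_zero]
        · exact hcn x hx
        · rw [mem_union, not_or]
          refine ⟨hx2, fun hx3 => disjoint_left.1 uA.2 hx3 ?_⟩
          rcases hX1 x hx with ⟨hx', -⟩ | ⟨hx', -⟩
          · rw [← union_assoc]; exact mem_union_left _ (hX' hx')
          · exact mem_union_right _ (mem_union_right _ hx')
      · rw [hcross x (mem_filter.1 hx).1, zero_add]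
        exact uR.hcnt x
    · calc Pot r w (fun T => a * Cost (κ T) (R₂ ∪ R₃) (ℋ₂ ∪ ℋ₃))
          ≤ Pot r w (fun T => a * Cost (κ T) R₂ ℋ₂ + a * Cost (κ T) R₃ ℋ₃) := by
            refine Pot_mono hw fun T _ => ?_
            rw [← mul_add]
            exact mul_le_mul_of_nonneg_left (Cost_union_le (hκ T) _ _ _ _) ha
        _ ≤ Pot r w (fun T => a * Cost (κ T) R₂ ℋ₂ + p S' T) := by
            rw [Pot_add, Pot_add]; exact upot
        _ = Pot r w (fun T => p S' T + a * Cost (κ T) R₂ ℋ₂) := by simp_rw [add_comm]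
        _ ≤ Pot r w (fun T => p S' T + ∑ S' ∈ 𝒮, p S' T) := by
            rw [Pot_add, Pot_add]; exact hpot
        _ = _ := by simp_rw [sum_insert hS']

/-- Edges containing `S` inside `S ∪ W` can be absorbed, uniformly in the window `W` of size at most
`N * ρ ^ k`. -/
def Absorbs (V : Type u) [DecidableEq V] [Fintype V] (q r N C k : ℕ) : Prop :=
  ∀ (ρ : ℕ) (S W : Finset V) (θ : V → ℝ) (w : Finset V → ℝ) (a : ℝ) (X A : Finset (Lab V)),
    1 ≤ ρ → Disjoint S W → 1 ≤ S.card → S.card ≤ r → N ≤ W.card → W.card ≤ N * ρ ^ k →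
    Weight W θ → (∀ T, 0 ≤ w T) → 0 ≤ a → a * C * (W.card * ρ ^ r) ≤ 1 →
    (∀ x ∈ X, x.1.card = r ∧ S ⊆ x.1 ∧ x.1 ⊆ S ∪ W) →
    ∃ R ℋ, Ref q r C S X R ℋ ∅ ∧ Thin X ℋ ∧ Disjoint R A ∧ (∀ x ∈ R, x.1 ⊆ S ∪ W) ∧
      Pot r w (fun T => a * Cost (kap θ T) R ℋ) ≤ Pot r w (fun T => a * C * load θ X T)

omit [Fintype V] in
lemma Ref.trivial (q r C : ℕ) (S : Finset V) (X : Finset (Lab V)) : Ref q r C S X ∅ ∅ X :=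
  ⟨by simp, by simp, fun T _ _ => by simp [ldeg], by simp, by simp, by simp, by simp [cnt],
    fun L hL _ => ⟨∅, by simp, by simp, by simp, fun x hx _ hxX =>
      absurd (hL (by simpa using hx)) hxX⟩⟩

/-- Edges inside `S ∪ W` are sorted by their trace `S'` on `W \ W'`. Edges with trace `S'` contain
`S ∪ S'` and otherwise use only vertices of `W'`, so the hypothesis applies to them with `S ∪ S'` in
place of `S`. The new edges have smaller traces or are covered, so r-|S|+1 levels, starting from
traces of size r-|S|, exhaust everything. -/
theorem Absorbs.sweep {q r N C k : ℕ} (hP : Absorbs V q r N C k) {ρ : ℕ} {S W W' : Finset V}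
    {θ : V → ℝ} {w : Finset V → ℝ} {a : ℝ} {X : Finset (Lab V)} (A : Finset (Lab V))
    (hρ : 1 ≤ ρ) (hSW : Disjoint S W) (hS1 : 1 ≤ S.card) (hSr : S.card ≤ r) (hW' : W' ⊆ W)
    (hN : N ≤ W'.card) (hk : W'.card ≤ N * ρ ^ k) (hθ : Weight W' θ) (hw : ∀ T, 0 ≤ w T)
    (ha : 0 ≤ a) (haC : a * (1 + C) ^ (r + 2) * (W'.card * ρ ^ r) ≤ 1)
    (hX : ∀ x ∈ X, x.1.card = r ∧ S ⊆ x.1 ∧ x.1 ⊆ S ∪ W) :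
    ∃ R ℋ, Ref q r (2 * C) S X R ℋ ∅ ∧ Thin X ℋ ∧ Disjoint R A ∧ (∀ x ∈ R, x.1 ⊆ S ∪ W) ∧
      Pot r w (fun T => a * Cost (kap θ T) R ℋ)
        ≤ Pot r w (fun T => a * (1 + C) ^ (r + 1) * load θ X T) := by
  have hC0 : (0 : ℝ) ≤ C := Nat.cast_nonneg _
  have hC1 : (1 : ℝ) ≤ 1 + C := by linarith
  set B := W \ W' with hB
  have hSB : Disjoint S B := disjoint_of_subset_right sdiff_subset hSW
  set Wρ : ℝ := W'.card * ρ ^ r with hWρ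
  have hWρ0 : 0 ≤ Wρ := by positivity
  have hκ : ∀ T A, 0 ≤ kap θ T A := fun T A => kap_nonneg hθ.nonneg T A
  have main : ∀ ℓ ≤ r - S.card + 1, ∀ (w : Finset V → ℝ) (a : ℝ), (∀ T, 0 ≤ w T) → 0 ≤ a →
      a * (1 + C) ^ (ℓ + 1) * Wρ ≤ 1 → ∃ R ℋ X', Ref q r (2 * C) S X R ℋ X' ∧ Thin X ℋ ∧
        Disjoint R A ∧ (∀ x ∈ R, x.1 ⊆ S ∪ W) ∧ X' ⊆ X ∪ R ∧
        (∀ x ∈ X', S ⊆ x.1 ∧ (x.1 ∩ B).card + ℓ ≤ r - S.card) ∧ (∀ x ∈ X', cnt ℋ x ≤ C) ∧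
        Pot r w (fun T => a * Cost (kap θ T) R ℋ)
          ≤ Pot r w (fun T => a * ((1 + C) ^ ℓ - 1) * load θ X T) := by
    intro ℓ
    induction ℓ with
    | zero =>
      intro _ w a _ _ _
      refine ⟨∅, ∅, X, Ref.trivial _ _ _ _ _, fun H hH => by simp at hH, by simp, by simp, by simp,
        fun x hx => ⟨(hX x hx).2.1, ?_⟩, by simp [cnt], by simp [Cost]⟩
      have h1 : x.1 ∩ B ⊆ x.1 \ S := fun y hy => by
        rw [mem_inter] at hy
        exact mem_sdiff.2 ⟨hy.1, fun h => disjoint_left.1 hSB h hy.2⟩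
      have h2 := card_le_card h1
      rw [card_sdiff_of_subset (hX x hx).2.1, (hX x hx).1] at h2
      simpa using h2
    | succ ℓ ih =>
      intro hℓ w a hw ha haC
      -- The next level costs at most `C` times the load of `X` and of the edges created so far. The
      -- first part is put into the weight, the second raises `a` to `a * (1 + C)`; this yields the
      -- factor (1+C)^ℓ - 1 by recursion.
      obtain ⟨R, ℋ, X', hR, hT, hA, hRW, hX', hs, hcnt, hpot⟩ := ih (by omega)
        (fun T => w T * Real.exp (a * C * load θ X T)) (a * (1 + C))
        (fun T => mul_nonneg (hw T) (Real.exp_nonneg _)) (by positivity)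
        (by rw [pow_succ'] at haC; linarith)
      have haC' : a * C * Wρ ≤ 1 := by
        refine le_trans ?_ haC
        gcongr
        calc (C : ℝ) ≤ (1 + C) ^ 1 := by linarith
          _ ≤ _ := pow_le_pow_right₀ hC1 (by omega)
      have hX'c : ∀ x ∈ X', x.1.card = r ∧ x.1 ⊆ S ∪ W := by
        intro x hx
        rcases mem_union.1 (hX' hx) with h | h
        · exact ⟨(hX x h).1, (hX x h).2.2⟩
        · exact ⟨hR.unif x h, hRW x h⟩
      obtain ⟨R₂, ℋ₂, X'', h2R, h2X, -, h2T, h2A, h2XR, h2P, h2cnt, h2pot⟩ :=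
        exists_level (S := S) (B := B) (s := r - S.card - ℓ) (P := fun x => x.1 ⊆ S ∪ W)
          (κ := kap θ) (a := a)
          (p := fun S' T => a * C * load θ (X'.filter fun x => x.1 ∩ B = S') T) ha hκ hR hT hX' hcnt
          (fun x hx => ⟨(hs x hx).1, by have := (hs x hx).2; omega⟩)
          (by
            intro S' hS'B hS's w hw A
            have hSS' : (S ∪ S').card = S.card + S'.card :=
              card_union_of_disjoint (disjoint_of_subset_right hS'B hSB)
            obtain ⟨R₂, ℋ₂, u1, u2, u3, u4, u5⟩ := hP ρ (S ∪ S') W' θ w a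
              (X'.filter fun x => x.1 ∩ B = S') A hρ
              (disjoint_union_left.2 ⟨disjoint_of_subset_right hW' hSW,
                disjoint_of_subset_left hS'B sdiff_disjoint⟩) (by omega) (by omega) hN hk hθ hw ha
              haC' (by
                intro x hx
                obtain ⟨hx, hxB⟩ := mem_filter.1 hx
                refine ⟨(hX'c x hx).1, union_subset (hs x hx).1 (hxB ▸ inter_subset_left), ?_⟩
                intro y hy
                have := (hX'c x hx).2 hy
                simp only [mem_union] at this ⊢
                rcases this with h | h
                · exact Or.inl (Or.inl h)
                by_cases hyW : y ∈ W'
                · exact Or.inr hyW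
                · rw [← hxB]
                  exact Or.inl (Or.inr (mem_inter.2 ⟨hy, mem_sdiff.2 ⟨h, hyW⟩⟩)))
            refine ⟨R₂, ℋ₂, u1, u2, u3, fun x hx => ⟨?_, ?_⟩, u5⟩
            · intro y hy
              rw [mem_inter] at hy
              have := u4 x hx hy.1
              simp only [mem_union] at this
              rcases this with (h | h) | h
              · exact absurd hy.2 (disjoint_left.1 hSB h)
              · exact h
              · exact absurd h (mem_sdiff.1 hy.2).2
            · refine (u4 x hx).trans ?_
              exact union_subset (union_subset subset_union_left
                ((hS'B.trans sdiff_subset).trans subset_union_right))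
                (hW'.trans subset_union_right))
          A _ subset_rfl (fun T => w T * Real.exp (a * Cost (kap θ T) R ℋ))
          (fun T => mul_nonneg (hw T) (Real.exp_nonneg _))
      refine ⟨R ∪ R₂, ℋ ∪ ℋ₂, X'', h2R, h2T, disjoint_union_left.2 ⟨hA, h2A⟩, ?_, ?_, ?_, h2cnt, ?_⟩
      · intro x hx
        rcases mem_union.1 hx with hx | hx
        exacts [hRW x hx, (h2P x hx).2]
      · intro x hx
        rw [← union_assoc]
        rcases h2X x hx with ⟨hx, -⟩ | ⟨hx, -⟩
        exacts [mem_union_left _ (hX' hx), mem_union_right _ hx]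
      · intro x hx
        rcases h2X x hx with ⟨hx, hxB⟩ | ⟨-, hx1, hx2⟩
        · refine ⟨(hs x hx).1, ?_⟩
          have h1 := (hs x hx).2
          have : (x.1 ∩ B).card ≠ r - S.card - ℓ := fun he =>
            hxB (mem_powersetCard.2 ⟨inter_subset_right, he⟩)
          omega
        · exact ⟨hx1, by omega⟩
      · have hload : ∀ T, ∑ S' ∈ B.powersetCard (r - S.card - ℓ),
            a * C * load θ (X'.filter fun x => x.1 ∩ B = S') T
            ≤ a * C * load θ X T + a * C * Cost (kap θ T) R ℋ := by
          intro T
          rw [← mul_sum, ← mul_add]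
          refine mul_le_mul_of_nonneg_left ?_ (by positivity)
          calc ∑ S' ∈ B.powersetCard (r - S.card - ℓ), load θ (X'.filter fun x => x.1 ∩ B = S') T
              ≤ load θ X' T := by
                unfold load
                rw [← sum_fiberwise_of_maps_to (s := X') (t := X'.image fun x => x.1 ∩ B)
                  (g := fun x => x.1 ∩ B) (fun x hx => mem_image_of_mem _ hx)
                  (f := fun x => kap θ T x.1)]
                have hz : ∀ S', S' ∉ X'.image (fun x => x.1 ∩ B) →
                    ∑ x ∈ X'.filter (fun x => x.1 ∩ B = S'), kap θ T x.1 = 0 := by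
                  intro S' hS'
                  rw [filter_false_of_mem, sum_empty]
                  rintro x hx rfl
                  exact hS' (mem_image_of_mem _ hx)
                have hnn : ∀ S', 0 ≤ ∑ x ∈ X'.filter (fun x => x.1 ∩ B = S'), kap θ T x.1 :=
                  fun S' => sum_nonneg fun _ _ => hκ _ _
                calc _ ≤ ∑ S' ∈ B.powersetCard (r - S.card - ℓ) ∪ X'.image (fun x => x.1 ∩ B),
                      ∑ x ∈ X'.filter (fun x => x.1 ∩ B = S'), kap θ T x.1 :=
                      sum_le_sum_of_subset_of_nonneg subset_union_left fun _ _ _ => hnn _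
                  _ = _ := (sum_subset subset_union_right fun S' _ h => hz S' h).symm
            _ ≤ load θ (X ∪ R) T := load_mono hθ.nonneg hX' T
            _ ≤ load θ X T + load θ R T := load_union_le hθ.nonneg _ _ _
            _ ≤ _ := by gcongr; exact load_le_Cost hθ.nonneg _ _ _
        calc Pot r w (fun T => a * Cost (kap θ T) (R ∪ R₂) (ℋ ∪ ℋ₂))
            ≤ Pot r w (fun T => a * Cost (kap θ T) R ℋ + a * Cost (kap θ T) R₂ ℋ₂) := by
              refine Pot_mono hw fun T _ => ?_
              rw [← mul_add]
              exact mul_le_mul_of_nonneg_left (Cost_union_le (hκ T) _ _ _ _) ha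
          _ ≤ Pot r w (fun T => a * Cost (kap θ T) R ℋ
                + (a * C * load θ X T + a * C * Cost (kap θ T) R ℋ)) := by
              rw [Pot_add, Pot_add]
              exact h2pot.trans (Pot_mono (fun T => mul_nonneg (hw T) (Real.exp_nonneg _))
                fun T _ => hload T)
          _ = Pot r w (fun T => a * C * load θ X T + a * (1 + C) * Cost (kap θ T) R ℋ) := by
              congr 1; funext T; ring
          _ ≤ Pot r w (fun T => a * C * load θ X T + a * (1 + C) * ((1 + C) ^ ℓ - 1) * load θ X T) := by
              rw [Pot_add, Pot_add]; exact hpot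
          _ = _ := by congr 1; funext T; ring
  obtain ⟨R, ℋ, X', h1, h2, h3, h4, -, h6, -, h8⟩ := main (r - S.card + 1) le_rfl w a hw ha (by
    refine le_trans ?_ haC
    gcongr
    · omega
    · norm_num)
  have hX'e : X' = ∅ := eq_empty_of_forall_notMem fun x hx => by
    have := (h6 x hx).2; omega
  subst hX'e
  refine ⟨R, ℋ, h1, h2, h3, h4, h8.trans (Pot_mono hw fun T _ => ?_)⟩
  refine mul_le_mul_of_nonneg_right ?_ (load_nonneg hθ.nonneg _ _)
  refine mul_le_mul_of_nonneg_left ?_ ha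
  have : (1 + C : ℝ) ^ (r - S.card + 1) ≤ (1 + C) ^ (r + 1) := pow_le_pow_right₀ hC1 (by omega)
  linarith

end Sweep
end RefineDown

/-! ### Divisible functions as integer combinations of cliques, and completion -/

namespace RefineDown
open Finset MultiHypergraph
section Completion

lemma ch_pos {q r : ℕ} (h : r ≤ q) (t : ℕ) : 0 < ch q r t := by
  unfold ch; exact Nat.choose_pos (by omega)

lemma ch_dvd_M {q r t : ℕ} (ht : t < r) : ch q r t ∣ M q r :=
  dvd_lcm (f := fun i => (q - i).choose (r - i)) (mem_range.2 ht)

lemma M_pos {q r : ℕ} (h : r ≤ q) : 0 < M q r := by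
  unfold M
  rw [Nat.pos_iff_ne_zero, Ne, Finset.lcm_eq_zero_iff]
  rintro ⟨i, -, hi⟩
  exact (ch_pos h i).ne' hi

/-- The functions on `r`-sets that are integer combinations of cliques. -/
def InSpan {V : Type u} [Fintype V] [DecidableEq V] (q r : ℕ) (f : Finset V → ℤ) : Prop :=
  ∃ z : Finset V → ℤ, ∀ g : Finset V, g.card = r →
    f g = ∑ K ∈ (univ : Finset V).powersetCard q, if g ⊆ K then z K else 0

section Span
variable {V : Type u} [Fintype V] [DecidableEq V] {q r : ℕ}

lemma InSpan.add {f f' : Finset V → ℤ} (h : InSpan q r f) (h' : InSpan q r f') :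
    InSpan q r (fun g => f g + f' g) := by
  obtain ⟨z, hz⟩ := h
  obtain ⟨z', hz'⟩ := h'
  refine ⟨fun K => z K + z' K, fun g hg => ?_⟩
  dsimp only
  rw [hz g hg, hz' g hg, ← sum_add_distrib]
  exact sum_congr rfl fun K _ => by split_ifs <;> simp

lemma InSpan.smul {f : Finset V → ℤ} (h : InSpan q r f) (c : ℤ) :
    InSpan q r (fun g => c * f g) := by
  obtain ⟨z, hz⟩ := h
  refine ⟨fun K => c * z K, fun g hg => ?_⟩
  dsimp only
  rw [hz g hg, mul_sum]
  exact sum_congr rfl fun K _ => by split_ifs <;> simp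

lemma InSpan.sum {ι : Type*} (s : Finset ι) (f : ι → Finset V → ℤ)
    (h : ∀ i ∈ s, InSpan q r (f i)) : InSpan q r (fun g => ∑ i ∈ s, f i g) := by
  classical
  induction s using Finset.induction_on with
  | empty => exact ⟨0, fun g _ => by simp⟩
  | insert i s hi ih =>
    simp_rw [sum_insert hi]
    exact (h i (mem_insert_self _ _)).add (ih fun j hj => h j (mem_insert_of_mem hj))

lemma InSpan.congr {f f' : Finset V → ℤ} (h : InSpan q r f)
    (he : ∀ g : Finset V, g.card = r → f' g = f g) : InSpan q r f' := by
  obtain ⟨z, hz⟩ := h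
  exact ⟨z, fun g hg => (he g hg).trans (hz g hg)⟩

omit [Fintype V] in
lemma card_filter_clique {E : Type u} [DecidableEq E] {G : MultiHypergraph V E} {H : G.Sub}
    (hH : H.IsClique q r) {g : Finset V} (hg : g.card = r) :
    (H.edges.filter fun e => G.edge e = g).card = if g ⊆ H.verts then 1 else 0 := by
  split_ifs with h
  · obtain ⟨e, ⟨he, heg⟩, hu⟩ := hH.2.2 g h hg
    rw [card_eq_one]
    refine ⟨e, ?_⟩
    ext e'
    rw [mem_filter, mem_singleton]
    exact ⟨fun h' => hu e' h', fun h' => h' ▸ ⟨he, heg⟩⟩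
  · rw [card_eq_zero, filter_eq_empty_iff]
    rintro e he rfl
    exact h (H.edge_subset e he)

/-- The coefficient of a `q`-set is the number of members of `Q` having it as vertex set. -/
lemma inSpan_of_cliques {E : Type u} [DecidableEq E] {G : MultiHypergraph V E}
    {Q : Finset G.Sub} (hQ : EdgeDisjoint Q) (hc : ∀ H ∈ Q, H.IsClique q r) (D : Finset E)
    (hD : ∀ e, (∃ H ∈ Q, e ∈ H.edges) ↔ e ∈ D) :
    InSpan q r fun g => ((D.filter fun e => G.edge e = g).card : ℤ) := by
  classical
  refine ⟨fun K => ((Q.filter fun H => H.verts = K).card : ℤ), fun g hg => ?_⟩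
  have hDe : D = Q.biUnion fun H => H.edges := by
    ext e; rw [← hD, mem_biUnion]
  dsimp only
  rw [hDe, filter_biUnion, card_biUnion]
  · rw [sum_congr rfl fun H hH => card_filter_clique (hc H hH) hg]
    push_cast
    rw [← sum_fiberwise_of_maps_to (s := Q) (t := univ.powersetCard q) (g := fun H => H.verts)
      fun H hH => mem_powersetCard.2 ⟨subset_univ _, (hc H hH).1⟩]
    refine sum_congr rfl fun K _ => ?_
    rw [sum_congr rfl (g := fun _ => if g ⊆ K then (1 : ℤ) else 0), sum_const]
    · split_ifs <;> simp
    · intro H hH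
      rw [(mem_filter.1 hH).2]
  · intro H hH H' hH' hne
    exact disjoint_filter_filter (hQ H hH H' hH' hne)

/-- Divisible functions are integer combinations of cliques. -/
theorem exists_inSpan {q r : ℕ} (hqr : r < q) (h : MultiOmniTheorem.{u} q r) :
    ∃ N, ∀ (V : Type u) [Fintype V] [DecidableEq V], N ≤ Fintype.card V → ∀ f : Finset V → ℤ,
      (∀ T : Finset V, T.card < r → (ch q r T.card : ℤ) ∣
        ∑ g ∈ (univ : Finset V).powersetCard r, if T ⊆ g then f g else 0) → InSpan q r f := by
  classical
  obtain ⟨C, -, hC⟩ := h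
  refine ⟨C, fun V _ _ hV f hf => ?_⟩
  set m := M q r with hm
  have hm0 : 0 < m := M_pos hqr.le
  -- Every `r`-set is given `M q r` parallel edges, the largest multiplicity allowed, so that every
  -- residue modulo `M q r` on every `r`-set is realised by a subgraph.
  let X : MultiHypergraph V ({g : Finset V // g.card = r} × Fin m) := ⟨fun e => e.1.1⟩
  have hXu : X.Uniform r := fun e => e.1.2
  obtain ⟨F, _, A, ℋ, hA, -⟩ := hC V _ X univ hXu (by
    intro S hS
    unfold deg
    calc _ ≤ ((univ : Finset (Fin m)).image fun j => ((⟨S, hS⟩ : {g : Finset V // g.card = r}), j)).card := by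
          refine card_le_card fun e he => ?_
          simp only [mem_filter] at he
          have : S = e.1.1 := eq_of_subset_of_card_le he.2 (by rw [hS]; exact e.1.2.le)
          exact mem_image.2 ⟨e.2, mem_univ _, by ext1 <;> simp [this]⟩
      _ ≤ _ := card_image_le.trans (by simp)) hV (by
    have : (0 : ℝ) ≤ Fintype.card V := Nat.cast_nonneg _
    rw [card_univ]; linarith)
  set a : Finset V → ℤ := fun g => ((univ.filter fun e : F => A.edge e = g).card : ℤ) with ha
  set μ : Finset ({g : Finset V // g.card = r} × Fin m) → Finset V → ℤ :=
    fun L g => ((L.filter fun e => X.edge e = g).card : ℤ) with hμ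
  have h1 : ∀ L, X.Divisible L q r → InSpan q r fun g => μ L g + a g := by
    intro L hL
    obtain ⟨Q, hQ, hQd, hQe⟩ := hA.decomp L hL
    refine (inSpan_of_cliques hQd (fun H hH => hA.clique H (hQ hH)) _ hQe).congr fun g _ => ?_
    rw [← map_inl_disjUnion_map_inr, filter_disjUnion, card_disjUnion, filter_map, filter_map,
      card_map, card_map]
    push_cast
    rfl
  have h2 : ∀ L, X.Divisible L q r → InSpan q r (μ L) := by
    intro L hL
    have h0 : InSpan q r a := (h1 ∅ (fun T _ => by simp [deg])).congr fun g _ => by simp [hμ]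
    exact ((h1 L hL).add (h0.smul (-1))).congr fun g _ => by ring
  have hdeg : ∀ L T, (X.deg L T : ℤ) = ∑ g ∈ (univ : Finset V).powersetCard r,
      if T ⊆ g then μ L g else 0 := by
    intro L T
    have hd : X.deg L T = (L.filter fun e => T ⊆ X.edge e).card := by
      unfold deg; congr
    rw [hd, ← sum_filter, hμ, card_eq_sum_card_fiberwise (f := X.edge)
      (t := (univ.powersetCard r).filter fun g => T ⊆ g)]
    · push_cast
      refine sum_congr rfl fun g hg => ?_
      congr 2
      ext e
      simp only [mem_filter] at hg ⊢
      constructor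
      · rintro ⟨⟨a, -⟩, b⟩; exact ⟨a, b⟩
      · rintro ⟨a, b⟩; exact ⟨⟨a, b ▸ hg.2⟩, b⟩
    · intro e he
      simp only [coe_filter, Set.mem_ofPred_eq] at he ⊢
      exact ⟨mem_powersetCard.2 ⟨subset_univ _, hXu e⟩, he.2⟩
  have hμc : ∀ (P : {g : Finset V // g.card = r} → Fin m → Prop) (g : Finset V) (hg : g.card = r),
      μ (univ.filter fun e => P e.1 e.2) g
        = ((univ.filter fun j : Fin m => P ⟨g, hg⟩ j).card : ℤ) := by
    intro P g hg
    simp only [hμ]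
    congr 1
    refine card_bij (fun e _ => e.2) ?_ ?_ ?_
    · rintro ⟨⟨g', hg'⟩, j⟩ he
      simp only [mem_filter, mem_univ, true_and, X] at he ⊢
      obtain ⟨he, rfl⟩ := he
      exact he
    · rintro ⟨⟨g', hg'⟩, j⟩ he ⟨⟨g'', hg''⟩, j'⟩ he' hj
      simp only [mem_filter, mem_univ, true_and, X] at he he' hj
      obtain ⟨-, rfl⟩ := he
      obtain ⟨-, rfl⟩ := he'
      rw [hj]
    · intro j hj
      exact ⟨(⟨g, hg⟩, j), by simpa [X] using hj, rfl⟩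
  -- All `m` copies of one `r`-set form a divisible subgraph, since `m` is a multiple of every
  -- divisor.
  have h3 : ∀ g₀ : Finset V, g₀.card = r → InSpan q r fun g => if g = g₀ then (m : ℤ) else 0 := by
    intro g₀ hg₀
    have e : ∀ g : Finset V, g.card = r → (if g = g₀ then (m : ℤ) else 0)
        = μ (univ.filter fun e => e.1.1 = g₀) g := by
      intro g hg
      refine Eq.trans ?_ ((hμc (fun g' _ => g'.1 = g₀) g hg).symm.trans (by congr))
      split_ifs with h <;> simp [h]
    refine (h2 (univ.filter fun e => e.1.1 = g₀) fun T hT => ?_).congr e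
    have : ((m : ℕ) : ℤ) ∣ X.deg (univ.filter fun e => e.1.1 = g₀) T := by
      rw [hdeg]
      refine dvd_sum fun g hg => ?_
      rw [← e g (mem_powersetCard.1 hg).2]
      split_ifs <;> simp
    exact (ch_dvd_M hT).trans (by exact_mod_cast this)
  have hm0' : (m : ℤ) ≠ 0 := by exact_mod_cast hm0.ne'
  have e4 : ∀ g : Finset V, g.card = r → f g % m
      = μ (univ.filter fun e => (e.2.1 : ℤ) < f e.1.1 % m) g := by
    intro g hg
    refine Eq.trans ?_ ((hμc (fun g' j => (j.1 : ℤ) < f g'.1 % m) g hg).symm.trans (by congr))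
    have h5 := Int.emod_nonneg (f g) hm0'
    have h6 := Int.emod_lt_of_pos (f g) (b := m) (by exact_mod_cast hm0)
    obtain ⟨c, hc⟩ := Int.eq_ofNat_of_zero_le h5
    simp only [hc]
    rw [hc] at h6
    have h7 : c < m := by exact_mod_cast h6
    have : (univ.filter fun j : Fin m => ((j : ℕ) : ℤ) < (c : ℤ)).card = c := by
      have : (univ.filter fun j : Fin m => ((j : ℕ) : ℤ) < (c : ℤ)) = Iio (⟨c, h7⟩ : Fin m) := by
        ext j; simp [Fin.lt_def]
      rw [this, Fin.card_Iio]
    exact congrArg (Nat.cast (R := ℤ)) this.symm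
  have h4 : InSpan q r fun g => f g % m := by
    refine (h2 (univ.filter fun e => (e.2.1 : ℤ) < f e.1.1 % m) fun T hT => ?_).congr e4
    have : ((ch q r T.card : ℕ) : ℤ) ∣ X.deg (univ.filter fun e => (e.2.1 : ℤ) < f e.1.1 % m) T := by
      rw [hdeg]
      have hch : ((ch q r T.card : ℕ) : ℤ) ∣ (m : ℤ) := by exact_mod_cast ch_dvd_M hT
      have hsub := hf T hT
      rw [← dvd_sub_right hsub, ← sum_sub_distrib]
      refine dvd_sum fun g hg => ?_
      split_ifs with hTg
      · rw [← e4 g (mem_powersetCard.1 hg).2]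
        refine hch.trans ?_
        exact Int.dvd_self_sub_emod
      · simp
    exact_mod_cast this
  -- `f` is its residue modulo `m`, realised by a divisible subgraph, plus integer multiples of `m`
  -- times the indicators of single `r`-sets.
  refine (h4.add (InSpan.sum (univ.powersetCard r) (fun g₀ g => f g₀ / m * if g = g₀ then (m : ℤ) else 0)
    fun g₀ hg₀ => (h3 g₀ (mem_powersetCard.1 hg₀).2).smul _)).congr fun g hg => ?_
  rw [sum_eq_single g]
  · rw [if_pos rfl]
    have := Int.emod_add_ediv_mul (f g) m
    linarith
  · intro b _ hb; rw [if_neg (Ne.symm hb), mul_zero]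
  · intro hg'; exact absurd (mem_powersetCard.2 ⟨subset_univ _, hg⟩) hg'

end Span

lemma sum_powersetCard_eq_subtype {V : Type u} [DecidableEq V] (W : Finset V) (k : ℕ)
    (F : Finset V → ℤ) : ∑ g ∈ W.powersetCard k, F g
      = ∑ g ∈ (univ : Finset {x // x ∈ W}).powersetCard k, F (g.map (Function.Embedding.subtype _)) := by
  have h := powersetCard_map (Function.Embedding.subtype fun x => x ∈ W) k univ
  rw [show univ.map (Function.Embedding.subtype fun x => x ∈ W) = W from by
    rw [univ_eq_attach]; exact attach_map_val] at h
  rw [h, sum_map]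
  rfl

/-- Divisible functions on the `r`-subsets of a large set are integer combinations of cliques. -/
theorem exists_clique_combination {q r : ℕ} (hqr : r < q) (h : MultiOmniTheorem.{u} q r) :
    ∃ N, ∀ (V : Type u) [DecidableEq V] (W : Finset V), N ≤ W.card → ∀ f : Finset V → ℤ,
      (∀ T ⊆ W, T.card < r → (ch q r T.card : ℤ) ∣
        ∑ g ∈ W.powersetCard r, if T ⊆ g then f g else 0) →
      ∃ z : Finset V → ℤ, ∀ g ∈ W.powersetCard r,
        f g = ∑ K ∈ W.powersetCard q, if g ⊆ K then z K else 0 := by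
  obtain ⟨N, hN⟩ := exists_inSpan hqr h
  refine ⟨N, fun V _ W hW f hf => ?_⟩
  set e : {x // x ∈ W} ↪ V := Function.Embedding.subtype _ with he
  obtain ⟨z, hz⟩ := hN {x // x ∈ W} (by simpa using hW) (fun g => f (g.map e)) (by
    intro T hT
    have h1 := hf (T.map e) (by
      intro x hx
      obtain ⟨y, -, rfl⟩ := mem_map.1 hx
      exact y.2) (by rwa [card_map])
    rw [sum_powersetCard_eq_subtype, card_map] at h1
    simpa only [← he, map_subset_map] using h1)
  have hsub : ∀ g : Finset V, g ⊆ W → (g.subtype (· ∈ W)).map e = g := fun g hg =>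
    subtype_map_of_mem fun x hx => hg hx
  refine ⟨fun K => z (K.subtype (· ∈ W)), fun g hg => ?_⟩
  obtain ⟨hgW, hgr⟩ := mem_powersetCard.1 hg
  have h2 := hz (g.subtype (· ∈ W)) (by rw [← card_map e, hsub g hgW, hgr])
  dsimp only at h2
  rw [hsub g hgW] at h2
  refine h2.trans (Eq.trans ?_ (sum_powersetCard_eq_subtype W q _).symm)
  refine sum_congr rfl fun K _ => ?_
  dsimp only
  rw [← he]
  have h3 : (K.map e).subtype (· ∈ W) = K := by
    apply map_injective e
    exact hsub _ fun x hx => by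
      obtain ⟨y, -, rfl⟩ := mem_map.1 hx
      exact y.2
  rw [h3]
  have h4 : g.subtype (· ∈ W) ⊆ K ↔ g ⊆ K.map e := by
    rw [← map_subset_map (f := e), hsub g hgW]
  simp only [h4]

/-- The number of `r`-sets between `T` and a `q`-set is the divisor for `|T|`. -/
lemma sum_between {V : Type u} [DecidableEq V] {q r : ℕ} {K T : Finset V} (hK : K.card = q)
    (hT : T.card ≤ r) : (ch q r T.card : ℤ) ∣
      ∑ e ∈ K.powersetCard r, if T ⊆ e then (1 : ℤ) else 0 := by
  rw [← sum_filter, sum_const, nsmul_one]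
  by_cases hTK : T ⊆ K
  · rw [card_filter_powersetCard_subset _ _ _ hTK hT, hK]
    rfl
  · rw [filter_false_of_mem]
    · simp
    · intro e he h
      exact hTK (h.trans (mem_powersetCard.1 he).1)

/-- `S`-divisible edge sets inside a large window become divisible after adding edges that do not
contain `S`. -/
theorem exists_completion {q r : ℕ} (hqr : r < q)
    (hyp : ∀ r' q' : ℕ, 1 ≤ r' → r' ≤ r - 1 → r' < q' → MultiOmniTheorem.{u} q' r') :
    ∃ N, q ≤ N ∧ ∀ (V : Type u) [DecidableEq V] (S W : Finset V), Disjoint S W → 1 ≤ S.card →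
      S.card ≤ r → N ≤ W.card → ∀ U : Finset (Lab V),
      (∀ x ∈ U, x.1.card = r ∧ S ⊆ x.1 ∧ x.1 ⊆ S ∪ W) → SDiv q r S U →
      ∃ d : Finset V → ℤ, ∀ T : Finset V, T.card < r → (ch q r T.card : ℤ) ∣ ldeg U T +
        ∑ e ∈ (S ∪ W).powersetCard r, if ¬ S ⊆ e ∧ T ⊆ e then d e else 0 := by
  -- Thresholds for the links at sets of size `i`. If i = r the links live on the empty set alone
  -- and one clique carries the whole coefficient; no lower-uniformity assertion is needed there.
  have hN : ∀ i : ℕ, ∃ N, ∀ (V : Type u) [DecidableEq V] (W : Finset V), 1 ≤ i → i ≤ r → N ≤ W.card →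
      q ≤ W.card → ∀ f : Finset V → ℤ, (∀ T ⊆ W, T.card < r - i → (ch (q - i) (r - i) T.card : ℤ) ∣
        ∑ g ∈ W.powersetCard (r - i), if T ⊆ g then f g else 0) →
      ∃ z : Finset V → ℤ, ∀ g ∈ W.powersetCard (r - i),
        f g = ∑ K ∈ W.powersetCard (q - i), if g ⊆ K then z K else 0 := by
    intro i
    by_cases hi : 1 ≤ i ∧ i < r
    · obtain ⟨N, hN⟩ := exists_clique_combination (q := q - i) (r := r - i) (by omega)
        (hyp _ _ (by omega) (by omega) (by omega))
      exact ⟨N, fun V _ W _ _ hW _ f hf => hN V W hW f hf⟩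
    · refine ⟨0, fun V _ W h1 h2 _ hW f _ => ?_⟩
      have : i = r := by omega
      subst this
      obtain ⟨K₀, hK₀⟩ := powersetCard_nonempty.2 ((Nat.sub_le q i).trans hW)
      refine ⟨fun K => if K = K₀ then f ∅ else 0, fun g hg => ?_⟩
      have : g = ∅ := by
        have := (mem_powersetCard.1 hg).2
        rwa [Nat.sub_self, card_eq_zero] at this
      subst this
      simp [hK₀]
  choose Ni hNi using hN
  refine ⟨q + (range (r + 1)).sup Ni, Nat.le_add_right _ _, ?_⟩
  intro V _ S W hSW hS1 hSr hW U hU hUd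
  set i := S.card with hi
  have hNiW : Ni i ≤ W.card := by
    have : Ni i ≤ (range (r + 1)).sup Ni := le_sup (f := Ni) (mem_range.2 (by omega))
    omega
  set μ : Finset V → ℤ := fun e => ((U.filter fun x => x.1 = e).card : ℤ) with hμ
  have hμdeg : ∀ T, (ldeg U T : ℤ) = ∑ e ∈ (S ∪ W).powersetCard r, if T ⊆ e then μ e else 0 := by
    intro T
    rw [ldeg_eq_sum (E := (S ∪ W).powersetCard r) (fun x hx =>
      mem_powersetCard.2 ⟨(hU x hx).2.2, (hU x hx).1⟩), sum_filter]
    push_cast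
    rfl
  have hμ0 : ∀ e, ¬ S ⊆ e → μ e = 0 := by
    intro e he
    rw [hμ]
    simp only [Nat.cast_eq_zero, card_eq_zero, filter_eq_empty_iff]
    rintro x hx rfl
    exact he (hU x hx).2.1
  -- edges containing `S` correspond to their links
  have hlink : ∀ F : Finset V → ℤ, ∑ e ∈ (S ∪ W).powersetCard r, (if S ⊆ e then F e else 0)
      = ∑ g ∈ W.powersetCard (r - i), F (S ∪ g) := by
    intro F
    rw [← sum_filter]
    refine sum_nbij' (fun e => e \ S) (fun g => S ∪ g) ?_ ?_ ?_ ?_ ?_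
    · intro e he
      obtain ⟨he, hSe⟩ := mem_filter.1 he
      obtain ⟨heW, her⟩ := mem_powersetCard.1 he
      refine mem_powersetCard.2 ⟨sdiff_le_iff.2 heW, ?_⟩
      rw [card_sdiff_of_subset hSe, her]
    · intro g hg
      obtain ⟨hgW, hgr⟩ := mem_powersetCard.1 hg
      refine mem_filter.2 ⟨mem_powersetCard.2 ⟨union_subset_union_right hgW, ?_⟩, subset_union_left⟩
      rw [card_union_of_disjoint (disjoint_of_subset_right hgW hSW), hgr]
      omega
    · intro e he
      exact union_sdiff_of_subset (mem_filter.1 he).2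
    · intro g hg
      have := disjoint_of_subset_right (mem_powersetCard.1 hg).1 hSW
      rw [union_sdiff_left, sdiff_eq_self_of_disjoint this.symm]
    · intro e he
      rw [union_sdiff_of_subset (mem_filter.1 he).2]
  -- The conditions on `U` above `S` are exactly the divisibility conditions on the link, because
  -- `ch q r (i + t) = ch (q - i) (r - i) t`.
  obtain ⟨z, hz⟩ := hNi i V W hS1 hSr hNiW (by omega) (fun g => μ (S ∪ g)) (by
    intro T hTW hT
    have hST : (S ∪ T).card = i + T.card :=
      card_union_of_disjoint (disjoint_of_subset_right hTW hSW)
    have h1 := hUd (S ∪ T) subset_union_left (by omega)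
    have h2 : (ch q r (S ∪ T).card : ℤ) ∣ (ldeg U (S ∪ T) : ℤ) := by exact_mod_cast h1
    have h3 : ch q r (S ∪ T).card = ch (q - i) (r - i) T.card := by
      unfold ch; rw [hST]; congr 1 <;> omega
    rw [h3, hμdeg] at h2
    refine h2.trans (dvd_of_eq ?_)
    have h4 : ∀ e : Finset V, (if S ∪ T ⊆ e then μ e else 0)
        = if S ⊆ e then (if T ⊆ e then μ e else 0) else 0 := by
      intro e
      by_cases h5 : S ⊆ e <;> by_cases h6 : T ⊆ e <;> simp only [union_subset_iff, h5, h6, and_self,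
        and_true, and_false, if_true, if_false]
    rw [sum_congr rfl fun e _ => h4 e, hlink]
    refine sum_congr rfl fun g _ => ?_
    have h5 : T ⊆ S ∪ g ↔ T ⊆ g :=
      ⟨fun h x hx => (mem_union.1 (h hx)).resolve_left fun h' => disjoint_left.1 hSW h' (hTW hx),
        fun h => h.trans subset_union_right⟩
    simp only [h5])
  -- The cliques of the link are coned with `S`. The result agrees with `U` on edges containing `S`,
  -- and it is divisible as a combination of `q`-cliques; its values on the other edges are the
  -- completion.
  set D : Finset V → ℤ := fun e => ∑ K ∈ W.powersetCard (q - i), if e ⊆ S ∪ K then z K else 0 with hD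
  have hDμ : ∀ e ∈ (S ∪ W).powersetCard r, S ⊆ e → D e = μ e := by
    intro e he hSe
    obtain ⟨heW, her⟩ := mem_powersetCard.1 he
    have h1 := hz (e \ S) (mem_powersetCard.2 ⟨sdiff_le_iff.2 heW, by
      rw [card_sdiff_of_subset hSe, her]⟩)
    rw [union_sdiff_of_subset hSe] at h1
    rw [h1]
    refine sum_congr rfl fun K _ => ?_
    have : e ⊆ S ∪ K ↔ e \ S ⊆ K := sdiff_le_iff.symm
    simp only [this]
  refine ⟨D, fun T hT => ?_⟩
  have h1 : (ldeg U T : ℤ) + ∑ e ∈ (S ∪ W).powersetCard r, (if ¬ S ⊆ e ∧ T ⊆ e then D e else 0)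
      = ∑ e ∈ (S ∪ W).powersetCard r, if T ⊆ e then D e else 0 := by
    rw [hμdeg, ← sum_add_distrib]
    refine sum_congr rfl fun e he => ?_
    by_cases hSe : S ⊆ e
    · rw [hDμ e he hSe]; simp [hSe]
    · rw [hμ0 e hSe]; simp [hSe]
  have h2 : ∑ e ∈ (S ∪ W).powersetCard r, (if T ⊆ e then D e else 0)
      = ∑ K ∈ W.powersetCard (q - i), z K * ∑ e ∈ (S ∪ K).powersetCard r, if T ⊆ e then 1 else 0 := by
    have e1 : ∀ e : Finset V, (if T ⊆ e then D e else 0)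
        = ∑ K ∈ W.powersetCard (q - i), if e ⊆ S ∪ K then (if T ⊆ e then z K else 0) else 0 := by
      intro e
      split_ifs
      · rfl
      · simp
    rw [sum_congr rfl fun e _ => e1 e, sum_comm]
    refine sum_congr rfl fun K hK => ?_
    rw [← sum_filter, mul_sum]
    refine sum_congr ?_ fun e _ => by split_ifs <;> simp
    ext e
    simp only [mem_filter, mem_powersetCard]
    have := union_subset_union_right (s := S) (mem_powersetCard.1 hK).1
    exact ⟨fun h => ⟨h.2, h.1.2⟩, fun h => ⟨⟨h.1.trans this, h.2⟩, h.1⟩⟩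
  rw [h1, h2]
  refine dvd_sum fun K hK => Dvd.dvd.mul_left (sum_between ?_ hT.le) _
  obtain ⟨hKW, hKc⟩ := mem_powersetCard.1 hK
  rw [card_union_of_disjoint (disjoint_of_subset_right hKW hSW), hKc]
  omega

end Completion
end RefineDown

/-! ### Enlarging the windows by a factor ρ -/

namespace RefineDown
open Finset MultiHypergraph
section Absorb

lemma exists_subset_mult {V : Type u} [DecidableEq V] (R : Finset (Lab V)) (E : Finset (Finset V))
    (d : Finset V → ℕ) (h : ∀ e ∈ E, d e ≤ (R.filter fun x => x.1 = e).card) :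
    ∃ D ⊆ R, (∀ x ∈ D, x.1 ∈ E) ∧ ∀ e ∈ E, (D.filter fun x => x.1 = e).card = d e := by
  have h1 : ∀ e : Finset V, ∃ D ⊆ R.filter fun x => x.1 = e, e ∈ E → D.card = d e := by
    intro e
    by_cases he : e ∈ E
    · obtain ⟨D, hD, hDc⟩ := exists_subset_card_eq (h e he)
      exact ⟨D, hD, fun _ => hDc⟩
    · exact ⟨∅, empty_subset _, fun h' => absurd h' he⟩
  choose D hD hDc using h1
  refine ⟨E.biUnion D, biUnion_subset.2 fun e _ => (hD e).trans (filter_subset _ _), ?_, ?_⟩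
  · intro x hx
    obtain ⟨e, he, hxe⟩ := mem_biUnion.1 hx
    rw [(mem_filter.1 (hD e hxe)).2]
    exact he
  · intro e he
    rw [← hDc e he]
    congr 1
    ext x
    rw [mem_filter, mem_biUnion]
    constructor
    · rintro ⟨⟨e', -, hx⟩, rfl⟩
      have := (mem_filter.1 (hD e' hx)).2
      rwa [this]
    · intro hx
      exact ⟨⟨e, he, hx⟩, (mem_filter.1 (hD e hx)).2⟩

/-- Every set of edges inside a window of size `N` can be completed to a divisible one. -/
def Completes (q r N : ℕ) : Prop :=
  ∀ (V : Type u) [DecidableEq V] (S W : Finset V), Disjoint S W → 1 ≤ S.card →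
    S.card ≤ r → N ≤ W.card → ∀ U : Finset (Lab V),
    (∀ x ∈ U, x.1.card = r ∧ S ⊆ x.1 ∧ x.1 ⊆ S ∪ W) → SDiv q r S U →
    ∃ d : Finset V → ℤ, ∀ T : Finset V, T.card < r → (ch q r T.card : ℤ) ∣ ldeg U T +
      ∑ e ∈ (S ∪ W).powersetCard r, if ¬ S ⊆ e ∧ T ⊆ e then d e else 0

variable {V : Type u} [DecidableEq V]

/-- Both values are compared with `kap θ T (S ∪ W)`. Since `e` contains `S`, it misses inside `S ∪
W` at most |T| < r vertices of `T`, all in `W` and each of weight 1/|W|. In bounded windows all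
costs are thus comparable to the load of a single edge. -/
lemma kap_le_mul_kap {r : ℕ} {S W T A e : Finset V} {θ : V → ℝ} (hθ : Weight W θ)
    (hN : 1 ≤ W.card) (hT : T.card = r - 1) (hA : A ⊆ S ∪ W) (hS : S ⊆ e) (he : e ⊆ S ∪ W) :
    kap θ T A ≤ (W.card : ℝ) ^ r * kap θ T e := by
  have hN0 : (1 : ℝ) ≤ W.card := by exact_mod_cast hN
  have h1 : kap θ T A ≤ kap θ T (S ∪ W) := kap_anti hθ.nonneg hθ.le_one T hA
  have h2 : kap θ T e = kap θ T (S ∪ W) * ∏ y ∈ (T ∩ (S ∪ W)) \ e, θ y := by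
    unfold kap
    rw [← prod_union]
    · congr 1
      ext y
      simp only [mem_sdiff, mem_union, mem_inter]
      constructor
      · rintro ⟨a, b⟩
        by_cases h : y ∈ S ∪ W
        · exact Or.inr ⟨⟨a, mem_union.1 h⟩, b⟩
        · exact Or.inl ⟨a, fun h' => h (mem_union.2 h')⟩
      · rintro (⟨a, b⟩ | ⟨⟨a, _⟩, b⟩)
        · exact ⟨a, fun h => b (mem_union.1 (he h))⟩
        · exact ⟨a, b⟩
    · rw [disjoint_left]
      intro y hy hy'
      exact (mem_sdiff.1 hy).2 (mem_inter.1 (mem_sdiff.1 hy').1).2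
  have h3 : ∏ y ∈ (T ∩ (S ∪ W)) \ e, θ y = (1 / (W.card : ℝ)) ^ ((T ∩ (S ∪ W)) \ e).card := by
    rw [← prod_const]
    refine prod_congr rfl fun y hy => hθ.eq y ?_
    have hy1 := (mem_inter.1 (mem_sdiff.1 hy).1).2
    exact (mem_union.1 hy1).resolve_left fun h => (mem_sdiff.1 hy).2 (hS h)
  have h4 : (1 / (W.card : ℝ)) ^ r ≤ (1 / (W.card : ℝ)) ^ ((T ∩ (S ∪ W)) \ e).card := by
    refine pow_le_pow_of_le_one (by positivity) (by rw [div_le_one (by linarith)]; exact hN0) ?_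
    have := card_le_card ((sdiff_subset (s := T ∩ (S ∪ W)) (t := e)).trans inter_subset_left)
    omega
  refine h1.trans ?_
  have hk := kap_nonneg hθ.nonneg T (S ∪ W)
  rw [h2, h3]
  calc kap θ T (S ∪ W) = (W.card : ℝ) ^ r * (kap θ T (S ∪ W) * (1 / (W.card : ℝ)) ^ r) := by
        rw [one_div, inv_pow]
        field_simp
    _ ≤ _ := by gcongr

/-- An (r-1)-set containing `S` extends to an edge by one vertex of `W`, so its degree is at most `m
* W.card`. If |S| = r, every edge is parallel to `S` and the multiplicity itself is the bound. -/
lemma ldeg_le_of_mult {r m : ℕ} (hr : 1 ≤ r) {S W : Finset V} {X : Finset (Lab V)} (hSr : S.card ≤ r)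
    (hW : 1 ≤ W.card) (hX : ∀ x ∈ X, x.1.card = r ∧ S ⊆ x.1 ∧ x.1 ⊆ S ∪ W)
    (hm : ∀ e, (X.filter fun x => x.1 = e).card ≤ m) (U : Finset V) (hU : S ⊆ U) :
    ldeg X U ≤ m * W.card * W.card ^ (r - 1 - U.card) := by
  rcases hSr.lt_or_eq with h | h
  · refine ldeg_le_pow h (fun x hx => ⟨(hX x hx).1, (hX x hx).2.2⟩) ?_ _ U hU rfl
    intro T hST hT
    have hb := card_biUnion_le (s := W) (t := fun y => X.filter fun x : Lab V => x.1 = insert y T)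
    have : X.filter (fun x => T ⊆ x.1) ⊆
        W.biUnion fun y => X.filter fun x : Lab V => x.1 = insert y T := by
      intro x hx
      obtain ⟨hx, hTx⟩ := mem_filter.1 hx
      have hlt : T.card < x.1.card := by have := (hX x hx).1; omega
      obtain ⟨y, hyx, hyT⟩ := exists_mem_notMem_of_card_lt_card hlt
      rw [mem_biUnion]
      refine ⟨y, (mem_union.1 ((hX x hx).2.2 hyx)).resolve_left fun h => hyT (hST h),
        mem_filter.2 ⟨hx, (eq_of_subset_of_card_le (insert_subset hyx hTx) ?_).symm⟩⟩
      rw [card_insert_of_notMem hyT, (hX x hx).1]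
      omega
    calc ldeg X T ≤ _ := card_le_card this
      _ ≤ _ := hb
      _ ≤ ∑ y ∈ W, m := sum_le_sum fun y _ => hm _
      _ = _ := by rw [sum_const, smul_eq_mul, mul_comm]
  · have h1 : ldeg X U ≤ m := by
      refine (card_le_card ?_).trans (hm S)
      intro x hx
      obtain ⟨hx, -⟩ := mem_filter.1 hx
      exact mem_filter.2 ⟨hx, (eq_of_subset_of_card_le (hX x hx).2.1 (by rw [(hX x hx).1, h])).symm⟩
    refine h1.trans ?_
    rw [mul_assoc]
    exact Nat.le_mul_of_pos_right _ (Nat.mul_pos hW (Nat.pow_pos hW))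

variable [Fintype V]

/-- Reveal a window and absorb inside it. -/
theorem Absorbs.reveal_sweep {q r N C k : ℕ} (hr : 1 ≤ r) (hP : Absorbs V q r N C k) {ρ m G : ℕ}
    {S W : Finset V} {θ : V → ℝ} {w : Finset V → ℝ} {a : ℝ} {X : Finset (Lab V)}
    (A : Finset (Lab V)) (hρ : 1 ≤ ρ) (hSW : Disjoint S W) (hS1 : 1 ≤ S.card) (hSr : S.card ≤ r)
    (hm1 : 1 ≤ m) (hmW : m ≤ W.card) (hN : N ≤ m) (hk : m ≤ N * ρ ^ k) (hθ : Weight W θ)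
    (hw : ∀ T, 0 ≤ w T) (ha : 0 ≤ a) (haC : a * (1 + C) ^ (r + 2) * (m * ρ ^ r) ≤ 1)
    (hX : ∀ x ∈ X, x.1.card = r ∧ S ⊆ x.1 ∧ x.1 ⊆ S ∪ W)
    (hdeg : ∀ U, S ⊆ U → ldeg X U ≤ G * W.card ^ (r - 1 - U.card))
    (haG : a * (1 + C) ^ (r + 1) * (2 ^ (r - 1) * G * ((W.card : ℝ) / m) ^ (r - 1 - S.card)) ≤ 1) :
    ∃ R ℋ, Ref q r (2 * C) S X R ℋ ∅ ∧ Thin X ℋ ∧ Disjoint R A ∧ (∀ x ∈ R, x.1 ⊆ S ∪ W) ∧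
      Pot r w (fun T => a * Cost (kap θ T) R ℋ)
        ≤ Pot r w (fun T => 2 ^ r * (a * (1 + C) ^ (r + 1)) * load θ X T) := by
  have hC0 : (0 : ℝ) ≤ C := Nat.cast_nonneg _
  obtain ⟨W', hW'W, hW'm, hpot⟩ := exists_reveal hr hw hθ hm1 hmW X
    (a := a * (1 + C) ^ (r + 1)) (by positivity) (by
      intro W' hW' T hT
      obtain ⟨h1, h2⟩ := mem_powersetCard.1 hW'
      have hθ' := hθ.reveal h1 (by omega)
      have h3 := load_le_of_deg (r := r) hm1 hmW (fun x hx => (hX x hx).2.1) hdeg hθ'.nonneg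
        (fun y => by rw [← h2]; exact hθ'.le y) hT
      exact (mul_le_mul_of_nonneg_left h3 (by positivity)).trans haG)
  have hθ' := hθ.reveal hW'W (by omega)
  obtain ⟨R, ℋ, h1, h2, h3, h4, h5⟩ := hP.sweep A hρ hSW hS1 hSr hW'W (by omega) (by omega) hθ' hw ha
    (by rw [hW'm]; exact haC) hX
  refine ⟨R, ℋ, h1, h2, h3, h4, ?_⟩
  calc Pot r w (fun T => a * Cost (kap θ T) R ℋ)
      ≤ Pot r w (fun T => a * Cost (kap (reveal θ W') T) R ℋ) := by
        refine Pot_mono hw fun T _ => mul_le_mul_of_nonneg_left ?_ ha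
        exact Cost_mono (fun B => kap_mono hθ.nonneg (hθ.le_reveal hW'W) T B) _ _
    _ ≤ _ := h5.trans hpot

/-- The size of the window is increased by a factor of `ρ`. -/
theorem Absorbs.succ {q r N C k : ℕ} (hr : 1 ≤ r) (hqr : r < q) (hN1 : 1 ≤ N)
    (hP : Absorbs V q r N C k) :
    Absorbs V q r N (2 * 2 ^ (2 * M q r + 1) + 2 * C + (1 + C) ^ (r + 2)
      + (1 + C) ^ (r + 1) * 2 ^ (r - 1) * M q r + (2 ^ (2 * M q r + 1) + M q r)
      + 2 ^ r * (1 + C) ^ (r + 1) * (2 ^ (2 * M q r + 1) + M q r)) (k + 1) := by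
  intro ρ S W θ w a X A hρ hSW hS1 hSr hN hk hθ hw ha haC hX
  set m := M q r with hm
  set c1 := 2 ^ (2 * m + 1) with hc1
  set Kp := c1 + m with hKp
  have hm1 : 1 ≤ m := M_pos hqr.le
  -- Bounding the multiplicity first makes the degrees at most a constant times |W|, which is what
  -- the averaging over windows can afford.
  obtain ⟨R0, ℋ0, X0, hR0, -, hT0, hA0, hX0R, hmult, hcnt0, hRX, hcost0⟩ :=
    exists_parallel (q := q) hm1 (fun t ht => ch_dvd_M ht) X (fun x hx => (hX x hx).1) A
  have hR0X : ∀ x ∈ R0, x.1.card = r ∧ S ⊆ x.1 ∧ x.1 ⊆ S ∪ W := by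
    intro x hx
    obtain ⟨y, hy, hxy⟩ := hRX x hx
    rw [hxy]; exact hX y hy
  have hX0 : ∀ x ∈ X0, x.1.card = r ∧ S ⊆ x.1 ∧ x.1 ⊆ S ∪ W := fun x hx => hR0X x (hX0R hx)
  have hW1 : 1 ≤ W.card := hN1.trans hN
  have hW0 : (0 : ℝ) < W.card := by exact_mod_cast hW1
  have hρ0 : (1 : ℝ) ≤ ρ := by exact_mod_cast hρ
  -- The new window has size ⌈|W|/ρ⌉, but never less than `N`. It is within the range of the
  -- induction hypothesis and satisfies |W|/m' ≤ ρ.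
  set m' := max N ((W.card + ρ - 1) / ρ) with hm'
  have hceil : W.card ≤ ρ * ((W.card + ρ - 1) / ρ) := by
    have h1 := Nat.div_add_mod (W.card + ρ - 1) ρ
    have h2 := Nat.mod_lt (W.card + ρ - 1) (by omega : ρ > 0)
    omega
  have hceil' : ∀ b, W.card ≤ ρ * b → (W.card + ρ - 1) / ρ ≤ b := by
    intro b hb
    rw [← Nat.lt_succ_iff, Nat.div_lt_iff_lt_mul (by omega)]
    have : (b + 1) * ρ = ρ * b + ρ := by ring
    rw [Nat.succ_eq_add_one, this]
    omega
  have hm'1 : 1 ≤ m' := hN1.trans (le_max_left _ _)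
  have hm'W : m' ≤ W.card := max_le hN (hceil' _ (Nat.le_mul_of_pos_left _ (by omega)))
  have hm'k : m' ≤ N * ρ ^ k := by
    refine max_le (Nat.le_mul_of_pos_right _ (Nat.pow_pos (by omega))) (hceil' _ ?_)
    calc W.card ≤ N * ρ ^ (k + 1) := hk
      _ = _ := by ring
  have hm'0 : (0 : ℝ) < m' := by exact_mod_cast hm'1
  have hratio : (W.card : ℝ) / m' ≤ ρ := by
    rw [div_le_iff₀ hm'0]
    have : W.card ≤ ρ * m' := hceil.trans (Nat.mul_le_mul_left _ (le_max_right _ _))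
    exact_mod_cast this
  have hratio1 : 1 ≤ (W.card : ℝ) / m' := by
    rw [le_div_iff₀ hm'0, one_mul]; exact_mod_cast hm'W
  have haK : ∀ K : ℝ, 0 ≤ K → K ≤ (2 * c1 + 2 * C + (1 + C) ^ (r + 2)
      + (1 + C) ^ (r + 1) * 2 ^ (r - 1) * m + Kp + 2 ^ r * (1 + C) ^ (r + 1) * Kp : ℕ) →
      a * K * (W.card * ρ ^ r) ≤ 1 := fun K hK0 hK =>
    le_trans (by gcongr) haC
  -- With `G = m * W.card` and ratio at most ρ, every outcome has load at most a constant times |W|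
  -- ρ^r, which explains the form of the smallness condition in `Absorbs`.
  obtain ⟨R, ℋ, h1, h2, h3, h4, h5⟩ := hP.reveal_sweep hr (G := m * W.card) (X := X0)
    (w := fun T => w T * Real.exp (a * Cost (kap θ T) R0 ℋ0)) (A ∪ (X ∪ R0)) hρ hSW hS1 hSr hm'1 hm'W
    (le_max_left _ _) hm'k hθ (fun T => mul_nonneg (hw T) (Real.exp_nonneg _)) ha
    (by
      refine le_trans ?_ (haK ((1 + C) ^ (r + 2)) (by positivity) ?_)
      · gcongr
      · push_cast
        have e1 : (0 : ℝ) ≤ 2 * c1 + 2 * C := by positivity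
        have e2 : (0 : ℝ) ≤ (1 + C) ^ (r + 1) * 2 ^ (r - 1) * m := by positivity
        have e3 : (0 : ℝ) ≤ Kp := by positivity
        have e4 : (0 : ℝ) ≤ 2 ^ r * (1 + C) ^ (r + 1) * Kp := by positivity
        linarith)
    hX0 (ldeg_le_of_mult hr hSr hW1 hX0 hmult)
    (by
      refine le_trans ?_ (haK ((1 + C) ^ (r + 1) * 2 ^ (r - 1) * m) (by positivity) ?_)
      · push_cast
        have e1 : ((W.card : ℝ) / m') ^ (r - 1 - S.card) ≤ ρ ^ r := by
          calc ((W.card : ℝ) / m') ^ (r - 1 - S.card) ≤ (ρ : ℝ) ^ (r - 1 - S.card) := by gcongr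
            _ ≤ _ := pow_le_pow_right₀ hρ0 (by omega)
        calc _ ≤ a * (1 + C) ^ (r + 1) * (2 ^ (r - 1) * (m * W.card) * ρ ^ r) := by gcongr
          _ = _ := by ring
      · push_cast
        have e1 : (0 : ℝ) ≤ 2 * c1 + 2 * C := by positivity
        have e2 : (0 : ℝ) ≤ (1 + C) ^ (r + 2) := by positivity
        have e3 : (0 : ℝ) ≤ Kp := by positivity
        have e4 : (0 : ℝ) ≤ 2 ^ r * (1 + C) ^ (r + 1) * Kp := by positivity
        linarith)
  rw [disjoint_union_right] at h3
  have hsum : c1 + 2 * C ≤ 2 * c1 + 2 * C := by omega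
  refine ⟨R0 ∪ R, ℋ0 ∪ ℋ, ?_, hT0.union h2 h1.sub (disjoint_of_subset_right subset_union_left h3.2).symm,
    disjoint_union_left.2 ⟨hA0, h3.1⟩, ?_, ?_⟩
  · refine (hR0 S).step hcnt0 h1 subset_rfl (hX0R.trans subset_union_right)
      (fun x hx => (hX0 x hx).2.1) (fun x hx hn => absurd hx hn) h3.2.symm ?_ ?_
      (fun x hx _ hn => absurd hx hn) (empty_subset _) (fun x _ h h' => absurd h h')
    · simp only [add_assoc]; exact Nat.le_add_right _ _
    · simp only [add_assoc]; rw [← add_assoc (2 * c1)]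
      exact hsum.trans (Nat.le_add_right _ _)
  · intro x hx
    rcases mem_union.1 hx with hx | hx
    exacts [(hR0X x hx).2.2, h4 x hx]
  · have hκ : ∀ T A, 0 ≤ kap θ T A := fun T A => kap_nonneg hθ.nonneg T A
    have hc0 : ∀ T, Cost (kap θ T) R0 ℋ0 ≤ Kp * load θ X T := fun T => hcost0 _ (hκ T)
    calc Pot r w (fun T => a * Cost (kap θ T) (R0 ∪ R) (ℋ0 ∪ ℋ))
        ≤ Pot r w (fun T => a * Cost (kap θ T) R0 ℋ0 + a * Cost (kap θ T) R ℋ) := by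
          refine Pot_mono hw fun T _ => ?_
          rw [← mul_add]
          exact mul_le_mul_of_nonneg_left (Cost_union_le (hκ T) _ _ _ _) ha
      _ ≤ Pot r w (fun T => a * Cost (kap θ T) R0 ℋ0
            + 2 ^ r * (a * (1 + C) ^ (r + 1)) * load θ X0 T) := by
          rw [Pot_add, Pot_add]; exact h5
      _ ≤ _ := by
          refine Pot_mono hw fun T _ => ?_
          have hl := load_nonneg hθ.nonneg X T
          have e1 : load θ X0 T ≤ Kp * load θ X T :=
            (load_mono hθ.nonneg hX0R T).trans ((load_le_Cost hθ.nonneg _ _ _).trans (hc0 T))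
          calc _ ≤ a * (Kp * load θ X T)
                + 2 ^ r * (a * (1 + C) ^ (r + 1)) * (Kp * load θ X T) := by
                gcongr
                exact hc0 T
            _ = a * (Kp + 2 ^ r * (1 + C) ^ (r + 1) * Kp) * load θ X T := by ring
            _ ≤ _ := by
                refine mul_le_mul_of_nonneg_right (mul_le_mul_of_nonneg_left ?_ ha) hl
                push_cast
                have e1 : (0 : ℝ) ≤ 2 * c1 + 2 * C := by positivity
                have e2 : (0 : ℝ) ≤ (1 + C) ^ (r + 2) := by positivity
                have e3 : (0 : ℝ) ≤ (1 + C) ^ (r + 1) * 2 ^ (r - 1) * m := by positivity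
                linarith

end Absorb
end RefineDown

/-! ### Windows of bounded size -/

namespace RefineDown
open Finset MultiHypergraph
section Base

/-- The integer coefficients of a completion only matter modulo `M q r`; their residues are realised
inside `R`, which holds `M q r` copies of every admissible edge. -/
lemma exists_completing_subset {V : Type u} [DecidableEq V] {q r N : ℕ} (hqr : r < q)
    (hE : Completes.{u} q r N) {S W : Finset V} (hSW : Disjoint S W) (hS1 : 1 ≤ S.card)
    (hSr : S.card ≤ r) (hN : N ≤ W.card) {R U : Finset (Lab V)}
    (hR : ∀ e ∈ (S ∪ W).powersetCard r, ¬ S ⊆ e → (R.filter fun x => x.1 = e).card = M q r)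
    (hU : ∀ x ∈ U, x.1.card = r ∧ S ⊆ x.1 ∧ x.1 ⊆ S ∪ W) (hUd : SDiv q r S U)
    (hUR : Disjoint U R) : ∃ D ⊆ R, SDiv q r ∅ (U ∪ D) := by
  obtain ⟨d, hd⟩ := hE V S W hSW hS1 hSr hN U hU hUd
  have hm0 : (0 : ℤ) < M q r := by exact_mod_cast M_pos hqr.le
  have hdm : ∀ e, ((d e % M q r).toNat : ℤ) = d e % M q r := fun e =>
    Int.toNat_of_nonneg (Int.emod_nonneg _ hm0.ne')
  obtain ⟨D, hDR, hDE, hDc⟩ := exists_subset_mult R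
    (((S ∪ W).powersetCard r).filter fun e => ¬ S ⊆ e) (fun e => (d e % M q r).toNat) (by
      intro e he
      rw [hR e (mem_filter.1 he).1 (mem_filter.1 he).2]
      have h1 := Int.emod_lt_of_pos (d e) hm0
      have h2 := hdm e
      omega)
  refine ⟨D, hDR, fun T _ hT => ?_⟩
  rw [ldeg_union (disjoint_of_subset_right hDR hUR), ldeg_eq_sum hDE, filter_filter]
  have h1 := hd T hT
  rw [← sum_filter] at h1
  zify
  have hch : ((ch q r T.card : ℕ) : ℤ) ∣ (M q r : ℤ) := by exact_mod_cast ch_dvd_M hT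
  rw [← dvd_sub_right h1, add_sub_add_left_eq_sub, ← sum_sub_distrib]
  refine dvd_sum fun e he => ?_
  rw [hDc e (mem_filter.2 ⟨(mem_filter.1 he).1, (mem_filter.1 he).2.1⟩), hdm]
  exact hch.trans Int.dvd_self_sub_emod

variable {V : Type u} [DecidableEq V]

/-- The divisible sets of edges in a window of bounded size and multiplicity are completed. -/
theorem exists_completion_family {q r N m n : ℕ} (hqr : r < q) (hm : m = M q r)
    (hE : Completes.{u} q r N) {S W : Finset V} (hSW : Disjoint S W) (hS1 : 1 ≤ S.card)
    (hSr : S.card ≤ r) (hN : N ≤ W.card) (hn : (S ∪ W).card ≤ n) {X : Finset (Lab V)}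
    (hX : ∀ x ∈ X, x.1.card = r ∧ S ⊆ x.1 ∧ x.1 ⊆ S ∪ W)
    (hmult : ∀ e, (X.filter fun x => x.1 = e).card ≤ m) (A : Finset (Lab V)) :
    ∃ R ℋ, Ref q r (2 ^ (m * 2 ^ n) + 2 * (m * 2 ^ n)) S X R ℋ ∅ ∧ Disjoint R A ∧
      (∀ x ∈ R, x.1 ⊆ S ∪ W ∧ ¬ S ⊆ x.1) ∧ R.card ≤ m * 2 ^ n ∧ ℋ.card ≤ 2 ^ (m * 2 ^ n) := by
  classical
  have hmult' : ∀ Z : Finset (Lab V), (∀ x ∈ Z, x.1 ⊆ S ∪ W) →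
      (∀ e ⊆ S ∪ W, (Z.filter fun x => x.1 = e).card ≤ m) → Z.card ≤ m * 2 ^ n := by
    intro Z hZ hZm
    have h1 := card_eq_sum_card_fiberwise (s := Z) (t := (S ∪ W).powerset) (f := Prod.fst)
      fun x hx => mem_powerset.2 (hZ x hx)
    rw [h1]
    calc _ ≤ ∑ e ∈ (S ∪ W).powerset, m := sum_le_sum fun e he => hZm e (mem_powerset.1 he)
      _ = 2 ^ (S ∪ W).card * m := by rw [sum_const, card_powerset, smul_eq_mul]
      _ ≤ 2 ^ n * m := Nat.mul_le_mul_right _ (Nat.pow_le_pow_right (by norm_num) hn)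
      _ = _ := mul_comm _ _
  set E := ((S ∪ W).powersetCard r).filter fun e => ¬ S ⊆ e with hEdef
  obtain ⟨R, hRA, hRE, hRc⟩ := exists_fresh (A ∪ X) E fun _ => m
  rw [disjoint_union_right] at hRA
  have hRr : ∀ x ∈ R, x.1 ⊆ S ∪ W ∧ ¬ S ⊆ x.1 := fun x hx =>
    ⟨(mem_powersetCard.1 (mem_filter.1 (hRE x hx)).1).1, (mem_filter.1 (hRE x hx)).2⟩
  have hXc : X.card ≤ m * 2 ^ n := hmult' X (fun x hx => (hX x hx).2.2) fun e _ => hmult e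
  have hRcard : R.card ≤ m * 2 ^ n := hmult' R (fun x hx => (hRr x hx).1) fun e _ => by
    by_cases he : e ∈ E
    · exact (hRc e he).le
    · rw [filter_false_of_mem]
      · simp
      · rintro x hx rfl; exact he (hRE x hx)
  have hD : ∀ U : Finset (Lab V), ∃ D ⊆ R, U ⊆ X → SDiv q r S U → SDiv q r ∅ (U ∪ D) := by
    intro U
    by_cases hU : U ⊆ X ∧ SDiv q r S U
    · obtain ⟨D, hDR, hD⟩ := exists_completing_subset hqr hE hSW hS1 hSr hN (R := R) (U := U)
        (fun e he hSe => by rw [← hm]; exact hRc e (mem_filter.2 ⟨he, hSe⟩))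
        (fun x hx => hX x (hU.1 hx)) hU.2 (disjoint_of_subset_left hU.1 hRA.2.symm)
      exact ⟨D, hDR, fun _ _ => hD⟩
    · exact ⟨∅, empty_subset _, fun h1 h2 => absurd ⟨h1, h2⟩ hU⟩
  choose D hDR hDd using hD
  -- `X` has bounded size, so one completion for each of its `S`-divisible subsets is a bounded
  -- family. A single member `L ∪ D L` already covers all edges containing `S`, since no edge of `R`
  -- contains `S`.
  set 𝒰 := X.powerset.filter fun U => SDiv q r S U with h𝒰
  have h𝒰c : 𝒰.card ≤ 2 ^ (m * 2 ^ n) := by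
    refine (card_filter_le _ _).trans ?_
    rw [card_powerset]
    exact Nat.pow_le_pow_right (by norm_num) hXc
  have hmem : ∀ H ∈ 𝒰.image fun U => U ∪ D U, ∃ U ⊆ X, SDiv q r S U ∧ H = U ∪ D U := by
    intro H hH
    obtain ⟨U, hU, rfl⟩ := mem_image.1 hH
    obtain ⟨hU, hUd⟩ := mem_filter.1 hU
    exact ⟨U, mem_powerset.1 hU, hUd, rfl⟩
  refine ⟨R, 𝒰.image fun U => U ∪ D U, ⟨hRA.2.symm, ?_, ?_, ?_, ?_, ?_, ?_, ?_⟩, hRA.1, hRr, hRcard,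
    card_image_le.trans h𝒰c⟩
  · intro x hx
    exact (mem_powersetCard.1 (mem_filter.1 (hRE x hx)).1).2
  · intro T _ hT
    rw [ldeg_eq_sum hRE]
    refine dvd_sum fun e he => ?_
    rw [hRc e (mem_filter.1 he).1, hm]
    exact ch_dvd_M hT
  · intro H hH
    obtain ⟨U, hU, -, rfl⟩ := hmem H hH
    exact union_subset_union hU (hDR U)
  · intro H hH
    obtain ⟨U, hU, hUd, rfl⟩ := hmem H hH
    exact hDd U hU hUd
  · intro H hH
    obtain ⟨U, hU, -, rfl⟩ := hmem H hH
    have h1 := card_union_le U (D U)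
    have h2 := card_le_card hU
    have h3 := card_le_card (hDR U)
    omega
  · intro x
    exact ((card_filter_le _ _).trans (card_image_le.trans h𝒰c)).trans (Nat.le_add_right _ _)
  · intro L hL hLd
    refine ⟨{L ∪ D L}, ?_, by simp, ?_, ?_⟩
    · rw [singleton_subset_iff]
      exact mem_image_of_mem _ (mem_filter.2 ⟨mem_powerset.2 hL, hLd⟩)
    · intro H hH
      rw [mem_singleton.1 hH]
      exact union_subset_union_right (hDR L)
    · intro x hx hSx _
      refine ⟨L ∪ D L, mem_singleton_self _, mem_union_left _ ?_⟩
      exact (mem_union.1 hx).resolve_right fun h => (hRr x h).2 hSx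

variable [Fintype V]

/-- Here |W| = N. Once the multiplicity has been reduced, everything takes place on boundedly many
edges, and `kap_le_mul_kap` charges the whole cost to one edge of `X`. -/
theorem Absorbs.zero {q r N m : ℕ} (hqr : r < q) (hN1 : 1 ≤ N) (hm : m = M q r)
    (hE : Completes.{u} q r N) :
    Absorbs V q r N (2 * 2 ^ (2 * m + 1) + (2 ^ (m * 2 ^ (r + N)) + 2 * (m * 2 ^ (r + N)))
      + (2 ^ (2 * m + 1) + m) + (2 ^ (m * 2 ^ (r + N)) + m * 2 ^ (r + N)) * N ^ r) 0 := by
  intro ρ S W θ w a X A hρ hSW hS1 hSr hN hk hθ hw ha haC hX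
  rw [pow_zero, mul_one] at hk
  have hWN : W.card = N := le_antisymm hk hN
  rcases X.eq_empty_or_nonempty with rfl | ⟨x0, hx0⟩
  · exact ⟨∅, ∅, (Ref.trivial _ _ _ _ _), fun H hH => by simp at hH, by simp, by simp,
      by simp [Cost, load]⟩
  have hm1 : 1 ≤ m := hm ▸ M_pos hqr.le
  obtain ⟨R0, ℋ0, X0, hR0, -, hT0, hA0, hX0R, hmult, hcnt0, hRX, hcost0⟩ :=
    exists_parallel (q := q) hm1 (fun t ht => hm ▸ ch_dvd_M ht) X (fun x hx => (hX x hx).1) A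
  have hR0X : ∀ x ∈ R0, x.1.card = r ∧ S ⊆ x.1 ∧ x.1 ⊆ S ∪ W := by
    intro x hx
    obtain ⟨y, hy, hxy⟩ := hRX x hx
    rw [hxy]; exact hX y hy
  have hX0 : ∀ x ∈ X0, x.1.card = r ∧ S ⊆ x.1 ∧ x.1 ⊆ S ∪ W := fun x hx => hR0X x (hX0R hx)
  obtain ⟨R, ℋ, h1, h2, h3, h4, h5⟩ := exists_completion_family (n := r + N) hqr hm hE hSW hS1 hSr hN
    (by rw [card_union_of_disjoint hSW]; omega) hX0 hmult (A ∪ (X ∪ R0))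
  rw [disjoint_union_right] at h2
  set K := m * 2 ^ (r + N) with hK
  -- A completion may use many edges of `X0`, but those are new edges: the completions avoid `X`
  -- altogether.
  have hThin : Thin X ℋ := by
    intro H hH
    have : H ∩ X = ∅ := by
      rw [← disjoint_iff_inter_eq_empty]
      refine disjoint_of_subset_left (h1.sub H hH) (disjoint_union_left.2 ⟨?_, ?_⟩)
      · exact disjoint_of_subset_left hX0R (hR0 S).disj.symm
      · exact disjoint_of_subset_right subset_union_left h2.2
    rw [this]; simp
  refine ⟨R0 ∪ R, ℋ0 ∪ ℋ, ?_, ?_, disjoint_union_left.2 ⟨hA0, h2.1⟩, ?_, ?_⟩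
  · refine (hR0 S).step hcnt0 h1 subset_rfl (hX0R.trans subset_union_right)
      (fun x hx => (hX0 x hx).2.1) (fun x hx hn => absurd hx hn) h2.2.symm (by omega) (by omega)
      (fun x hx _ hn => absurd hx hn) (empty_subset _) (fun x _ h h' => absurd h h')
  · intro H hH
    rcases mem_union.1 hH with hH | hH
    exacts [hT0 H hH, hThin H hH]
  · intro x hx
    rcases mem_union.1 hx with hx | hx
    exacts [(hR0X x hx).2.2, (h3 x hx).1]
  · refine Pot_mono hw fun T hT => ?_
    rw [mul_assoc]
    refine mul_le_mul_of_nonneg_left ?_ ha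
    have hκ : ∀ A, 0 ≤ kap θ T A := fun A => kap_nonneg hθ.nonneg T A
    refine (Cost_union_le hκ _ _ _ _).trans ?_
    have e1 : Cost (kap θ T) R0 ℋ0 ≤ (2 ^ (2 * m + 1) + m : ℕ) * load θ X T := hcost0 _ hκ
    have e2 : kap θ T x0.1 ≤ load θ X T :=
      single_le_sum (f := fun x : Lab V => kap θ T x.1) (fun x _ => hκ _) hx0
    have e3 : ∀ B ⊆ S ∪ W, kap θ T B ≤ N ^ r * load θ X T := by
      intro B hB
      have := kap_le_mul_kap (r := r) hθ (by omega) hT hB (hX x0 hx0).2.1 (hX x0 hx0).2.2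
      rw [hWN] at this
      exact this.trans (by gcongr)
    have e4 : Cost (kap θ T) R ℋ ≤ ((2 ^ K + K : ℕ) : ℝ) * (N ^ r * load θ X T) := by
      unfold Cost
      have hl : 0 ≤ (N : ℝ) ^ r * load θ X T := mul_nonneg (by positivity) (load_nonneg hθ.nonneg _ _)
      have f1 : ∑ H ∈ ℋ, kap θ T (verts H) ≤ ℋ.card * (N ^ r * load θ X T) := by
        rw [← nsmul_eq_mul]
        refine sum_le_card_nsmul _ _ _ fun H hH => e3 _ ?_
        refine biUnion_subset.2 fun x hx => ?_
        rcases mem_union.1 (h1.sub H hH hx) with h | h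
        exacts [(hX0 x h).2.2, (h3 x h).1]
      have f2 : ∑ x ∈ R, kap θ T x.1 ≤ R.card * (N ^ r * load θ X T) := by
        rw [← nsmul_eq_mul]
        exact sum_le_card_nsmul _ _ _ fun x hx => e3 _ (h3 x hx).1
      have f3 : (ℋ.card : ℝ) ≤ (2 : ℝ) ^ K := by exact_mod_cast h5
      have f4 : (R.card : ℝ) ≤ K := by exact_mod_cast h4
      push_cast
      nlinarith
    have hl := load_nonneg hθ.nonneg X T
    calc _ ≤ (2 ^ (2 * m + 1) + m : ℕ) * load θ X T + ((2 ^ K + K : ℕ) : ℝ) * (N ^ r * load θ X T) :=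
          add_le_add e1 e4
      _ = (((2 ^ (2 * m + 1) + m : ℕ) : ℝ) + ((2 ^ K + K : ℕ) : ℝ) * N ^ r) * load θ X T := by ring
      _ ≤ _ := by
          refine mul_le_mul_of_nonneg_right ?_ hl
          push_cast
          have g1 : (0 : ℝ) ≤ 2 * 2 ^ (2 * m + 1) + (2 ^ K + 2 * K) := by positivity
          linarith

/-- Absorption inside windows of size up to `N * ρ ^ k`. -/
theorem exists_absorbs {q r N : ℕ} (hr : 1 ≤ r) (hqr : r < q) (hN1 : 1 ≤ N)
    (hE : Completes.{u} q r N) (k : ℕ) :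
    ∃ C, ∀ (V : Type u) [DecidableEq V] [Fintype V], Absorbs V q r N C k := by
  induction k with
  | zero => exact ⟨_, fun V _ _ => Absorbs.zero hqr hN1 rfl hE⟩
  | succ k ih =>
    obtain ⟨C, hC⟩ := ih
    exact ⟨_, fun V _ _ => (hC V).succ hr hqr hN1⟩

end Base
end RefineDown

/-! ### Octahedra and sets with small vertex sum -/

namespace RefineDown
open Finset
section Octahedron
variable {V : Type u} [DecidableEq V]

/-- The `k`-subsets of `Y` whose vertex sum, shifted by `s`, is less than `c`. -/
def sumSets {n : ℕ} (Y : Finset V) (e : V → ZMod n) (k c : ℕ) (s : ZMod n) : Finset (Finset V) :=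
  (Y.powersetCard k).filter fun g => (∑ y ∈ g, e y - s).val < c

/-- Replace the vertices of `I` by their images under `f`. -/
def swap (f : V → V) (g I : Finset V) : Finset V := (g \ I) ∪ I.image f

/-- As `T` is smaller than `g`, it avoids both `y` and `f y` for some `y`. Toggling `y` in `I`
changes the sign but not the condition on `T`, so the terms cancel in pairs. -/
lemma sum_octahedron_eq_zero {f : V → V} {g : Finset V} (hf : ∀ y ∈ g, f y ∉ g)
    (hinj : Set.InjOn f g) {T : Finset V} (hT : T.card < g.card) :
    ∑ I ∈ g.powerset, (-1 : ℤ) ^ I.card * (if T ⊆ swap f g I then 1 else 0) = 0 := by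
  -- some vertex occurs in `T` neither itself nor by its image
  obtain ⟨y, hy, hyT, hfyT⟩ : ∃ y ∈ g, y ∉ T ∧ f y ∉ T := by
    by_contra! hcon
    have h1 : g.card ≤ T.card := by
      refine card_le_card_of_injOn (fun y => if y ∈ T then y else f y) ?_ ?_
      · intro y hy
        by_cases h : y ∈ T
        · simp [h]
        · simpa [h] using hcon y hy h
      · intro y hy y' hy' h
        dsimp only at h
        split_ifs at h with h1 h2 h2
        · exact h
        · exact absurd (h ▸ hy) (hf y' hy')
        · exact absurd (h.symm ▸ hy') (hf y hy)
        · exact hinj hy hy' h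
    omega
  have hpair : ∀ I : Finset V, y ∉ I → (T ⊆ swap f g (insert y I) ↔ T ⊆ swap f g I) := by
    intro I _
    have key : ∀ z ∈ T, (z ∈ swap f g (insert y I) ↔ z ∈ swap f g I) := by
      intro z hz
      have hzy : z ≠ y := fun h => hyT (h ▸ hz)
      have hzf : z ≠ f y := fun h => hfyT (h ▸ hz)
      simp [swap, image_insert, hzy, hzf]
    exact ⟨fun h z hz => (key z hz).1 (h hz), fun h z hz => (key z hz).2 (h hz)⟩
  rw [← insert_erase hy, sum_powerset_insert (notMem_erase _ _), ← sum_add_distrib]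
  refine sum_eq_zero fun I hI => ?_
  have hyI : y ∉ I := fun h => notMem_erase y g (mem_powerset.1 hI h)
  rw [card_insert_of_notMem hyI, insert_erase hy]
  simp only [hpair I hyI]
  ring

variable {n : ℕ} [NeZero n]

omit [NeZero n] in
-- These are the opposite vertices of an octahedron on `g`, chosen with slightly smaller labels so
-- that every replacement lowers the vertex sum by a small positive amount.
lemma exists_star {Y : Finset V} {e : V → ZMod n}
    (hsurj : ∀ z, ∃ y ∈ Y, e y = z) {g : Finset V} {k : ℕ} (hgk : g.card = k) (hn : 2 * k < n) :
    ∀ g' ⊆ g, ∃ (f : V → V) (δ : V → ℕ), (∀ y ∈ g', f y ∈ Y ∧ f y ∉ g ∧ 1 ≤ δ y ∧ δ y ≤ 2 * k ∧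
      e (f y) = e y - δ y) ∧ Set.InjOn f g' := by
  intro g'
  induction g' using Finset.induction_on with
  | empty => exact fun _ => ⟨id, 0, by simp, by simp⟩
  | insert y g' hy ih =>
    intro hsub
    obtain ⟨f, δ, hf, hinj⟩ := ih ((subset_insert _ _).trans hsub)
    have hg'k : g'.card < k := by
      have := card_le_card hsub
      rw [card_insert_of_notMem hy] at this
      omega
    -- There are 2k candidates, distinct modulo `n` because 2k < n, whereas `g` and the images
    -- chosen so far occupy fewer than 2k labels.
    obtain ⟨d, hd, hdn⟩ : ∃ d ∈ Icc 1 (2 * k), e y - (d : ZMod n) ∉ (g ∪ g'.image f).image e := by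
      by_contra! hcon
      have h1 : (Icc 1 (2 * k)).card ≤ ((g ∪ g'.image f).image e).card := by
        refine card_le_card_of_injOn (fun d : ℕ => e y - (d : ZMod n)) (fun d hd => hcon d hd) ?_
        intro d hd d' hd' h
        simp only [coe_Icc, Set.mem_Icc] at hd hd'
        have h2 : (d : ZMod n) = d' := sub_right_injective h
        have h3 := congrArg ZMod.val h2
        rwa [ZMod.val_natCast_of_lt (by omega), ZMod.val_natCast_of_lt (by omega)] at h3
      have h2 : ((g ∪ g'.image f).image e).card ≤ k + g'.card :=
        card_image_le.trans ((card_union_le _ _).trans (by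
          have := card_image_le (s := g') (f := f)
          omega))
      rw [Nat.card_Icc] at h1
      omega
    obtain ⟨z, hzY, hz⟩ := hsurj (e y - d)
    have hzg : z ∉ g ∪ g'.image f := fun h => hdn (by rw [← hz]; exact mem_image_of_mem _ h)
    rw [mem_union, not_or] at hzg
    rw [mem_Icc] at hd
    refine ⟨Function.update f y z, Function.update δ y d, ?_, ?_⟩
    · intro y' hy'
      by_cases h : y' = y
      · subst h
        simp only [Function.update_self]
        exact ⟨hzY, hzg.1, hd.1, hd.2, hz⟩
      · simp only [Function.update_of_ne h]
        exact hf y' ((mem_insert.1 hy').resolve_left h)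
    · intro a ha b hb hab
      simp only [coe_insert, Set.mem_insert_iff, mem_coe] at ha hb
      by_cases h1 : a = y <;> by_cases h2 : b = y
      · rw [h1, h2]
      · subst h1
        rw [Function.update_self, Function.update_of_ne h2] at hab
        exact absurd (mem_image.2 ⟨b, hb.resolve_left h2, hab.symm⟩) hzg.2
      · subst h2
        rw [Function.update_self, Function.update_of_ne h1] at hab
        exact absurd (mem_image.2 ⟨a, ha.resolve_left h1, hab⟩) hzg.2
      · rw [Function.update_of_ne h1, Function.update_of_ne h2] at hab
        exact hinj (ha.resolve_left h1) (hb.resolve_left h2) hab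

/-- Modulo octahedra, every `k`-set is a combination of those with small shifted sum. -/
theorem exists_sumSets_combination {Y : Finset V} {e : V → ZMod n}
    (hsurj : ∀ z, ∃ y ∈ Y, e y = z) {k : ℕ} (hn : 2 * k < n) (s : ZMod n) :
    ∀ (b : ℕ) (g : Finset V), g ∈ Y.powersetCard k → (∑ y ∈ g, e y - s).val = b →
      ∃ c : Finset V → ℤ, ∀ T : Finset V, T.card < k → (if T ⊆ g then (1 : ℤ) else 0)
        = ∑ h ∈ sumSets Y e k (2 * k * k) s, if T ⊆ h then c h else 0 := by
  intro b
  induction b using Nat.strong_induction_on with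
  | _ b ih =>
  intro g hg hb
  obtain ⟨hgY, hgk⟩ := mem_powersetCard.1 hg
  by_cases hbc : b < 2 * k * k
  · have hgm : g ∈ sumSets Y e k (2 * k * k) s := mem_filter.2 ⟨hg, by rw [hb]; exact hbc⟩
    refine ⟨fun h => if h = g then 1 else 0, fun T _ => ?_⟩
    rw [sum_eq_single g]
    · simp
    · intro h _ hne; simp [hne]
    · intro h; exact absurd hgm h
  obtain ⟨f, δ, hf, hinj⟩ := exists_star hsurj hgk hn g subset_rfl
  have hdisj : ∀ I ⊆ g, Disjoint (g \ I) (I.image f) := by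
    intro I hI
    rw [disjoint_left]
    intro y hy hy'
    obtain ⟨z, hz, rfl⟩ := mem_image.1 hy'
    exact (hf z (hI hz)).2.1 (mem_sdiff.1 hy).1
  have hcomb : ∀ I : Finset V, ∃ c : Finset V → ℤ, I ∈ g.powerset.erase ∅ → ∀ T : Finset V, T.card < k →
      (if T ⊆ swap f g I then (1 : ℤ) else 0)
        = ∑ h ∈ sumSets Y e k (2 * k * k) s, if T ⊆ h then c h else 0 := by
    intro I
    by_cases hI : I ∈ g.powerset.erase ∅
    swap
    · exact ⟨0, fun h => absurd h hI⟩
    rw [mem_erase, mem_powerset] at hI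
    obtain ⟨hIne, hIg⟩ := hI
    have hinjI : Set.InjOn f I := hinj.mono (by exact_mod_cast hIg)
    have hsum : ∑ y ∈ swap f g I, e y - s
        = (∑ y ∈ g, e y - s) - ((∑ y ∈ I, δ y : ℕ) : ZMod n) := by
      have h1 : ∑ y ∈ swap f g I, e y = ∑ y ∈ g \ I, e y + ∑ y ∈ I, e (f y) := by
        unfold swap
        rw [sum_union (hdisj I hIg), sum_image hinjI]
      have h2 : ∑ y ∈ I, e (f y) = ∑ y ∈ I, e y - ((∑ y ∈ I, δ y : ℕ) : ZMod n) := by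
        rw [sum_congr rfl fun y hy => (hf y (hIg hy)).2.2.2.2, sum_sub_distrib]
        push_cast; rfl
      rw [h1, h2, ← sum_sdiff hIg]
      ring
    have hδ1 : 1 ≤ ∑ y ∈ I, δ y := by
      obtain ⟨y, hy⟩ := nonempty_iff_ne_empty.2 hIne
      exact ((hf y (hIg hy)).2.2.1).trans (single_le_sum (f := δ) (fun _ _ => Nat.zero_le _) hy)
    have hδ2 : ∑ y ∈ I, δ y ≤ 2 * k * k := by
      calc ∑ y ∈ I, δ y ≤ ∑ y ∈ I, 2 * k := sum_le_sum fun y hy => (hf y (hIg hy)).2.2.2.1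
        _ = I.card * (2 * k) := by rw [sum_const, smul_eq_mul]
        _ ≤ k * (2 * k) := Nat.mul_le_mul_right _ (hgk ▸ card_le_card hIg)
        _ = _ := by ring
    have hbn : b < n := hb ▸ ZMod.val_lt _
    -- The total decrease is between 1 and 2k², and b ≥ 2k² in this case: the sum decreases strictly
    -- and does not wrap around modulo `n`, so the induction applies.
    have hval : (∑ y ∈ swap f g I, e y - s).val = b - ∑ y ∈ I, δ y := by
      rw [hsum, ZMod.val_sub]
      · rw [hb, ZMod.val_natCast_of_lt (by omega)]
      · rw [hb, ZMod.val_natCast_of_lt (by omega)]; omega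
    obtain ⟨c, hc⟩ := ih (b - ∑ y ∈ I, δ y) (by omega) (swap f g I) (by
      refine mem_powersetCard.2 ⟨union_subset (sdiff_subset.trans hgY) ?_, ?_⟩
      · intro y hy
        obtain ⟨z, hz, rfl⟩ := mem_image.1 hy
        exact (hf z (hIg hz)).1
      · unfold swap
        rw [card_union_of_disjoint (hdisj I hIg), card_sdiff_of_subset hIg,
          card_image_of_injOn hinjI, hgk]
        have := card_le_card hIg
        omega) hval
    exact ⟨c, fun _ => hc⟩
  choose c hc using hcomb
  -- The octahedron relation is solved for its term I = ∅, which is `g` itself.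
  refine ⟨fun h => -∑ I ∈ g.powerset.erase ∅, (-1 : ℤ) ^ I.card * c I h, fun T hT => ?_⟩
  have h0 := sum_octahedron_eq_zero (fun y hy => (hf y hy).2.1) hinj (hgk.symm ▸ hT : T.card < g.card)
  rw [← add_sum_erase _ _ (empty_mem_powerset g)] at h0
  have h1 : swap f g ∅ = g := by simp [swap]
  rw [h1, card_empty, pow_zero, one_mul] at h0
  rw [eq_neg_of_add_eq_zero_left h0, sum_congr rfl fun I hI => by rw [hc I hI T hT, mul_sum],
    sum_comm, ← sum_neg_distrib]
  refine sum_congr rfl fun h _ => ?_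
  split_ifs
  · rfl
  · simp

lemma exists_zmod_labelling {Y : Finset V} (hn : Y.card = n) :
    ∃ e : V → ZMod n, Set.InjOn e Y ∧ ∀ z, ∃ y ∈ Y, e y = z := by
  let φ : {x // x ∈ Y} ≃ ZMod n := Fintype.equivOfCardEq (by simp [ZMod.card, hn])
  refine ⟨fun v => if h : v ∈ Y then φ ⟨v, h⟩ else 0, ?_, ?_⟩
  · intro a ha b hb hab
    simp only [mem_coe] at ha hb
    simp only [ha, hb, dif_pos] at hab
    simpa using hab
  · intro z
    refine ⟨(φ.symm z).1, (φ.symm z).2, ?_⟩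
    simp

/-- Given `T`, the last vertex is determined by the vertex sum, which takes at most `c` values. This
keeps the degrees of the carry bounded. -/
lemma card_sumSets_superset_le {Y : Finset V} {e : V → ZMod n} (he : Set.InjOn e Y) {k c : ℕ}
    (s : ZMod n) {T : Finset V} (hT : T.card + 1 = k) :
    ((sumSets Y e k c s).filter fun h => T ⊆ h).card ≤ c := by
  rw [← card_range c]
  refine card_le_card_of_injOn (fun g => (∑ y ∈ g, e y - s).val) ?_ ?_
  · intro g hg
    simp only [sumSets, coe_filter, mem_filter, Set.mem_ofPred_eq] at hg
    simpa using hg.1.2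
  · intro g hg g' hg' h
    simp only [sumSets, coe_filter, mem_filter, Set.mem_ofPred_eq, mem_powersetCard] at hg hg'
    have h1 : ∑ y ∈ g, e y = ∑ y ∈ g', e y := sub_left_injective (ZMod.val_injective n h)
    have hy : ∀ g : Finset V, T ⊆ g → g.card = k → ∃ y ∉ T, insert y T = g := by
      intro g hTg hgk
      have := (covBy_iff_card_sdiff_eq_one (s := g) (t := T)).2 ⟨hTg, by
        rw [card_sdiff_of_subset hTg]; omega⟩
      obtain ⟨y, hyT, hyg⟩ := (Finset.covBy_iff_exists_insert).1 this
      exact ⟨y, hyT, hyg⟩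
    obtain ⟨y, hyT, rfl⟩ := hy g hg.2 hg.1.1.2
    obtain ⟨y', hyT', rfl⟩ := hy g' hg'.2 hg'.1.1.2
    rw [sum_insert hyT, sum_insert hyT'] at h1
    have := he (hg.1.1.1 (mem_insert_self _ _)) (hg'.1.1.1 (mem_insert_self _ _)) (add_right_cancel h1)
    rw [this]

/-- A fixed set is selected by at most `c` of the `n` shifts, so the carry of a random shift has
load about 1/n of that of all `k`-sets. -/
lemma card_shifts_le (Y : Finset V) (e : V → ZMod n) (k c : ℕ) (g : Finset V) :
    ((univ : Finset (ZMod n)).filter fun s => g ∈ sumSets Y e k c s).card ≤ c := by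
  rw [← card_range c]
  refine card_le_card_of_injOn (fun s => (∑ y ∈ g, e y - s).val) ?_ ?_
  · intro s hs
    simp only [sumSets, coe_filter, mem_filter, Set.mem_ofPred_eq] at hs
    simpa using hs.2.2
  · intro s _ s' _ h
    exact sub_right_injective (ZMod.val_injective n h)

/-- The degrees of a set of edges can be cancelled by the sets of small shifted sum. -/
theorem exists_cancelling {Y S : Finset V} {e : V → ZMod n}
    (hsurj : ∀ z, ∃ y ∈ Y, e y = z) {r k : ℕ} (hk : S.card + k = r)
    (hn : 2 * k < n) (s : ZMod n) (U : Finset (Lab V))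
    (hU : ∀ x ∈ U, x.1.card = r ∧ S ⊆ x.1 ∧ x.1 ⊆ S ∪ Y) :
    ∃ c : Finset V → ℤ, ∀ T, S ⊆ T → T.card < r → (ldeg U T : ℤ)
      + ∑ h ∈ sumSets Y e k (2 * k * k) s, (if T ⊆ S ∪ h then c h else 0) = 0 := by
  have h1 : ∀ g : Finset V, ∃ c : Finset V → ℤ, g ∈ Y.powersetCard k → ∀ T : Finset V, T.card < k →
      (if T ⊆ g then (1 : ℤ) else 0)
        = ∑ h ∈ sumSets Y e k (2 * k * k) s, if T ⊆ h then c h else 0 := by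
    intro g
    by_cases hg : g ∈ Y.powersetCard k
    · obtain ⟨c, hc⟩ := exists_sumSets_combination hsurj hn s _ g hg rfl
      exact ⟨c, fun _ => hc⟩
    · exact ⟨0, fun h => absurd h hg⟩
  choose c hc using h1
  refine ⟨fun h => -∑ x ∈ U, c (x.1 \ S) h, fun T hST hT => ?_⟩
  have hTS : ∀ h : Finset V, T ⊆ S ∪ h ↔ T \ S ⊆ h := fun h => sdiff_le_iff.symm
  have h2 : (ldeg U T : ℤ) = ∑ x ∈ U, if T \ S ⊆ x.1 \ S then (1 : ℤ) else 0 := by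
    unfold ldeg
    rw [card_filter]
    push_cast
    refine sum_congr rfl fun x hx => ?_
    have : T ⊆ x.1 ↔ T \ S ⊆ x.1 \ S := by
      rw [← hTS, union_sdiff_of_subset (hU x hx).2.1]
    simp only [this]
  have h3 : ∀ x ∈ U, (if T \ S ⊆ x.1 \ S then (1 : ℤ) else 0)
      = ∑ h ∈ sumSets Y e k (2 * k * k) s, if T \ S ⊆ h then c (x.1 \ S) h else 0 := by
    intro x hx
    refine hc _ (mem_powersetCard.2 ⟨sdiff_le_iff.2 (hU x hx).2.2, ?_⟩) _ ?_
    · rw [card_sdiff_of_subset (hU x hx).2.1, (hU x hx).1]; omega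
    · rw [card_sdiff_of_subset hST]
      have := card_le_card hST
      omega
  rw [h2, sum_congr rfl h3, sum_comm, ← sum_add_distrib]
  refine sum_eq_zero fun h _ => ?_
  simp only [hTS]
  split_ifs <;> simp

end Octahedron
end RefineDown

/-! ### Colour classes and the carry between them -/

namespace RefineDown
open Finset MultiHypergraph
section Carry
variable {V : Type u} [DecidableEq V]

/-- Greedy colouring: edges of the same colour do not share an `(r-1)`-set containing `S`. -/
lemma exists_colouring {r D : ℕ} {S : Finset V} (hr : 1 ≤ r) (X : Finset (Lab V))
    (hX : ∀ x ∈ X, x.1.card = r)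
    (hD : ∀ T, S ⊆ T → T.card = r - 1 → ldeg X T ≤ D) :
    ∃ col : Lab V → ℕ, (∀ x ∈ X, col x < r * D + 1) ∧
      ∀ j T, S ⊆ T → T.card = r - 1 → ldeg (X.filter fun x => col x = j) T ≤ 1 := by
  induction X using Finset.induction_on with
  | empty => exact ⟨fun _ => 0, by simp, by simp [ldeg]⟩
  | insert x X hx ih =>
    obtain ⟨col, hcol, hdeg⟩ := ih (fun y hy => hX y (mem_insert_of_mem hy))
      fun T hST hT => (ldeg_mono (subset_insert _ _) T).trans (hD T hST hT)
    -- The earlier edges that share with `x` an (r-1)-set containing `S`. Each of the `r` subsets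
    -- contributes at most `D`, so `r * D + 1` colours suffice.
    set bad := (((x.1.powersetCard (r - 1)).filter fun T => S ⊆ T).biUnion fun T =>
      X.filter fun y : Lab V => T ⊆ y.1) with hbad
    have hbadc : bad.card ≤ r * D := by
      refine card_biUnion_le.trans ?_
      calc _ ≤ ∑ T ∈ (x.1.powersetCard (r - 1)).filter fun T => S ⊆ T, D :=
            sum_le_sum fun T hT => by
              obtain ⟨h1, h2⟩ := mem_filter.1 hT
              exact (ldeg_mono (subset_insert x X) T).trans (hD T h2 (mem_powersetCard.1 h1).2)
        _ ≤ (x.1.powersetCard (r - 1)).card * D := by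
            rw [sum_const, smul_eq_mul]
            exact Nat.mul_le_mul_right _ (card_filter_le _ _)
        _ = r * D := by
            rw [card_powersetCard, hX x (mem_insert_self _ _), Nat.choose_symm hr,
              Nat.choose_one_right]
    obtain ⟨j₀, hj₀, hj₀b⟩ : ∃ j₀ ∈ range (r * D + 1), j₀ ∉ bad.image col :=
      exists_mem_notMem_of_card_lt_card (by
        rw [card_range]; exact Nat.lt_succ_of_le (card_image_le.trans hbadc))
    have hnex : ∀ y ∈ X, y ≠ x := fun y hy h => hx (h ▸ hy)
    refine ⟨fun y => if y = x then j₀ else col y, ?_, ?_⟩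
    · intro y hy
      dsimp only
      split_ifs with h
      · exact mem_range.1 hj₀
      · exact hcol y ((mem_insert.1 hy).resolve_left h)
    · intro j T hST hT
      unfold ldeg
      by_cases hjT : j = j₀ ∧ T ⊆ x.1
      · refine card_le_one.2 fun y hy z hz => ?_
        have key : ∀ y ∈ ((insert x X).filter fun y => (if y = x then j₀ else col y) = j).filter
            fun y => T ⊆ y.1, y = x := by
          intro y hy
          by_contra hyx
          simp only [mem_filter, mem_insert, hyx, false_or, if_false] at hy
          refine hj₀b (mem_image.2 ⟨y, mem_biUnion.2 ⟨T, mem_filter.2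
            ⟨mem_powersetCard.2 ⟨hjT.2, hT⟩, hST⟩, mem_filter.2 ⟨hy.1.1, hy.2⟩⟩, ?_⟩)
          rw [hy.1.2, hjT.1]
        rw [key y hy, key z hz]
      · refine (card_le_card ?_).trans (hdeg j T hST hT)
        intro y hy
        simp only [mem_filter, mem_insert] at hy ⊢
        obtain ⟨⟨hy1, hy2⟩, hy3⟩ := hy
        by_cases hyx : y = x
        · subst hyx
          rw [if_pos rfl] at hy2
          exact absurd ⟨hy2.symm, hy3⟩ hjT
        · rw [if_neg hyx] at hy2
          exact ⟨⟨hy1.resolve_left hyx, hy2⟩, hy3⟩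

/-- `Z` consists of `m` copies of `S ∪ h` for every `h ∈ 𝒯`. -/
structure Copies (m : ℕ) (S : Finset V) (𝒯 : Finset (Finset V)) (Z : Finset (Lab V)) : Prop where
  mem : ∀ x ∈ Z, x.1 ∈ 𝒯.image fun h => S ∪ h
  card : ∀ e ∈ 𝒯.image fun h => S ∪ h, (Z.filter fun x => x.1 = e).card = m

lemma exists_copies (m : ℕ) (S : Finset V) (𝒯 : Finset (Finset V)) (A : Finset (Lab V)) :
    ∃ Z, Copies m S 𝒯 Z ∧ Disjoint Z A := by
  obtain ⟨Z, h1, h2, h3⟩ := exists_fresh A (𝒯.image fun h => S ∪ h) fun _ => m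
  exact ⟨Z, ⟨h2, h3⟩, h1⟩

lemma union_injOn {S Y : Finset V} (hSY : Disjoint S Y) {𝒯 : Finset (Finset V)}
    (h𝒯 : ∀ h ∈ 𝒯, h ⊆ Y) : Set.InjOn (fun h => S ∪ h) (𝒯 : Set (Finset V)) := by
  intro a ha b hb hab
  have key : ∀ a ∈ 𝒯, (S ∪ a) \ S = a := fun a ha => by
    rw [union_sdiff_left, sdiff_eq_self_of_disjoint (disjoint_of_subset_right (h𝒯 a ha) hSY).symm]
  rw [← key a ha, ← key b hb]
  exact congrArg (· \ S) hab

lemma Copies.ldeg {m : ℕ} {S Y : Finset V} {𝒯 : Finset (Finset V)} {Z : Finset (Lab V)}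
    (hZ : Copies m S 𝒯 Z) (hSY : Disjoint S Y) (h𝒯 : ∀ h ∈ 𝒯, h ⊆ Y) (T : Finset V) :
    ldeg Z T = m * (𝒯.filter fun h => T ⊆ S ∪ h).card := by
  rw [ldeg_eq_sum hZ.mem, sum_congr rfl fun e he => hZ.card e (mem_filter.1 he).1, sum_const,
    smul_eq_mul, mul_comm, filter_image, card_image_of_injOn]
  exact (union_injOn hSY h𝒯).mono (by exact_mod_cast filter_subset _ _)

lemma Copies.load {m : ℕ} {S Y : Finset V} {𝒯 : Finset (Finset V)} {Z : Finset (Lab V)}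
    (hZ : Copies m S 𝒯 Z) (hSY : Disjoint S Y) (h𝒯 : ∀ h ∈ 𝒯, h ⊆ Y) (θ : V → ℝ) (T : Finset V) :
    load θ Z T = m * ∑ h ∈ 𝒯, kap θ T (S ∪ h) := by
  unfold RefineDown.load
  rw [← sum_fiberwise_of_maps_to (s := Z) (g := Prod.fst) hZ.mem, sum_image (union_injOn hSY h𝒯), mul_sum]
  refine sum_congr rfl fun h hh => ?_
  rw [sum_congr rfl (g := fun _ => kap θ T (S ∪ h)), sum_const, nsmul_eq_mul,
    hZ.card _ (mem_image_of_mem _ hh)]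
  intro x hx
  rw [(mem_filter.1 hx).2]

/-- Every set of edges becomes `S`-divisible after adding some of the copies. -/
lemma Copies.exists_carry {n : ℕ} [NeZero n] {q r k : ℕ} (hqr : r < q) {S Y : Finset V}
    (hSY : Disjoint S Y) {e : V → ZMod n} (hsurj : ∀ z, ∃ y ∈ Y, e y = z) (hk : S.card + k = r)
    (hn : 2 * k < n) (s : ZMod n) {Z : Finset (Lab V)}
    (hZ : Copies (M q r) S (sumSets Y e k (2 * k * k) s) Z) (U : Finset (Lab V))
    (hU : ∀ x ∈ U, x.1.card = r ∧ S ⊆ x.1 ∧ x.1 ⊆ S ∪ Y) (hUZ : Disjoint U Z) :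
    ∃ D ⊆ Z, SDiv q r S (U ∪ D) := by
  set 𝒯 := sumSets Y e k (2 * k * k) s with h𝒯def
  have h𝒯 : ∀ h ∈ 𝒯, h ⊆ Y := fun h hh => (mem_powersetCard.1 (mem_filter.1 hh).1).1
  obtain ⟨c, hc⟩ := exists_cancelling hsurj hk hn s U hU
  have hm0 : (0 : ℤ) < M q r := by exact_mod_cast M_pos hqr.le
  have hdm : ∀ h, ((c h % M q r).toNat : ℤ) = c h % M q r := fun e =>
    Int.toNat_of_nonneg (Int.emod_nonneg _ hm0.ne')
  -- Cancellation is exact over ℤ; reducing the coefficients modulo `M q r` preserves divisibility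
  -- and fits the available number of copies.
  obtain ⟨D, hDZ, hDE, hDc⟩ := exists_subset_mult Z (𝒯.image fun h => S ∪ h)
    (fun e => (c (e \ S) % M q r).toNat) (by
      intro e he
      rw [hZ.card e he]
      have h1 := Int.emod_lt_of_pos (c (e \ S)) hm0
      have h2 := hdm (e \ S)
      omega)
  refine ⟨D, hDZ, fun T hST hT => ?_⟩
  rw [ldeg_union (disjoint_of_subset_right hDZ hUZ), ldeg_eq_sum hDE]
  have h1 := hc T hST hT
  have hch : ((ch q r T.card : ℕ) : ℤ) ∣ (M q r : ℤ) := by exact_mod_cast ch_dvd_M hT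
  zify
  rw [filter_image, sum_image ((union_injOn hSY h𝒯).mono (by exact_mod_cast filter_subset _ _))]
  rw [← sum_filter] at h1
  rw [← dvd_sub_right (b := (0 : ℤ)) (dvd_zero _), ← h1, add_sub_add_left_eq_sub, ← sum_sub_distrib]
  refine dvd_sum fun h hh => ?_
  have hh' := (mem_filter.1 hh).1
  have hS : (S ∪ h) \ S = h := by
    rw [union_sdiff_left, sdiff_eq_self_of_disjoint (disjoint_of_subset_right (h𝒯 h hh') hSY).symm]
  rw [hDc _ (mem_image_of_mem _ hh'), hS, hdm]
  exact hch.trans Int.dvd_self_sub_emod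

/-- One more piece `X₁` is absorbed, together with the old carry `Z` and a new carry `Z'`. -/
theorem Ref.step_carry {q r c : ℕ} {S : Finset V} {X X₁ R Z Z' R₂ : Finset (Lab V)}
    {ℋ ℋ₂ : Finset (Finset (Lab V))} (h : Ref q r (2 * c) S X R ℋ Z)
    (hall : ∀ L ⊆ X, ∃ Q ⊆ ℋ, (Q : Set (Finset (Lab V))).PairwiseDisjoint id ∧
      (∀ H ∈ Q, H ⊆ L ∪ R) ∧ ∀ x ∈ L ∪ R, S ⊆ x.1 → x ∉ Z → ∃ H ∈ Q, x ∈ H)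
    (hZR : Z ⊆ R) (hcnt : ∀ x ∈ Z, cnt ℋ x ≤ c) (h₂ : Ref q r c S (X₁ ∪ Z ∪ Z') R₂ ℋ₂ ∅)
    (hX₁ : Disjoint X₁ (X ∪ R)) (hZ' : Disjoint Z' (X ∪ X₁ ∪ R))
    (hR₂ : Disjoint R₂ (X ∪ X₁ ∪ R ∪ Z')) (hZ'u : ∀ x ∈ Z', x.1.card = r) (hZ'd : SDiv q r ∅ Z')
    (hcarry : ∀ U ⊆ X₁ ∪ Z, ∃ D ⊆ Z', SDiv q r S (U ∪ D)) :
    Ref q r (2 * c) S (X ∪ X₁) (R ∪ (Z' ∪ R₂)) (ℋ ∪ ℋ₂) Z' ∧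
    (∀ L ⊆ X ∪ X₁, ∃ Q ⊆ ℋ ∪ ℋ₂, (Q : Set (Finset (Lab V))).PairwiseDisjoint id ∧
      (∀ H ∈ Q, H ⊆ L ∪ (R ∪ (Z' ∪ R₂))) ∧
      ∀ x ∈ L ∪ (R ∪ (Z' ∪ R₂)), S ⊆ x.1 → x ∉ Z' → ∃ H ∈ Q, x ∈ H) ∧
    ∀ x ∈ Z', cnt (ℋ ∪ ℋ₂) x ≤ c := by
  simp only [disjoint_union_right] at hX₁ hZ' hR₂
  obtain ⟨⟨⟨hR₂X, hR₂X₁⟩, hR₂R⟩, hR₂Z'⟩ := hR₂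
  obtain ⟨⟨hZ'X, hZ'X₁⟩, hZ'R⟩ := hZ'
  have hcover : ∀ L ⊆ X ∪ X₁, ∃ Q ⊆ ℋ ∪ ℋ₂, (Q : Set (Finset (Lab V))).PairwiseDisjoint id ∧
      (∀ H ∈ Q, H ⊆ L ∪ (R ∪ (Z' ∪ R₂))) ∧
      ∀ x ∈ L ∪ (R ∪ (Z' ∪ R₂)), S ⊆ x.1 → x ∉ Z' → ∃ H ∈ Q, x ∈ H := by
    intro L hL
    obtain ⟨Q, hQ, hQd, hQL, hQc⟩ := hall (L ∩ X) inter_subset_right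
    -- What has to be covered now: the edges of `L` in the new piece and the unused part of the old
    -- carry. Part of the new carry makes it `S`-divisible; the other part of `Z'` stays as
    -- remainder. Hence nothing is assumed of `L`.
    set D := (L ∩ X₁) ∪ (Z \ Q.biUnion id) with hD
    obtain ⟨c', hc', hdiv⟩ := hcarry D (union_subset_union inter_subset_right sdiff_subset)
    have hDc : D ∪ c' ⊆ X₁ ∪ Z ∪ Z' :=
      union_subset_union (union_subset_union inter_subset_right sdiff_subset) hc'
    obtain ⟨Q₂, hQ₂, hQ₂d, hQ₂L, hQ₂c⟩ := h₂.cover _ hDc hdiv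
    have hDL : D ⊆ L ∪ (R ∪ (Z' ∪ R₂)) := union_subset (inter_subset_left.trans subset_union_left)
      ((sdiff_subset.trans hZR).trans (subset_union_left.trans subset_union_right))
    have hcross : ∀ H ∈ Q, ∀ H' ∈ Q₂, Disjoint H H' := by
      intro H hH H' hH'
      rw [disjoint_left]
      intro x hx hx'
      have h1 : x ∈ X ∪ R := h.sub H (hQ hH) hx
      have h2 : x ∈ D ∪ c' ∪ R₂ := hQ₂L H' hH' hx'
      simp only [hD, mem_union, mem_inter, mem_sdiff] at h2
      rcases h2 with ((h2 | h2) | h2) | h2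
      · rcases mem_union.1 h1 with h1 | h1
        exacts [disjoint_left.1 hX₁.1 h2.2 h1, disjoint_left.1 hX₁.2 h2.2 h1]
      · exact h2.2 (mem_biUnion.2 ⟨H, hH, hx⟩)
      · rcases mem_union.1 h1 with h1 | h1
        exacts [disjoint_left.1 hZ'X (hc' h2) h1, disjoint_left.1 hZ'R (hc' h2) h1]
      · rcases mem_union.1 h1 with h1 | h1
        exacts [disjoint_left.1 hR₂X h2 h1, disjoint_left.1 hR₂R h2 h1]
    refine ⟨Q ∪ Q₂, union_subset_union hQ hQ₂, ?_, ?_, ?_⟩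
    · intro A hA B hB hAB
      simp only [coe_union, Set.mem_union, mem_coe] at hA hB
      rcases hA with hA | hA <;> rcases hB with hB | hB
      · exact hQd hA hB hAB
      · exact hcross A hA B hB
      · exact (hcross B hB A hA).symm
      · exact hQ₂d hA hB hAB
    · intro H hH
      rcases mem_union.1 hH with hH | hH
      · exact (hQL H hH).trans (union_subset_union inter_subset_left subset_union_left)
      · refine (hQ₂L H hH).trans (union_subset (union_subset hDL ?_) ?_)
        · exact hc'.trans (subset_union_left.trans (subset_union_right.trans subset_union_right))
        · exact subset_union_right.trans (subset_union_right.trans subset_union_right)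
    · intro x hx hSx hxZ'
      have key : x ∈ D ∪ c' ∪ R₂ → ∃ H ∈ Q ∪ Q₂, x ∈ H := by
        intro h
        obtain ⟨H, hH, hxH⟩ := hQ₂c x h hSx (notMem_empty x)
        exact ⟨H, mem_union_right _ hH, hxH⟩
      by_cases hxQ : x ∈ Q.biUnion id
      · obtain ⟨H, hH, hxH⟩ := mem_biUnion.1 hxQ
        exact ⟨H, mem_union_left _ hH, hxH⟩
      by_cases hxR₂ : x ∈ R₂
      · exact key (mem_union_right _ hxR₂)
      by_cases hxZ : x ∈ Z
      · exact key (mem_union_left _ (mem_union_left _ (mem_union_right _ (mem_sdiff.2 ⟨hxZ, hxQ⟩))))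
      by_cases hxX₁ : x ∈ L ∩ X₁
      · exact key (mem_union_left _ (mem_union_left _ (mem_union_left _ hxX₁)))
      have hx2 : x ∈ L ∩ X ∪ R := by
        simp only [mem_union, mem_inter] at hx hxX₁ ⊢
        rcases hx with hx | hx | hx | hx
        · have := hL hx
          rw [mem_union] at this
          tauto
        · exact Or.inr hx
        · exact absurd hx hxZ'
        · exact absurd hx hxR₂
      obtain ⟨H, hH, hxH⟩ := hQc x hx2 hSx hxZ
      exact ⟨H, mem_union_left _ hH, hxH⟩
  have hcnt0 : ∀ x ∈ Z', cnt ℋ x = 0 := fun x hx => h.cnt_zero fun h' => by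
    rcases mem_union.1 h' with h' | h'
    exacts [disjoint_left.1 hZ'X hx h', disjoint_left.1 hZ'R hx h']
  refine ⟨⟨?_, ?_, ?_, ?_, ?_, ?_, ?_, ?_⟩, hcover, ?_⟩
  · simp only [disjoint_union_left, disjoint_union_right]
    exact ⟨⟨h.disj, hX₁.2⟩, ⟨hZ'X.symm, hZ'X₁.symm⟩, hR₂X.symm, hR₂X₁.symm⟩
  · intro x hx
    simp only [mem_union] at hx
    rcases hx with hx | hx | hx
    exacts [h.unif x hx, hZ'u x hx, h₂.unif x hx]
  · exact h.rdiv.union (hZ'd.union h₂.rdiv hR₂Z'.symm)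
      (disjoint_union_right.2 ⟨hZ'R.symm, hR₂R.symm⟩)
  · intro H hH x hx
    rcases mem_union.1 hH with hH | hH
    · have := h.sub H hH hx
      simp only [mem_union] at this ⊢
      tauto
    · have h1 := h₂.sub H hH hx
      have h2 := @hZR x
      simp only [mem_union] at h1 ⊢
      tauto
  · intro H hH
    rcases mem_union.1 hH with hH | hH
    exacts [h.hdiv H hH, h₂.hdiv H hH]
  · intro H hH
    rcases mem_union.1 hH with hH | hH
    · exact h.hcard H hH
    · have := h₂.hcard H hH; omega
  · intro x
    refine (cnt_union_le _ _ _).trans ?_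
    by_cases hx : x ∈ Z
    · have h1 := hcnt x hx
      have h2 := h₂.hcnt x
      omega
    by_cases hx2 : x ∈ X ∪ R
    · rw [h₂.cnt_zero, add_zero]
      · exact h.hcnt x
      · intro h'
        simp only [mem_union] at h' hx2
        rcases h' with ((h' | h') | h') | h' <;> rcases hx2 with h'' | h''
        · exact disjoint_left.1 hX₁.1 h' h''
        · exact disjoint_left.1 hX₁.2 h' h''
        · exact hx h'
        · exact hx h'
        · exact disjoint_left.1 hZ'X h' h''
        · exact disjoint_left.1 hZ'R h' h''
        · exact disjoint_left.1 hR₂X h' h''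
        · exact disjoint_left.1 hR₂R h' h''
    · rw [h.cnt_zero hx2, zero_add]
      have := h₂.hcnt x
      omega
  · intro L hL _
    obtain ⟨Q, h1, h2, h3, h4⟩ := hcover L hL
    exact ⟨Q, h1, h2, h3, h4⟩
  · intro x hx
    refine (cnt_union_le _ _ _).trans ?_
    rw [hcnt0 x hx, zero_add]
    exact h₂.hcnt x

end Carry
end RefineDown

/-! ### Absorbing edge sets of large degree at `S` -/

namespace RefineDown
open Finset MultiHypergraph
section Top
variable {V : Type u} [DecidableEq V] [Fintype V]

omit [Fintype V] in
lemma Cost_empty_left (c : Finset V → ℝ) (R : Finset (Lab V)) : Cost c R ∅ = ∑ x ∈ R, c x.1 := by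
  simp [Cost]

/-- Absorption of edges of the form `S ∪ g` with `g ⊆ Y`, for `|S| < r`, by splitting them into
pieces of small degree. -/
theorem Absorbs.top {q r N C k : ℕ} (hr : 1 ≤ r) (hqr : r < q) (hP : Absorbs V q r N C k)
    {ρ m D : ℕ} {S Y : Finset V} {θ : V → ℝ} {a : ℝ} {X : Finset (Lab V)} (A : Finset (Lab V))
    (hρ : 1 ≤ ρ) (hSY : Disjoint S Y) (hS1 : 1 ≤ S.card) (hSr : S.card < r) (hm1 : 1 ≤ m)
    (hmY : m ≤ Y.card) (hN : N ≤ m) (hk : m ≤ N * ρ ^ k) (hθ : Weight Y θ) (ha : 0 ≤ a)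
    (hYr : 2 * r < Y.card) (haC : a * (1 + C) ^ (r + 2) * (m * ρ ^ r) ≤ 1)
    (haG : a * (1 + C) ^ (r + 1) * (2 ^ (r - 1) * (1 + 2 * (M q r * (2 * r * r)) : ℕ)
      * ((Y.card : ℝ) / m) ^ (r - 1 - S.card)) ≤ 1)
    (haZ : a * (1 + 2 * (2 ^ r * (1 + C) ^ (r + 1))) * (2 ^ (r - 1) * (M q r * (2 * r * r) : ℕ)) ≤ 1)
    (hX : ∀ x ∈ X, x.1.card = r ∧ S ⊆ x.1 ∧ x.1 ⊆ S ∪ Y)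
    (hD : ∀ T, S ⊆ T → T.card = r - 1 → ldeg X T ≤ D) (w : Finset V → ℝ) (hw : ∀ T, 0 ≤ w T) :
    ∃ R ℋ, Ref q r (2 * (2 * C)) S X R ℋ ∅ ∧ Thin X ℋ ∧ Disjoint R A ∧ (∀ x ∈ R, x.1 ⊆ S ∪ Y) ∧
      Pot r w (fun T => a * Cost (kap θ T) R ℋ) ≤ Pot r w (fun T =>
        a * (2 ^ r * (1 + C) ^ (r + 1) * load θ X T + (r * D + 1 : ℕ) *
          (2 * (1 + 2 * (2 ^ r * (1 + C) ^ (r + 1))) * (M q r * (2 * r * r) : ℕ)) *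
          ((∑ g ∈ Y.powersetCard (r - S.card), kap θ T (S ∪ g)) / Y.card))) := by
  have hC0 : (0 : ℝ) ≤ C := Nat.cast_nonneg _
  set K0 : ℝ := 2 ^ r * (1 + C) ^ (r + 1) with hK0
  have hK00 : 0 ≤ K0 := by positivity
  set d := r - S.card with hd
  set Gz := M q r * (2 * r * r) with hGz
  set K2 : ℝ := 2 * (1 + 2 * K0) * (Gz : ℕ) with hK2
  set av : Finset V → ℝ := fun T => (∑ g ∈ Y.powersetCard d, kap θ T (S ∪ g)) / Y.card with hav
  have hY0 : 0 < Y.card := by omega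
  have hY0' : (0 : ℝ) < Y.card := by exact_mod_cast hY0
  have : NeZero Y.card := ⟨hY0.ne'⟩
  obtain ⟨e, he, hsurj⟩ := exists_zmod_labelling (Y := Y) rfl
  have hdr : 2 * d * d ≤ 2 * r * r := by
    have : d ≤ r := Nat.sub_le _ _
    gcongr
  have hload0 := fun (X : Finset (Lab V)) T => load_nonneg hθ.nonneg X T
  -- pieces of bounded degree
  have piece : ∀ (w : Finset V → ℝ) (A P : Finset (Lab V)), (∀ T, 0 ≤ w T) →
      (∀ x ∈ P, x.1.card = r ∧ S ⊆ x.1 ∧ x.1 ⊆ S ∪ Y) →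
      (∀ T, S ⊆ T → T.card = r - 1 → ldeg P T ≤ 1 + 2 * Gz) →
      ∃ R ℋ, Ref q r (2 * C) S P R ℋ ∅ ∧ Thin P ℋ ∧ Disjoint R A ∧ (∀ x ∈ R, x.1 ⊆ S ∪ Y) ∧
        Pot r w (fun T => a * Cost (kap θ T) R ℋ) ≤ Pot r w (fun T => a * (K0 * load θ P T)) := by
    intro w A P hw hP' hPd
    obtain ⟨R, ℋ, h1, h2, h3, h4, h5⟩ := hP.reveal_sweep hr (G := 1 + 2 * Gz) (w := w) A hρ hSY hS1
      hSr.le hm1 hmY hN hk hθ hw ha haC hP'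
      (fun U hU => ldeg_le_pow hSr (fun x hx => ⟨(hP' x hx).1, (hP' x hx).2.2⟩) hPd _ U hU rfl) haG
    refine ⟨R, ℋ, h1, h2, h3, h4, h5.trans (le_of_eq ?_)⟩
    congr 1; funext T; rw [hK0]; ring
  -- A colour class has degree at most 1, and the old and the new carry at most `Gz` each, so a
  -- round deals with a piece of degree at most `1 + 2 * Gz`, independent of `D`.
  obtain ⟨col, hcol, hcold⟩ := exists_colouring hr X (fun x hx => (hX x hx).1) hD
  have h𝒯Y : ∀ s, ∀ h ∈ sumSets Y e d (2 * d * d) s, h ⊆ Y := fun s h hh =>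
    (mem_powersetCard.1 (mem_filter.1 hh).1).1
  have hcop : ∀ s (Z : Finset (Lab V)), Copies (M q r) S (sumSets Y e d (2 * d * d) s) Z →
      (∀ x ∈ Z, x.1.card = r ∧ S ⊆ x.1 ∧ x.1 ⊆ S ∪ Y) ∧
      (∀ T, S ⊆ T → T.card = r - 1 → ldeg Z T ≤ Gz) ∧ SDiv q r ∅ Z := by
    intro s Z hZ
    refine ⟨?_, ?_, ?_⟩
    · intro x hx
      obtain ⟨h, hh, hhx⟩ := mem_image.1 (hZ.mem x hx)
      have h1 := (mem_powersetCard.1 (mem_filter.1 hh).1).2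
      rw [← hhx]
      refine ⟨?_, subset_union_left, union_subset_union_right (h𝒯Y s h hh)⟩
      rw [card_union_of_disjoint (disjoint_of_subset_right (h𝒯Y s h hh) hSY), h1]
      omega
    · intro T hST hT
      rw [hZ.ldeg hSY (h𝒯Y s)]
      refine Nat.mul_le_mul_left _ (le_trans ?_ hdr)
      have h1 := card_sumSets_superset_le he (k := d) (c := 2 * d * d) s (T := T \ S)
        (by rw [card_sdiff_of_subset hST]; omega)
      refine (card_le_card ?_).trans h1
      intro h hh
      obtain ⟨hh1, hh2⟩ := mem_filter.1 hh
      exact mem_filter.2 ⟨hh1, sdiff_le_iff.2 hh2⟩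
    · intro T _ hT
      rw [hZ.ldeg hSY (h𝒯Y s)]
      exact (ch_dvd_M hT).mul_right _
  -- The cost estimate includes `K0 * load θ Z T`, the price reserved for clearing the current carry
  -- in the following round.
  have main : ∀ (j : ℕ) (w : Finset V → ℝ), (∀ T, 0 ≤ w T) → ∃ R ℋ Z,
      Ref q r (2 * (2 * C)) S (X.filter fun x => col x < j) R ℋ Z ∧
      (∀ L ⊆ X.filter fun x => col x < j, ∃ Q ⊆ ℋ, (Q : Set (Finset (Lab V))).PairwiseDisjoint id ∧
        (∀ H ∈ Q, H ⊆ L ∪ R) ∧ ∀ x ∈ L ∪ R, S ⊆ x.1 → x ∉ Z → ∃ H ∈ Q, x ∈ H) ∧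
      Z ⊆ R ∧ (∀ x ∈ Z, cnt ℋ x ≤ 2 * C) ∧ Thin (X.filter fun x => col x < j) ℋ ∧
      Disjoint R (A ∪ X) ∧ (∀ x ∈ R, x.1 ⊆ S ∪ Y) ∧ (∀ x ∈ Z, S ⊆ x.1) ∧
      (∀ T, S ⊆ T → T.card = r - 1 → ldeg Z T ≤ Gz) ∧
      Pot r w (fun T => a * (Cost (kap θ T) R ℋ + K0 * load θ Z T))
        ≤ Pot r w (fun T => a * (K0 * load θ (X.filter fun x => col x < j) T + j * K2 * av T)) := by
    intro j
    induction j with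
    | zero =>
      intro w hw
      refine ⟨∅, ∅, ∅, ?_, ?_, by simp, by simp, fun H hH => by simp at hH, by simp, by simp,
        by simp, by simp [ldeg], by simp [Cost, load]⟩
      · simp only [not_lt_zero, filter_false]
        exact Ref.trivial _ _ _ _ _
      · intro L hL
        simp only [not_lt_zero, filter_false, subset_empty] at hL
        exact ⟨∅, by simp, by simp, by simp, by simp [hL]⟩
    | succ j ih =>
      intro w hw
      set X₁ := X.filter fun x => col x = j with hX₁
      set Xj := X.filter fun x => col x < j with hXj
      have hXs : X.filter (fun x => col x < j + 1) = Xj ∪ X₁ := by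
        ext x
        simp only [hXj, hX₁, mem_filter, mem_union]
        constructor
        · rintro ⟨h1, h2⟩
          rcases Nat.lt_succ_iff_lt_or_eq.1 h2 with h | h
          exacts [Or.inl ⟨h1, h⟩, Or.inr ⟨h1, h⟩]
        · rintro (⟨h1, h2⟩ | ⟨h1, h2⟩) <;> exact ⟨h1, by omega⟩
      have hXjX₁ : Disjoint Xj X₁ := by
        rw [disjoint_left]
        intro x hx hx'
        have h1 := (mem_filter.1 hx).2
        have h2 := (mem_filter.1 hx').2
        omega
      have hXjX : Xj ⊆ X := filter_subset _ _
      have hX₁X : X₁ ⊆ X := filter_subset _ _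
      obtain ⟨R, ℋ, Z, hR, hall, hZR, hcnt, hT, hA, hRY, hZS, hZd, hpot⟩ :=
        ih (fun T => w T * Real.exp (a * (K0 * load θ X₁ T + K2 * av T)))
          (fun T => mul_nonneg (hw T) (Real.exp_nonneg _))
      -- choose the new carry
      have hZs : ∀ s : ZMod Y.card, ∃ Z', Copies (M q r) S (sumSets Y e d (2 * d * d) s) Z' ∧
          Disjoint Z' (A ∪ X ∪ R) := fun s => exists_copies _ _ _ _
      choose Zs hZs hZsd using hZs
      have hZload : ∀ s T, T.card = r - 1 → load θ (Zs s) T ≤ 2 ^ (r - 1) * (Gz : ℕ) := by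
        intro s T hT
        obtain ⟨c1, c2, -⟩ := hcop s _ (hZs s)
        have h1 := load_le_of_deg (r := r) (G := Gz) (m := Y.card) (S := S) (W := Y) (X := Zs s)
          (θ := θ) hY0 le_rfl (fun x hx => (c1 x hx).2.1)
          (fun U hU => ldeg_le_pow hSr (fun x hx => ⟨(c1 x hx).1, (c1 x hx).2.2⟩) c2 _ U hU rfl)
          hθ.nonneg hθ.le hT
        rwa [div_self hY0'.ne', one_pow, mul_one] at h1
      -- The shift is chosen by averaging. The carry is charged `1 + 2 * K0`: once for its edges as
      -- part of the refiner, and `K0` for its absorption both in this round and in the next.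
      obtain ⟨s, -, hs⟩ := exists_Pot_le (r := r) (Ω := (univ : Finset (ZMod Y.card)))
        (w := fun T => w T * Real.exp (a * (Cost (kap θ T) R ℋ + K0 * load θ Z T + K0 * load θ X₁ T)))
        (fun T => mul_nonneg (hw T) (Real.exp_nonneg _)) univ_nonempty
        (fun s T => a * (1 + 2 * K0) * load θ (Zs s) T)
        (fun T => a * (1 + 2 * K0) * ((Gz : ℕ) * av T))
        (fun s _ T _ => mul_nonneg (by positivity) (hload0 _ T))
        (fun s _ T hT => (mul_le_mul_of_nonneg_left (hZload s T hT) (by positivity)).trans haZ) (by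
          intro T hT
          rw [card_univ, ZMod.card]
          have hsum : ∑ s, load θ (Zs s) T ≤ (Y.card : ℝ) * ((Gz : ℕ) * av T) := ?_
          · have h1 := mul_le_mul_of_nonneg_left hsum (by positivity : 0 ≤ a * (1 + 2 * K0))
            rw [← mul_sum]
            refine h1.trans (le_of_eq ?_)
            ring
          calc ∑ s, load θ (Zs s) T
              = ∑ s, ∑ g ∈ Y.powersetCard d, if g ∈ sumSets Y e d (2 * d * d) s
                  then (M q r : ℝ) * kap θ T (S ∪ g) else 0 := by
                refine sum_congr rfl fun s _ => ?_
                rw [(hZs s).load hSY (h𝒯Y s), mul_sum, ← sum_filter]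
                refine sum_congr ?_ fun _ _ => rfl
                ext g
                simp only [mem_filter, sumSets]
                tauto
            _ = ∑ g ∈ Y.powersetCard d, ((univ.filter fun s => g ∈ sumSets Y e d (2 * d * d) s).card : ℝ)
                  * (M q r * kap θ T (S ∪ g)) := by
                rw [sum_comm]
                refine sum_congr rfl fun g _ => ?_
                rw [← sum_filter, sum_const, nsmul_eq_mul]
            _ ≤ ∑ g ∈ Y.powersetCard d, (2 * r * r : ℕ) * (M q r * kap θ T (S ∪ g)) := by
                refine sum_le_sum fun g _ => mul_le_mul_of_nonneg_right ?_
                  (mul_nonneg (Nat.cast_nonneg _) (kap_nonneg hθ.nonneg _ _))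
                exact_mod_cast (card_shifts_le Y e d (2 * d * d) g).trans hdr
            _ = _ := by
                rw [hav, hGz, ← mul_sum, ← mul_sum]
                push_cast
                field_simp)
      set Z' := Zs s with hZ'
      obtain ⟨z1, z2, z3⟩ := hcop s Z' (hZs s)
      have hZ'd := hZsd s
      rw [← hZ', disjoint_union_right, disjoint_union_right] at hZ'd
      obtain ⟨⟨hZ'A, hZ'X⟩, hZ'R⟩ := hZ'd
      rw [disjoint_union_right] at hA
      have hPX : ∀ x ∈ X₁ ∪ Z ∪ Z', x.1.card = r ∧ S ⊆ x.1 ∧ x.1 ⊆ S ∪ Y := by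
        intro x hx
        simp only [mem_union] at hx
        rcases hx with (hx | hx) | hx
        · exact hX x (hX₁X hx)
        · exact ⟨hR.unif x (hZR hx), hZS x hx, hRY x (hZR hx)⟩
        · exact z1 x hx
      have hX₁Z : Disjoint X₁ Z := disjoint_of_subset_left hX₁X (disjoint_of_subset_right hZR hA.2.symm)
      have hX₁Z' : Disjoint (X₁ ∪ Z) Z' :=
        disjoint_union_left.2 ⟨(disjoint_of_subset_right hX₁X hZ'X).symm,
          (disjoint_of_subset_right hZR hZ'R).symm⟩
      obtain ⟨R₂, ℋ₂, p1, p2, p3, p4, p5⟩ := piece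
        (fun T => w T * Real.exp (a * (Cost (kap θ T) R ℋ + (1 + K0) * load θ Z' T)))
        (A ∪ X ∪ R ∪ Z') (X₁ ∪ Z ∪ Z') (fun T => mul_nonneg (hw T) (Real.exp_nonneg _)) hPX (by
          intro T hST hT
          rw [ldeg_union hX₁Z', ldeg_union hX₁Z]
          have h1 := hcold j T hST hT
          have h2 := hZd T hST hT
          have h3 := z2 T hST hT
          rw [← hX₁] at h1
          omega)
      simp only [disjoint_union_right] at p3
      obtain ⟨⟨⟨p3A, p3X⟩, p3R⟩, p3Z'⟩ := p3
      obtain ⟨s1, s2, s3⟩ := hR.step_carry hall hZR hcnt p1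
        (disjoint_union_right.2 ⟨hXjX₁.symm, disjoint_of_subset_left hX₁X hA.2.symm⟩)
        (by simp only [disjoint_union_right]
            exact ⟨⟨disjoint_of_subset_right hXjX hZ'X, disjoint_of_subset_right hX₁X hZ'X⟩, hZ'R⟩)
        (by simp only [disjoint_union_right]
            exact ⟨⟨⟨disjoint_of_subset_right hXjX p3X, disjoint_of_subset_right hX₁X p3X⟩, p3R⟩, p3Z'⟩)
        (fun x hx => (z1 x hx).1) z3
        (fun U hU => (hZs s).exists_carry hqr hSY hsurj (by omega) (by omega) s U
          (fun x hx => hPX x (mem_union_left _ (hU hx))) (disjoint_of_subset_left hU hX₁Z'))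
      rw [hXs]
      refine ⟨R ∪ (Z' ∪ R₂), ℋ ∪ ℋ₂, Z', s1, s2, subset_union_left.trans subset_union_right, s3,
        ?_, ?_, ?_, fun x hx => (z1 x hx).2.1, z2, ?_⟩
      · intro H hH
        rcases mem_union.1 hH with hH | hH
        · refine (card_le_card ?_).trans (hT H hH)
          intro x hx
          rw [mem_inter, mem_union] at hx
          refine mem_inter.2 ⟨hx.1, hx.2.resolve_right fun h => ?_⟩
          rcases mem_union.1 (hR.sub H hH hx.1) with h' | h'
          · exact disjoint_left.1 hXjX₁ h' h
          · exact disjoint_left.1 hA.2 h' (hX₁X h)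
        · refine (card_le_card ?_).trans (p2 H hH)
          intro x hx
          rw [mem_inter] at hx
          refine mem_inter.2 ⟨hx.1, (mem_union.1 (p1.sub H hH hx.1)).resolve_right fun h => ?_⟩
          rcases mem_union.1 hx.2 with h' | h'
          exacts [disjoint_left.1 p3X h (hXjX h'), disjoint_left.1 p3X h (hX₁X h')]
      · simp only [disjoint_union_left, disjoint_union_right]
        exact ⟨⟨hA.1, hZ'A, p3A⟩, hA.2, hZ'X, p3X⟩
      · intro x hx
        simp only [mem_union] at hx
        rcases hx with hx | hx | hx
        exacts [hRY x hx, (z1 x hx).2.2, p4 x hx]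
      · have hκ : ∀ T A, 0 ≤ kap θ T A := fun T A => kap_nonneg hθ.nonneg T A
        calc Pot r w (fun T => a * (Cost (kap θ T) (R ∪ (Z' ∪ R₂)) (ℋ ∪ ℋ₂) + K0 * load θ Z' T))
            ≤ Pot r w (fun T => a * (Cost (kap θ T) R ℋ + (1 + K0) * load θ Z' T)
                + a * Cost (kap θ T) R₂ ℋ₂) := by
              refine Pot_mono hw fun T _ => ?_
              rw [← mul_add]
              refine mul_le_mul_of_nonneg_left ?_ ha
              have h1 := Cost_union_le (hκ T) R (Z' ∪ R₂) ℋ ℋ₂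
              have h2 := Cost_union_le (hκ T) Z' R₂ ∅ ℋ₂
              rw [empty_union, Cost_empty_left] at h2
              have h3 : ∑ x ∈ Z', kap θ T x.1 = load θ Z' T := rfl
              linarith
          _ ≤ Pot r w (fun T => a * (Cost (kap θ T) R ℋ + (1 + K0) * load θ Z' T)
                + a * (K0 * load θ (X₁ ∪ Z ∪ Z') T)) := by
              rw [Pot_add, Pot_add]; exact p5
          _ ≤ Pot r w (fun T => a * (Cost (kap θ T) R ℋ + K0 * load θ Z T + K0 * load θ X₁ T)
                + a * (1 + 2 * K0) * load θ Z' T) := by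
              refine Pot_mono hw fun T _ => ?_
              have h1 := load_union_le hθ.nonneg (X₁ ∪ Z) Z' T
              have h2 := load_union_le hθ.nonneg X₁ Z T
              have h3 : load θ (X₁ ∪ Z ∪ Z') T ≤ load θ X₁ T + load θ Z T + load θ Z' T := by linarith
              have h4 := mul_le_mul_of_nonneg_left (mul_le_mul_of_nonneg_left h3 hK00) ha
              linarith
          _ ≤ Pot r w (fun T => a * (Cost (kap θ T) R ℋ + K0 * load θ Z T + K0 * load θ X₁ T)
                + 2 * (a * (1 + 2 * K0) * ((Gz : ℕ) * av T))) := by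
              rw [Pot_add, Pot_add]; exact hs
          _ = Pot r w (fun T => a * (K0 * load θ X₁ T + K2 * av T)
                + a * (Cost (kap θ T) R ℋ + K0 * load θ Z T)) := by
              congr 1; funext T; rw [hK2]; ring
          _ ≤ Pot r w (fun T => a * (K0 * load θ X₁ T + K2 * av T)
                + a * (K0 * load θ Xj T + j * K2 * av T)) := by
              rw [Pot_add, Pot_add]; exact hpot
          _ = _ := by
              congr 1; funext T
              have : load θ (Xj ∪ X₁) T = load θ Xj T + load θ X₁ T := sum_union hXjX₁
              rw [this]; push_cast; ring
  -- After the last colour only the carry is left. For an `S`-divisible `L` its uncovered part is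
  -- `S`-divisible too, so it can be absorbed as a final piece with no further carry.
  obtain ⟨R, ℋ, Z, hR, -, hZR, hcnt, hT, hA, hRY, hZS, hZd, hpot⟩ := main (r * D + 1) w hw
  rw [filter_true_of_mem hcol] at hR hT hpot
  rw [disjoint_union_right] at hA
  have hZ1 : ∀ x ∈ Z, x.1.card = r ∧ S ⊆ x.1 ∧ x.1 ⊆ S ∪ Y := fun x hx =>
    ⟨hR.unif x (hZR hx), hZS x hx, hRY x (hZR hx)⟩
  obtain ⟨R₂, ℋ₂, p1, p2, p3, p4, p5⟩ := piece (fun T => w T * Real.exp (a * Cost (kap θ T) R ℋ))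
    (A ∪ (X ∪ R)) Z (fun T => mul_nonneg (hw T) (Real.exp_nonneg _)) hZ1
    (fun T hST hT => (hZd T hST hT).trans (by omega))
  rw [disjoint_union_right] at p3
  refine ⟨R ∪ R₂, ℋ ∪ ℋ₂, ?_, hT.union p2 p1.sub (disjoint_of_subset_right subset_union_left p3.2).symm,
    disjoint_union_left.2 ⟨hA.1, p3.1⟩, ?_, ?_⟩
  · exact hR.step hcnt p1 subset_rfl (hZR.trans subset_union_right) hZS (fun x hx hn => absurd hx hn)
      p3.2.symm le_rfl (by omega) (fun x hx _ hn => absurd hx hn) (empty_subset _)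
      (fun x _ h h' => absurd h h')
  · intro x hx
    rcases mem_union.1 hx with hx | hx
    exacts [hRY x hx, p4 x hx]
  · have hκ : ∀ T A, 0 ≤ kap θ T A := fun T A => kap_nonneg hθ.nonneg T A
    calc Pot r w (fun T => a * Cost (kap θ T) (R ∪ R₂) (ℋ ∪ ℋ₂))
        ≤ Pot r w (fun T => a * Cost (kap θ T) R ℋ + a * Cost (kap θ T) R₂ ℋ₂) := by
          refine Pot_mono hw fun T _ => ?_
          rw [← mul_add]
          exact mul_le_mul_of_nonneg_left (Cost_union_le (hκ T) _ _ _ _) ha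
      _ ≤ Pot r w (fun T => a * Cost (kap θ T) R ℋ + a * (K0 * load θ Z T)) := by
          rw [Pot_add, Pot_add]; exact p5
      _ = Pot r w (fun T => a * (Cost (kap θ T) R ℋ + K0 * load θ Z T)) := by
          congr 1; funext T; ring
      _ ≤ _ := hpot

end Top
end RefineDown

/-! ### Edges disjoint from `Y` -/

namespace RefineDown
open Finset MultiHypergraph
section FullUnit
variable {V : Type u} [DecidableEq V]

lemma Cost_le_of_window {r : ℕ} {S W T e : Finset V} {θ : V → ℝ} (hθ : Weight W θ)
    (hN : 1 ≤ W.card) (hT : T.card = r - 1) (hS : S ⊆ e) (he : e ⊆ S ∪ W) {R : Finset (Lab V)}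
    {ℋ : Finset (Finset (Lab V))} (hR : ∀ x ∈ R, x.1 ⊆ S ∪ W) (hH : ∀ H ∈ ℋ, verts H ⊆ S ∪ W) :
    Cost (kap θ T) R ℋ ≤ (ℋ.card + R.card : ℝ) * ((W.card : ℝ) ^ r * kap θ T e) := by
  unfold Cost
  rw [add_mul, ← nsmul_eq_mul, ← nsmul_eq_mul]
  exact add_le_add
    (sum_le_card_nsmul _ _ _ fun H h => kap_le_mul_kap hθ hN hT (hH H h) hS he)
    (sum_le_card_nsmul _ _ _ fun x h => kap_le_mul_kap hθ hN hT (hR x h) hS he)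

/-- If `|S| = r`, then all sets of edges are `S`-divisible, so new edges can be put aside. -/
lemma Ref.extend {q r C : ℕ} {S : Finset V} (hS : S.card = r) {X R X₁ : Finset (Lab V)}
    {ℋ : Finset (Finset (Lab V))} (h : Ref q r C S X R ℋ ∅) (hd : Disjoint X₁ R) :
    Ref q r C S (X ∪ X₁) R ℋ X₁ :=
  { h with
    disj := disjoint_union_left.2 ⟨h.disj, hd⟩
    sub := fun H hH => (h.sub H hH).trans (union_subset_union_left subset_union_left)
    cover := fun L hL _ => by
      obtain ⟨Q, h1, h2, h3, h4⟩ := h.cover (L ∩ X) inter_subset_right fun T hST hT => by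
        have := card_le_card hST
        omega
      refine ⟨Q, h1, h2, fun H hH => (h3 H hH).trans (union_subset_union_left inter_subset_left),
        fun x hx hSx hxX => h4 x ?_ hSx (notMem_empty x)⟩
      rcases mem_union.1 hx with hx | hx
      · exact mem_union_left _ (mem_inter.2 ⟨hx, (mem_union.1 (hL hx)).resolve_right hxX⟩)
      · exact mem_union_right _ hx }

variable [Fintype V]

/-- Refinement of parallel edges `S` disjoint from `Y`, using only edges that do not contain `S`. -/
theorem exists_full_unit {q r N m : ℕ} (hr : 1 ≤ r) (hqr : r < q) (hm : m = M q r) (hN1 : 1 ≤ N)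
    (hE : Completes.{u} q r N) {S Y : Finset V} (hSY : Disjoint S Y) (hS : S.card = r)
    (hN : N ≤ Y.card) {θ : V → ℝ} (hθ : Weight Y θ) {a : ℝ} (ha : 0 ≤ a)
    (haR : a * ((2 ^ (m * 2 ^ (r + N)) + m * 2 ^ (r + N) : ℕ) * (N : ℝ) ^ r) * m ≤ 1)
    {X : Finset (Lab V)} (hX : ∀ x ∈ X, x.1 = S) (hXm : X.card ≤ m) (A : Finset (Lab V))
    (w : Finset V → ℝ) (hw : ∀ T, 0 ≤ w T) :
    ∃ R ℋ, Ref q r (2 ^ (m * 2 ^ (r + N)) + 2 * (m * 2 ^ (r + N))) S X R ℋ ∅ ∧ Thin X ℋ ∧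
      Disjoint R A ∧ (∀ x ∈ R, x.1 ⊆ S ∪ Y ∧ ¬ S ⊆ x.1) ∧
      Pot r w (fun T => a * Cost (kap θ T) R ℋ) ≤ Pot r w (fun T =>
        2 ^ r * (a * ((2 ^ (m * 2 ^ (r + N)) + m * 2 ^ (r + N) : ℕ) * (N : ℝ) ^ r)) * load θ X T) := by
  set K : ℕ := 2 ^ (m * 2 ^ (r + N)) + m * 2 ^ (r + N) with hK
  have hm1 : 1 ≤ m := hm ▸ M_pos hqr.le
  -- One window of size `N` serves all edges parallel to `S`. There are at most `m` of them, each
  -- with `kap` at most 1, which bounds the load of every outcome.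
  obtain ⟨W, hWY, hWN, hpot⟩ := exists_reveal hr hw hθ hN1 hN X
    (a := a * ((K : ℕ) * (N : ℝ) ^ r)) (by positivity) (by
      intro W' hW' T hT
      obtain ⟨h1, h2⟩ := mem_powersetCard.1 hW'
      have hθ' := hθ.reveal h1 (by omega)
      refine le_trans (mul_le_mul_of_nonneg_left ?_ (by positivity)) haR
      calc load (reveal θ W') X T ≤ X.card • (1 : ℝ) :=
            sum_le_card_nsmul _ _ _ fun x _ => kap_le_one hθ'.nonneg hθ'.le_one _ _
        _ ≤ m := by rw [nsmul_one]; exact_mod_cast hXm)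
  have hθ' := hθ.reveal hWY (by omega)
  have hSW : Disjoint S W := disjoint_of_subset_right hWY hSY
  -- For |S| = r the condition of `S`-divisibility is void, so each edge can be completed
  -- separately; this also ensures that no member of the family contains two edges of `X`.
  have main : ∀ X₀ ⊆ X, ∃ R ℋ,
      Ref q r (2 ^ (m * 2 ^ (r + N)) + 2 * (m * 2 ^ (r + N))) S X₀ R ℋ ∅ ∧ Thin X₀ ℋ ∧
      Disjoint R (A ∪ X) ∧ (∀ x ∈ R, x.1 ⊆ S ∪ W ∧ ¬ S ⊆ x.1) ∧
      ∀ T, T.card = r - 1 → Cost (kap (reveal θ W) T) R ℋ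
        ≤ ((K : ℕ) * (N : ℝ) ^ r) * load (reveal θ W) X₀ T := by
    intro X₀
    induction X₀ using Finset.induction_on with
    | empty =>
      exact fun _ => ⟨∅, ∅, Ref.trivial _ _ _ _ _, fun H hH => by simp at hH, by simp, by simp,
        by simp [Cost, load]⟩
    | insert x X₀ hx ih =>
      intro hsub
      obtain ⟨R, ℋ, h1, h2, h3, h4, h5⟩ := ih ((subset_insert _ _).trans hsub)
      have hxS : x.1 = S := hX x (hsub (mem_insert_self _ _))
      have hxX := hsub (mem_insert_self x X₀)
      obtain ⟨R₂, ℋ₂, g1, g2, g3, g4, g5⟩ := exists_completion_family (n := r + N) hqr hm hE hSW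
        (by omega) hS.le (by omega) (by rw [card_union_of_disjoint hSW]; omega) (X := {x})
        (by
          intro y hy
          rw [mem_singleton.1 hy, hxS]
          exact ⟨hS, subset_rfl, subset_union_left⟩)
        (fun e => ((card_filter_le _ _).trans (by simp)).trans hm1) (A ∪ X ∪ R)
      simp only [disjoint_union_right] at g2 h3
      have hxR : x ∉ R := fun h => disjoint_left.1 h3.2 h hxX
      have hX₀X : X₀ ⊆ X := (subset_insert _ _).trans hsub
      rw [insert_eq, union_comm]
      refine ⟨R ∪ R₂, ℋ ∪ ℋ₂, ?_, ?_, ?_, ?_, ?_⟩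
      · refine (h1.extend hS (disjoint_singleton_left.2 hxR)).step (c := 0) ?_ g1 subset_rfl ?_ ?_ ?_ ?_
          le_rfl (by omega) (fun y hy _ hn => absurd hy hn) (empty_subset _) (fun y _ h h' => absurd h h')
        · intro y hy
          rw [mem_singleton.1 hy]
          refine (h1.cnt_zero fun h => ?_).le
          rcases mem_union.1 h with h | h
          exacts [hx h, hxR h]
        · exact subset_union_right.trans subset_union_left
        · intro y hy
          rw [mem_singleton.1 hy, hxS]
        · exact fun y hy hn => absurd hy hn
        · simp only [disjoint_union_left, disjoint_singleton_left]
          exact ⟨⟨(disjoint_of_subset_right hX₀X g2.1.2).symm, fun h => disjoint_left.1 g2.1.2 h hxX⟩,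
            g2.2.symm⟩
      · intro H hH
        rcases mem_union.1 hH with hH | hH
        · refine (card_le_card ?_).trans (h2 H hH)
          intro y hy
          rw [mem_inter, mem_union, mem_singleton] at hy
          refine mem_inter.2 ⟨hy.1, hy.2.resolve_right fun h => ?_⟩
          rcases mem_union.1 (h1.sub H hH hy.1) with h' | h'
          exacts [hx (h ▸ h'), hxR (h ▸ h')]
        · refine (card_le_card (t := {x}) ?_).trans (by simp)
          intro y hy
          rw [mem_inter] at hy
          refine (mem_union.1 (g1.sub H hH hy.1)).resolve_right fun h => ?_
          rcases mem_union.1 hy.2 with h' | h'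
          · exact disjoint_left.1 g2.1.2 h (hX₀X h')
          · exact disjoint_left.1 g2.1.2 h (mem_singleton.1 h' ▸ hxX)
      · simp only [disjoint_union_left, disjoint_union_right]
        exact ⟨⟨h3.1, g2.1.1⟩, h3.2, g2.1.2⟩
      · intro y hy
        rcases mem_union.1 hy with hy | hy
        exacts [h4 y hy, g3 y hy]
      · intro T hT
        have hκ : ∀ A, 0 ≤ kap (reveal θ W) T A := fun A => kap_nonneg hθ'.nonneg T A
        have e1 : Cost (kap (reveal θ W) T) R₂ ℋ₂
            ≤ ((K : ℕ) * (N : ℝ) ^ r) * kap (reveal θ W) T x.1 := by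
          have := Cost_le_of_window (S := S) (e := x.1) (R := R₂) (ℋ := ℋ₂) hθ' (by omega) hT
            (by rw [hxS]) (by rw [hxS]; exact subset_union_left) (fun y hy => (g3 y hy).1) (by
              intro H hH
              refine biUnion_subset.2 fun y hy => ?_
              rcases mem_union.1 (g1.sub H hH hy) with h | h
              · rw [mem_singleton.1 h, hxS]; exact subset_union_left
              · exact (g3 y h).1)
          rw [hWN, ← mul_assoc] at this
          refine this.trans ?_
          have h6 : (ℋ₂.card + R₂.card : ℝ) ≤ (K : ℕ) := by
            rw [hK]; exact_mod_cast add_le_add g5 g4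
          have := hκ x.1
          gcongr
        have e2 : load (reveal θ W) (X₀ ∪ {x}) T = load (reveal θ W) X₀ T + kap (reveal θ W) T x.1 := by
          unfold load
          rw [sum_union (disjoint_singleton_right.2 hx), sum_singleton]
        rw [e2, mul_add]
        exact (Cost_union_le hκ _ _ _ _).trans (add_le_add (h5 T hT) e1)
  obtain ⟨R, ℋ, h1, h2, h3, h4, h5⟩ := main X subset_rfl
  rw [disjoint_union_right] at h3
  refine ⟨R, ℋ, h1, h2, h3.1, fun x hx => ⟨(h4 x hx).1.trans (union_subset_union_right hWY),
    (h4 x hx).2⟩, le_trans ?_ hpot⟩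
  refine Pot_mono hw fun T hT => ?_
  rw [mul_assoc]
  refine mul_le_mul_of_nonneg_left ?_ ha
  exact (Cost_mono (fun B => kap_mono hθ.nonneg (hθ.le_reveal hWY) T B) _ _).trans (h5 T hT)

end FullUnit
end RefineDown

/-! ### Estimates for the uniform weight on `Y` -/

namespace RefineDown
open Finset MultiHypergraph
section Main
variable {V : Type u} [DecidableEq V]

/-- The weight that is uniform on `Y` and vanishes elsewhere. -/
noncomputable def thetaOn (Y : Finset V) (y : V) : ℝ := if y ∈ Y then 1 / (Y.card : ℝ) else 0

lemma weight_thetaOn (Y : Finset V) : Weight Y (thetaOn Y) := by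
  refine ⟨fun y => ?_, fun y => ?_, fun y hy => by simp [thetaOn, hy]⟩ <;>
  · unfold thetaOn; split_ifs <;> simp

lemma prod_thetaOn {Y B : Finset V} (hB : B ⊆ Y) :
    ∏ y ∈ B, thetaOn Y y = (1 / (Y.card : ℝ)) ^ B.card := by
  rw [← prod_const]
  exact prod_congr rfl fun y hy => if_pos (hB hy)

lemma prod_thetaOn_eq_zero {Y B : Finset V} (hB : ¬ B ⊆ Y) : ∏ y ∈ B, thetaOn Y y = 0 := by
  obtain ⟨y, hy, hyY⟩ := not_subset.1 hB
  exact prod_eq_zero hy (if_neg hyY)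

lemma sum_load_filter_le {ι : Type*} [DecidableEq ι] {θ : V → ℝ} (hθ : ∀ y, 0 ≤ θ y)
    (X : Finset (Lab V)) (f : Lab V → ι) (s : Finset ι) (T : Finset V) :
    ∑ i ∈ s, load θ (X.filter fun x => f x = i) T ≤ load θ X T := by
  unfold load
  rw [← sum_biUnion]
  · refine sum_le_sum_of_subset_of_nonneg ?_ fun x _ _ => kap_nonneg hθ _ _
    exact biUnion_subset.2 fun i _ => filter_subset _ _
  · intro i _ j _ hij
    rw [Function.onFun, disjoint_left]
    intro x hx hx'
    exact hij ((mem_filter.1 hx).2.symm.trans (mem_filter.1 hx').2)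

section Fin
variable [Fintype V]

/-- The weight vanishes outside `Y`, so only traces `J ⊇ T \ Y` count. Each missing vertex
contributes v to the degree and 1/|Y| to the weight, and at most r-1-|T \ Y| vertices are missing.
-/
lemma load_thetaOn_le {r : ℕ} {Y : Finset V} (hY : 1 ≤ Y.card) {Δ : ℝ} {X : Finset (Lab V)}
    (hr : 1 ≤ r) (hX : ∀ x ∈ X, x.1.card = r)
    (hXΔ : ∀ T : Finset V, T.card = r - 1 → (ldeg X T : ℝ) ≤ Δ) (hΔ0 : 0 ≤ Δ)
    {T : Finset V} (hT : T.card = r - 1) :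
    load (thetaOn Y) X T
      ≤ 2 ^ (r - 1) * (Δ * ((Fintype.card V : ℝ) / Y.card) ^ (r - 1 - (T \ Y).card)) := by
  set n := Y.card with hn
  set v := Fintype.card V with hv
  have hn0 : (0 : ℝ) < n := by exact_mod_cast hY
  have hnv : n ≤ v := card_le_univ _
  have hvn : 1 ≤ (v : ℝ) / n := by rw [le_div_iff₀ hn0, one_mul]; exact_mod_cast hnv
  refine (load_le_sum (weight_thetaOn Y).nonneg X T).trans ?_
  have hG : ∀ T : Finset V, T.card = r - 1 → ldeg X T ≤ ⌊Δ⌋₊ := fun T hT => Nat.le_floor (hXΔ T hT)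
  have key : ∀ J ∈ T.powerset, (ldeg X J : ℝ) * ∏ y ∈ T \ J, thetaOn Y y
      ≤ Δ * ((v : ℝ) / n) ^ (r - 1 - (T \ Y).card) := by
    intro J hJ
    have hJT := mem_powerset.1 hJ
    by_cases hsub : T \ J ⊆ Y
    · rw [prod_thetaOn hsub, card_sdiff_of_subset hJT, hT]
      have h1 := ldeg_le_pow (r := r) (G := ⌊Δ⌋₊) (S := ∅) (W := univ) (X := X)
        (by rw [card_empty]; omega) (fun x hx => ⟨hX x hx, by simp⟩) (fun T _ hT => hG T hT)
        (r - 1 - J.card) J (empty_subset _) rfl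
      rw [card_univ] at h1
      have h2 : (ldeg X J : ℝ) ≤ Δ * (v : ℝ) ^ (r - 1 - J.card) := by
        calc (ldeg X J : ℝ) ≤ (⌊Δ⌋₊ : ℝ) * (v : ℝ) ^ (r - 1 - J.card) := by exact_mod_cast h1
          _ ≤ _ := by gcongr; exact Nat.floor_le hΔ0
      have h3 : (T \ Y).card ≤ J.card := by
        refine card_le_card fun y hy => ?_
        by_contra hyJ
        exact (mem_sdiff.1 hy).2 (hsub (mem_sdiff.2 ⟨(mem_sdiff.1 hy).1, hyJ⟩))
      calc _ ≤ Δ * (v : ℝ) ^ (r - 1 - J.card) * (1 / (n : ℝ)) ^ (r - 1 - J.card) := by gcongr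
        _ = Δ * ((v : ℝ) / n) ^ (r - 1 - J.card) := by rw [mul_assoc, ← mul_pow, mul_one_div]
        _ ≤ _ := mul_le_mul_of_nonneg_left (pow_le_pow_right₀ hvn (by omega)) hΔ0
    · rw [prod_thetaOn_eq_zero hsub, mul_zero]
      positivity
  calc _ ≤ ∑ J ∈ T.powerset, Δ * ((v : ℝ) / n) ^ (r - 1 - (T \ Y).card) := sum_le_sum key
    _ = _ := by rw [sum_const, card_powerset, hT, nsmul_eq_mul]; push_cast; ring

/-- The average load of the carry sets. -/
lemma sum_avg_le {r i : ℕ} {Y : Finset V} (hY : 1 ≤ Y.card) (hi : i < r)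
    {T : Finset V} (hT : T.card = r - 1) :
    ((Fintype.card V : ℝ) / Y.card) ^ (r - 1 - i) * ∑ S ∈ (Yᶜ).powersetCard i,
      (∑ g ∈ Y.powersetCard (r - i), kap (thetaOn Y) T (S ∪ g)) / Y.card
      ≤ 2 ^ (r - 1) * ((Fintype.card V : ℝ) / Y.card) ^ (r - 1 - (T \ Y).card) := by
  set n := Y.card with hn
  set v := Fintype.card V with hv
  have hn0 : (0 : ℝ) < n := by exact_mod_cast hY
  have hn1 : (1 : ℝ) ≤ n := by exact_mod_cast hY
  have hnv : n ≤ v := card_le_univ _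
  set j := (T \ Y).card with hj
  have hTY : (T ∩ Y).card + j = r - 1 := by rw [hj, card_inter_add_card_sdiff, hT]
  -- Only `S ⊇ T \ Y` contribute. For a trace `J ⊆ T ∩ Y` the number of `g ⊇ J` times the weight of
  -- the missed vertices is at most n · n^(-(i-j)), because |T ∩ Y| = r-1-j; division by `n` leaves
  -- n^(-(i-j)).
  have hS : ∀ S ∈ (Yᶜ).powersetCard i,
      (∑ g ∈ Y.powersetCard (r - i), kap (thetaOn Y) T (S ∪ g)) / n
        ≤ if T \ Y ⊆ S then 2 ^ (r - 1) * (1 / (n : ℝ)) ^ (i - j) else 0 := by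
    intro S hS
    obtain ⟨hSY, hSi⟩ := mem_powersetCard.1 hS
    have hSY' : Disjoint S Y := by
      rw [disjoint_left]; intro y hy; exact mem_compl.1 (hSY hy)
    split_ifs with hTS
    · have hji : j ≤ i := hSi ▸ card_le_card hTS
      have h1 : ∀ g ∈ Y.powersetCard (r - i), kap (thetaOn Y) T (S ∪ g)
          ≤ ∑ J ∈ (T ∩ Y).powerset, if J ⊆ g then (1 / (n : ℝ)) ^ ((T ∩ Y).card - J.card) else 0 := by
        intro g hg
        have hsub : T \ (S ∪ g) ⊆ Y := by
          intro y hy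
          by_contra hyY
          obtain ⟨h2, h3⟩ := mem_sdiff.1 hy
          exact h3 (mem_union_left _ (hTS (mem_sdiff.2 ⟨h2, hyY⟩)))
        have heq : T \ (S ∪ g) = (T ∩ Y) \ (T ∩ Y ∩ g) := by
          ext y
          have h2 : y ∈ Y → y ∉ S := fun h h' => disjoint_left.1 hSY' h' h
          have h3 : y ∈ T → y ∉ Y → y ∈ S := fun h h' => hTS (mem_sdiff.2 ⟨h, h'⟩)
          simp only [mem_sdiff, mem_union, mem_inter]
          tauto
        have e1 : kap (thetaOn Y) T (S ∪ g)
            = if T ∩ Y ∩ g ⊆ g then (1 / (n : ℝ)) ^ ((T ∩ Y).card - (T ∩ Y ∩ g).card) else 0 := by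
          rw [if_pos inter_subset_right, kap, prod_thetaOn hsub, heq,
            card_sdiff_of_subset inter_subset_left]
        rw [e1]
        exact single_le_sum
          (f := fun J => if J ⊆ g then (1 / (n : ℝ)) ^ ((T ∩ Y).card - J.card) else 0)
          (fun J _ => by split_ifs <;> positivity) (mem_powerset.2 inter_subset_left)
      have h2 : ∀ J ∈ (T ∩ Y).powerset, ∑ g ∈ Y.powersetCard (r - i),
          (if J ⊆ g then (1 / (n : ℝ)) ^ ((T ∩ Y).card - J.card) else 0)
          ≤ n * (1 / (n : ℝ)) ^ (i - j) := by
        intro J hJ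
        have hJT := mem_powerset.1 hJ
        have hJc := card_le_card hJT
        rw [← sum_filter, sum_const, nsmul_eq_mul]
        by_cases hJr : J.card ≤ r - i
        · rw [card_filter_powersetCard_subset _ _ _ (hJT.trans inter_subset_right) hJr]
          have h3 : ((n - J.card).choose (r - i - J.card) : ℝ) ≤ (n : ℝ) ^ (r - i - J.card) := by
            have := (Nat.choose_le_pow (n - J.card) (r - i - J.card)).trans
              (Nat.pow_le_pow_left (Nat.sub_le n J.card) _)
            exact_mod_cast this
          calc _ ≤ (n : ℝ) ^ (r - i - J.card) * (1 / (n : ℝ)) ^ ((T ∩ Y).card - J.card) := by gcongr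
            _ = n * (1 / (n : ℝ)) ^ (i - j) := by
              have e1 : (T ∩ Y).card - J.card + 1 = (r - i - J.card) + (i - j) := by omega
              have e2 : (1 / (n : ℝ)) ^ ((T ∩ Y).card - J.card)
                  = n * (1 / (n : ℝ)) ^ ((T ∩ Y).card - J.card + 1) := by
                rw [pow_succ]; field_simp
              rw [e2, e1, pow_add, mul_left_comm, ← mul_assoc ((n : ℝ) ^ _), ← mul_pow,
                mul_one_div_cancel hn0.ne', one_pow, one_mul]
        · rw [filter_false_of_mem]
          · simp only [card_empty, Nat.cast_zero, zero_mul]; positivity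
          · intro g hg hJg
            have := card_le_card hJg
            rw [(mem_powersetCard.1 hg).2] at this
            exact hJr this
      rw [div_le_iff₀ hn0]
      calc _ ≤ ∑ g ∈ Y.powersetCard (r - i), ∑ J ∈ (T ∩ Y).powerset,
            (if J ⊆ g then (1 / (n : ℝ)) ^ ((T ∩ Y).card - J.card) else 0) := sum_le_sum h1
        _ ≤ ∑ J ∈ (T ∩ Y).powerset, n * (1 / (n : ℝ)) ^ (i - j) := by
            rw [sum_comm]; exact sum_le_sum h2
        _ = 2 ^ (T ∩ Y).card * (n * (1 / (n : ℝ)) ^ (i - j)) := by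
            rw [sum_const, card_powerset, nsmul_eq_mul]; push_cast; rfl
        _ ≤ 2 ^ (r - 1) * (n * (1 / (n : ℝ)) ^ (i - j)) := by
            gcongr
            · norm_num
            · omega
        _ = _ := by ring
    · rw [sum_eq_zero, zero_div]
      intro g hg
      refine prod_thetaOn_eq_zero fun h => hTS fun y hy => ?_
      obtain ⟨hyT, hyY⟩ := mem_sdiff.1 hy
      by_contra hyS
      have : y ∉ S ∪ g := fun h' => (mem_union.1 h').elim hyS fun h'' =>
        hyY ((mem_powersetCard.1 hg).1 h'')
      exact hyY (h (mem_sdiff.2 ⟨hyT, this⟩))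
  by_cases hji : j ≤ i
  -- At most v^(i-j) sets `S` contain `T \ Y`, so the sum supplies (v/n)^(i-j), completing the
  -- exponent r-1-i to r-1-j.
  · have hcard : (((Yᶜ).powersetCard i).filter fun S => T \ Y ⊆ S).card ≤ v ^ (i - j) := by
      rw [card_filter_powersetCard_subset _ _ _ (fun y hy => mem_compl.2 (mem_sdiff.1 hy).2) hji]
      refine (Nat.choose_le_pow _ _).trans (Nat.pow_le_pow_left ?_ _)
      exact (Nat.sub_le _ _).trans (card_le_univ _)
    calc _ ≤ ((v : ℝ) / n) ^ (r - 1 - i) * ∑ S ∈ (Yᶜ).powersetCard i,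
          (if T \ Y ⊆ S then 2 ^ (r - 1) * (1 / (n : ℝ)) ^ (i - j) else 0) := by
          gcongr with S hS'
          exact hS S hS'
      _ = ((v : ℝ) / n) ^ (r - 1 - i) * ((((Yᶜ).powersetCard i).filter fun S => T \ Y ⊆ S).card *
          (2 ^ (r - 1) * (1 / (n : ℝ)) ^ (i - j))) := by
          rw [← sum_filter, sum_const, nsmul_eq_mul]
      _ ≤ ((v : ℝ) / n) ^ (r - 1 - i) * ((v : ℝ) ^ (i - j) *
          (2 ^ (r - 1) * (1 / (n : ℝ)) ^ (i - j))) := by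
          gcongr
          exact_mod_cast hcard
      _ = 2 ^ (r - 1) * (((v : ℝ) / n) ^ (r - 1 - i) * ((v : ℝ) * (1 / n)) ^ (i - j)) := by
          rw [mul_pow]; ring
      _ = _ := by
          rw [mul_one_div, ← pow_add]
          congr 2
          omega
  · rw [sum_eq_zero, mul_zero]
    · positivity
    · intro S hS'
      have h1 := hS S hS'
      rw [if_neg] at h1
      · refine le_antisymm h1 (div_nonneg (sum_nonneg fun g _ => kap_nonneg
          (weight_thetaOn Y).nonneg _ _) hn0.le)
      · intro h
        have := card_le_card h
        rw [(mem_powersetCard.1 hS').2] at this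
        exact hji this

omit [DecidableEq V] in
-- With weights exp(-p) the predicted potential just counts the (r-1)-sets, at most v^r of them.
-- Every single summand is bounded by this, and taking logarithms gives the claim.
lemma le_add_log_of_Pot {r : ℕ} (hV : 1 ≤ Fintype.card V) {f p : Finset V → ℝ}
    (h : Pot r (fun T => Real.exp (-p T)) f ≤ Pot r (fun T => Real.exp (-p T)) p)
    {T : Finset V} (hT : T.card = r - 1) : f T ≤ p T + r * Real.log (Fintype.card V) := by
  have hv0 : (0 : ℝ) < Fintype.card V := by exact_mod_cast hV
  have h1 : Pot r (fun T => Real.exp (-p T)) p ≤ (Fintype.card V : ℝ) ^ r := by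
    unfold Pot
    rw [sum_congr rfl (g := fun _ => (1 : ℝ)) fun T _ => by rw [← Real.exp_add]; simp, sum_const,
      nsmul_one, card_powersetCard, card_univ]
    have : (Fintype.card V).choose (r - 1) ≤ Fintype.card V ^ r :=
      (Nat.choose_le_pow _ _).trans (Nat.pow_le_pow_right hV (Nat.sub_le _ _))
    exact_mod_cast this
  have h2 : Real.exp (-p T) * Real.exp (f T) ≤ Pot r (fun T => Real.exp (-p T)) f :=
    single_le_sum (f := fun T => Real.exp (-p T) * Real.exp (f T)) (fun T _ => by positivity)
      (mem_powersetCard.2 ⟨subset_univ _, hT⟩)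
  have h3 := (h2.trans h).trans h1
  rw [← Real.exp_add] at h3
  have h4 := Real.log_le_log (Real.exp_pos _) h3
  rw [Real.log_exp, Real.log_pow] at h4
  linarith

end Fin
end Main
end RefineDown

/-! ### Lowering the number of vertices outside `Y`, level by level -/

namespace RefineDown
open Finset MultiHypergraph
section Levels
variable {V : Type u} [DecidableEq V] [Fintype V]

/-- `X` can be refined up to a remainder whose edges have at most `s` vertices in `B`, with new edges
that have at most `r - 1` vertices in `B`, at cost at most `K * Q`. -/
def Reaches (q r c : ℕ) (B : Finset V) (X : Finset (Lab V)) (θ : V → ℝ) (Q : Finset V → ℝ) (s : ℕ)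
    (K : ℝ) : Prop :=
  ∃ R ℋ X', Ref q r (2 * c) ∅ X R ℋ X' ∧ Thin X ℋ ∧ X' ⊆ X ∪ R ∧ (∀ x ∈ X', cnt ℋ x ≤ c) ∧
    (∀ x ∈ X', (x.1 ∩ B).card ≤ s) ∧ (∀ x ∈ R, (x.1 ∩ B).card ≤ r - 1) ∧
    ∀ T, T.card = r - 1 → Cost (kap θ T) R ℋ ≤ K * Q T

/-- One application of `exists_level` with the weights normalised as in `le_add_log_of_Pot`.
Dividing by `a` shows that a level adds `K'` to the constant, provided prediction and logarithmic
error fit into `a * (K' * Q T)`. -/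
theorem Reaches.next {q r c s : ℕ} {B : Finset V} {X : Finset (Lab V)} {θ : V → ℝ}
    {Q : Finset V → ℝ} {K K' a : ℝ} {p : Finset (Lab V) → Finset V → Finset V → ℝ} (ha : 0 < a)
    (hV : 1 ≤ Fintype.card V) (hθ : ∀ y, 0 ≤ θ y)
    (h : Reaches q r c B X θ Q (s + 1) K)
    (unit : ∀ R X', (∀ x ∈ R, x.1.card = r ∧ (x.1 ∩ B).card ≤ r - 1) → X' ⊆ X ∪ R → (∀ x ∈ X', (x.1 ∩ B).card ≤ s + 1) →
      (∀ T, T.card = r - 1 → load θ R T ≤ K * Q T) →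
      (∀ T, T.card = r - 1 → ∑ S' ∈ B.powersetCard (s + 1), p X' S' T + r * Real.log (Fintype.card V)
        ≤ a * (K' * Q T)) ∧
      ∀ S' ⊆ B, S'.card = s + 1 → ∀ (w : Finset V → ℝ), (∀ T, 0 ≤ w T) →
      ∀ A : Finset (Lab V), ∃ R₂ ℋ₂,
        Ref q r c S' (X'.filter fun x => x.1 ∩ B = S') R₂ ℋ₂ ∅ ∧
        Thin (X'.filter fun x => x.1 ∩ B = S') ℋ₂ ∧ Disjoint R₂ A ∧
        (∀ x ∈ R₂, x.1 ∩ B ⊆ S' ∧ (x.1 ∩ B).card ≤ r - 1) ∧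
        Pot r w (fun T => a * Cost (kap θ T) R₂ ℋ₂) ≤ Pot r w (p X' S')) :
    Reaches q r c B X θ Q s (K + K') := by
  obtain ⟨R, ℋ, X', hR, hT, hX', hcnt, hs, hRB, hcost⟩ := h
  have hκ : ∀ T A, 0 ≤ kap θ T A := fun T A => kap_nonneg hθ T A
  obtain ⟨hp, unit⟩ := unit R X' (fun x hx => ⟨hR.unif x hx, hRB x hx⟩) hX' hs fun T hT =>
    (load_le_Cost hθ R ℋ T).trans (hcost T hT)
  obtain ⟨R₂, ℋ₂, X'', h2R, h2X, -, h2T, -, h2XR, h2P, h2cnt, h2pot⟩ :=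
    exists_level (S := ∅) (B := B) (s := s + 1) (P := fun x => (x.1 ∩ B).card ≤ r - 1)
      (κ := kap θ) (p := p X') ha.le hκ hR hT hX' hcnt
      (fun x hx => ⟨empty_subset _, hs x hx⟩) (by simpa only [empty_union] using unit) ∅ _ subset_rfl
      (fun T => Real.exp (-∑ S' ∈ B.powersetCard (s + 1), p X' S' T))
      (fun T => (Real.exp_pos _).le)
  refine ⟨R ∪ R₂, ℋ ∪ ℋ₂, X'', h2R, h2T, ?_, h2cnt, ?_, ?_, fun T hT => ?_⟩
  · intro x hx
    rw [← union_assoc]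
    rcases h2X x hx with ⟨hx, -⟩ | ⟨hx, -⟩
    exacts [mem_union_left _ (hX' hx), mem_union_right _ hx]
  · intro x hx
    rcases h2X x hx with ⟨hx, hxB⟩ | ⟨-, -, hx⟩
    · have : (x.1 ∩ B).card ≠ s + 1 := fun he =>
        hxB (mem_powersetCard.2 ⟨inter_subset_right, he⟩)
      have := hs x hx
      omega
    · omega
  · intro x hx
    rcases mem_union.1 hx with hx | hx
    exacts [hRB x hx, (h2P x hx).2]
  · refine (Cost_union_le (hκ T) _ _ _ _).trans ?_
    rw [add_mul]
    refine add_le_add (hcost T hT) ?_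
    exact le_of_mul_le_mul_left ((le_add_log_of_Pot hV h2pot hT).trans (hp T hT)) ha

/-- The order of magnitude of the costs at `T`. -/
noncomputable def scale (r : ℕ) (Y : Finset V) (Δ : ℝ) (T : Finset V) : ℝ :=
  Δ * ((Fintype.card V : ℝ) / Y.card) ^ (r - 1 - (T \ Y).card)

omit [DecidableEq V] in
lemma one_le_ratio {Y : Finset V} (hY : 1 ≤ Y.card) : 1 ≤ (Fintype.card V : ℝ) / Y.card := by
  have hn0 : (0 : ℝ) < Y.card := by exact_mod_cast hY
  rw [le_div_iff₀ hn0, one_mul]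
  exact_mod_cast card_le_univ _

lemma le_scale {r : ℕ} {Y : Finset V} {Δ : ℝ} (hY : 1 ≤ Y.card) (hΔ : 0 ≤ Δ) (T : Finset V) :
    Δ ≤ scale r Y Δ T :=
  le_mul_of_one_le_right hΔ (one_le_pow₀ (one_le_ratio hY))

lemma subset_union_of_inter_compl {x S Y : Finset V} (h : x ∩ Yᶜ ⊆ S) : x ⊆ S ∪ Y := by
  intro y hy
  by_cases hyY : y ∈ Y
  · exact mem_union_right _ hyY
  · exact mem_union_left _ (h (mem_inter.2 ⟨hy, mem_compl.2 hyY⟩))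

lemma inter_compl_subset {x S Y : Finset V} (h : x ⊆ S ∪ Y) : x ∩ Yᶜ ⊆ S := fun _ hy =>
  (mem_union.1 (h (mem_inter.1 hy).1)).resolve_right (mem_compl.1 (mem_inter.1 hy).2)

/-- The traces of size `r`, that is, the edges disjoint from `Y`. Their refiners avoid edges
containing the trace, so new edges meet `Y`; this is where (r-1)-flatness comes from. -/
theorem Reaches.first {q r c N m : ℕ} (hr : 1 ≤ r) (hqr : r < q) (hm : m = M q r) (hN1 : 1 ≤ N)
    (hE : Completes.{u} q r N) {Y : Finset V} (hN : N ≤ Y.card) {a Δ Cl : ℝ} (ha : 0 < a)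
    (hc : 2 ^ (m * 2 ^ (r + N)) + 2 * (m * 2 ^ (r + N)) ≤ c)
    (haR : a * ((2 ^ (m * 2 ^ (r + N)) + m * 2 ^ (r + N) : ℕ) * (N : ℝ) ^ r) * m ≤ 1)
    {X : Finset (Lab V)} (hX : ∀ x ∈ X, x.1.card = r)
    (hXm : ∀ e, (X.filter fun x => x.1 = e).card ≤ m)
    (hXΔ : ∀ T : Finset V, T.card = r - 1 → (ldeg X T : ℝ) ≤ Δ) (hΔ0 : 0 ≤ Δ) (hCl : 0 ≤ Cl)
    (hlog : r * Real.log (Fintype.card V) ≤ a * (Cl * Δ)) :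
    Reaches q r c Yᶜ X (thetaOn Y) (scale r Y Δ) (r - 1)
      (2 ^ r * ((2 ^ (m * 2 ^ (r + N)) + m * 2 ^ (r + N) : ℕ) * (N : ℝ) ^ r) * 2 ^ (r - 1) + Cl) := by
  have hY : 1 ≤ Y.card := hN1.trans hN
  have hθ := weight_thetaOn Y
  set Kc : ℝ := ((2 ^ (m * 2 ^ (r + N)) + m * 2 ^ (r + N) : ℕ) : ℝ) * (N : ℝ) ^ r with hKc
  have h0 : Reaches q r c Yᶜ X (thetaOn Y) (scale r Y Δ) (r - 1 + 1) 0 := by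
    refine ⟨∅, ∅, X, Ref.trivial _ _ _ _ _, fun H hH => by simp at hH, by simp, by simp [cnt],
      fun x hx => ?_, by simp, by simp [Cost]⟩
    rw [Nat.sub_add_cancel hr, ← hX x hx]
    exact card_le_card inter_subset_left
  have h1 := h0.next (a := a) (K' := 2 ^ r * Kc * 2 ^ (r - 1) + Cl)
    (p := fun X' S' T => 2 ^ r * (a * Kc) * load (thetaOn Y) (X'.filter fun x => x.1 ∩ Yᶜ = S') T)
    ha (hY.trans (card_le_univ _)) hθ.nonneg (by
      intro R X' hR hX' hs hload
      -- New edges have at most r-1 vertices outside `Y`, so an edge with a trace of size `r` is one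
      -- of `X` and equals its trace; the multiplicity bound of `X` applies.
      have hf : ∀ S', S'.card = r → (X'.filter fun x => x.1 ∩ Yᶜ = S') ⊆ X.filter fun x => x.1 = S' := by
        intro S' hS' x hx
        obtain ⟨hx, hxS⟩ := mem_filter.1 hx
        have hxX : x ∈ X := (mem_union.1 (hX' hx)).resolve_right fun h => by
          have := (hR x h).2
          rw [hxS] at this
          omega
        refine mem_filter.2 ⟨hxX, ?_⟩
        rw [← hxS]
        exact (eq_of_subset_of_card_le inter_subset_left (by rw [hxS, hS', hX x hxX])).symm
      refine ⟨fun T hT => ?_, ?_⟩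
      · have hs1 : scale r Y Δ T = Δ * ((Fintype.card V : ℝ) / Y.card) ^ (r - 1 - (T \ Y).card) := rfl
        rw [← mul_sum]
        have h2 : ∑ S' ∈ (Yᶜ).powersetCard (r - 1 + 1),
            load (thetaOn Y) (X'.filter fun x => x.1 ∩ Yᶜ = S') T ≤ 2 ^ (r - 1) * scale r Y Δ T := by
          calc _ ≤ ∑ S' ∈ (Yᶜ).powersetCard (r - 1 + 1),
                load (thetaOn Y) (X.filter fun x => x.1 = S') T :=
                sum_le_sum fun S' hS' => load_mono hθ.nonneg
                  (hf S' (by rw [(mem_powersetCard.1 hS').2]; omega)) T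
            _ ≤ load (thetaOn Y) X T := sum_load_filter_le hθ.nonneg _ _ _ _
            _ ≤ _ := by rw [hs1]; exact load_thetaOn_le hY hr hX hXΔ hΔ0 hT
        have h3 := le_scale (r := r) hY hΔ0 T
        calc _ ≤ 2 ^ r * (a * Kc) * (2 ^ (r - 1) * scale r Y Δ T) + a * (Cl * scale r Y Δ T) :=
              add_le_add (mul_le_mul_of_nonneg_left h2 (by positivity)) (hlog.trans (by gcongr))
          _ = _ := by ring
      · intro S' hS'B hS' w hw A
        have hS'r : S'.card = r := by omega
        obtain ⟨R₂, ℋ₂, u1, u2, u3, u4, u5⟩ := exists_full_unit hr hqr hm hN1 hE (S := S') (Y := Y)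
          (disjoint_left.2 fun y hy => mem_compl.1 (hS'B hy)) hS'r hN hθ ha.le haR
          (fun x hx => (mem_filter.1 (hf S' hS'r hx)).2)
          ((card_le_card (hf S' hS'r)).trans (hXm S')) A w hw
        refine ⟨R₂, ℋ₂, u1.le hc, u2, u3, fun x hx => ?_, u5⟩
        have h2 := inter_compl_subset (u4 x hx).1
        refine ⟨h2, Nat.le_sub_one_of_lt (hS'r ▸ card_lt_card (Finset.ssubset_iff_subset_ne.2 ⟨h2, ?_⟩))⟩
        intro he
        exact (u4 x hx).2 (he ▸ inter_subset_left))
  simpa only [zero_add] using h1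

/-- The growth of the cost in one level. -/
noncomputable def stepConst (r : ℕ) (K0 K2 Cl A : ℝ) : ℝ :=
  A + (K0 * (2 ^ (r - 1) + A) + (r * (2 ^ (r - 1) + A) + 1) * K2 * 2 ^ (r - 1) + Cl)

/-- Traces of size `s + 1` with `1 ≤ s + 1 < r` are handled by `Absorbs.top`. The degrees at a trace
are read off from the load bound, and `sum_avg_le` ensures that the carries of all traces together
stay within `scale`. -/
theorem Reaches.step {q r c N C k : ℕ} (hr : 1 ≤ r) (hqr : r < q) (hP : Absorbs V q r N C k)
    {ρ m s : ℕ} {Y : Finset V} {a Δ Cl K K0 : ℝ} (hρ : 1 ≤ ρ) (hsr : s + 1 < r) (hm1 : 1 ≤ m)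
    (hmY : m ≤ Y.card) (hN : N ≤ m) (hk : m ≤ N * ρ ^ k) (ha : 0 < a) (hYr : 2 * r < Y.card)
    (hc : 2 * (2 * C) ≤ c) (hK0 : K0 = 2 ^ r * (1 + C) ^ (r + 1)) (hK : 0 ≤ K)
    (haC : a * (1 + C) ^ (r + 2) * (m * ρ ^ r) ≤ 1)
    (haG : a * (1 + C) ^ (r + 1) * (2 ^ (r - 1) * (1 + 2 * (M q r * (2 * r * r)) : ℕ)
      * ((Y.card : ℝ) / m) ^ (r - 1 - (s + 1))) ≤ 1)
    (haZ : a * (1 + 2 * K0) * (2 ^ (r - 1) * (M q r * (2 * r * r) : ℕ)) ≤ 1)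
    {X : Finset (Lab V)} (hX : ∀ x ∈ X, x.1.card = r)
    (hXΔ : ∀ T : Finset V, T.card = r - 1 → (ldeg X T : ℝ) ≤ Δ) (hΔ1 : 1 ≤ Δ) (hCl : 0 ≤ Cl)
    (hlog : r * Real.log (Fintype.card V) ≤ a * (Cl * Δ))
    (h : Reaches q r c Yᶜ X (thetaOn Y) (scale r Y Δ) (s + 1) K) :
    Reaches q r c Yᶜ X (thetaOn Y) (scale r Y Δ) s
      (stepConst r K0 (2 * (1 + 2 * K0) * (M q r * (2 * r * r) : ℕ)) Cl K) := by
  have hY : 1 ≤ Y.card := hm1.trans hmY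
  have hθ := weight_thetaOn Y
  have hΔ0 : 0 ≤ Δ := zero_le_one.trans hΔ1
  have hn0 : (0 : ℝ) < Y.card := by exact_mod_cast hY
  have hvn := one_le_ratio hY
  have hK00 : 0 ≤ K0 := by rw [hK0]; positivity
  set A1 : ℝ := 2 ^ (r - 1) + K with hA1
  have hA10 : 0 ≤ A1 := by positivity
  -- The value of `scale` at test sets with exactly `s + 1` vertices outside `Y`; `D` is the
  -- resulting degree bound at each trace.
  set G : ℝ := Δ * ((Fintype.card V : ℝ) / Y.card) ^ (r - 1 - (s + 1)) with hG
  have hG1 : 1 ≤ G := one_le_mul_of_one_le_of_one_le hΔ1 (one_le_pow₀ hvn)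
  set D : ℕ := ⌊A1 * G⌋₊ with hD
  have hrD : ((r * D + 1 : ℕ) : ℝ) ≤ (r * A1 + 1) * G := by
    have : (D : ℝ) ≤ A1 * G := Nat.floor_le (by positivity)
    push_cast
    calc (r : ℝ) * D + 1 ≤ r * (A1 * G) + G := by gcongr
      _ = _ := by ring
  set K2 : ℝ := 2 * (1 + 2 * K0) * (M q r * (2 * r * r) : ℕ) with hK2
  have hK20 : 0 ≤ K2 := by positivity
  refine h.next (a := a) (p := fun X' S' T => a * (K0 * load (thetaOn Y)
      (X'.filter fun x => x.1 ∩ Yᶜ = S') T + (r * D + 1 : ℕ) * K2 *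
      ((∑ g ∈ Y.powersetCard (r - S'.card), kap (thetaOn Y) T (S' ∪ g)) / Y.card)))
    ha (hY.trans (card_le_univ _)) hθ.nonneg ?_
  intro R X' hR hX' hs hload
  have hX'r : ∀ x ∈ X', x.1.card = r := fun x hx =>
    (mem_union.1 (hX' hx)).elim (hX x) fun h => (hR x h).1
  have hl : ∀ T : Finset V, T.card = r - 1 → load (thetaOn Y) X' T ≤ A1 * scale r Y Δ T := by
    intro T hT
    calc load (thetaOn Y) X' T ≤ load (thetaOn Y) (X ∪ R) T := load_mono hθ.nonneg hX' T
      _ ≤ load (thetaOn Y) X T + load (thetaOn Y) R T := load_union_le hθ.nonneg _ _ _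
      _ ≤ 2 ^ (r - 1) * scale r Y Δ T + K * scale r Y Δ T :=
          add_le_add (load_thetaOn_le hY hr hX hXΔ hΔ0 hT) (hload T hT)
      _ = _ := by rw [hA1]; ring
  refine ⟨fun T hT => ?_, ?_⟩
  · have h1 := hl T hT
    have h2 := (sum_load_filter_le hθ.nonneg X' (fun x => x.1 ∩ Yᶜ) ((Yᶜ).powersetCard (s + 1)) T).trans h1
    have h3 := sum_avg_le (r := r) (i := s + 1) hY hsr hT
    have h4 := le_scale (r := r) hY hΔ0 T
    set av := ∑ S ∈ (Yᶜ).powersetCard (s + 1),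
      (∑ g ∈ Y.powersetCard (r - (s + 1)), kap (thetaOn Y) T (S ∪ g)) / Y.card with hav
    have hav0 : 0 ≤ av := sum_nonneg fun S _ => div_nonneg
      (sum_nonneg fun g _ => kap_nonneg hθ.nonneg _ _) hn0.le
    have h5 : ((r * D + 1 : ℕ) : ℝ) * K2 * av ≤ (r * A1 + 1) * K2 * 2 ^ (r - 1) * scale r Y Δ T := by
      calc _ ≤ (r * A1 + 1) * G * K2 * av := by gcongr
        _ = (r * A1 + 1) * K2 * Δ * (((Fintype.card V : ℝ) / Y.card) ^ (r - 1 - (s + 1)) * av) := by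
            rw [hG]; ring
        _ ≤ (r * A1 + 1) * K2 * Δ * (2 ^ (r - 1) *
              ((Fintype.card V : ℝ) / Y.card) ^ (r - 1 - (T \ Y).card)) :=
            mul_le_mul_of_nonneg_left h3 (by positivity)
        _ = _ := by unfold scale; ring
    have e : ∑ S' ∈ (Yᶜ).powersetCard (s + 1), a * (K0 * load (thetaOn Y)
          (X'.filter fun x => x.1 ∩ Yᶜ = S') T + (r * D + 1 : ℕ) * K2 *
          ((∑ g ∈ Y.powersetCard (r - S'.card), kap (thetaOn Y) T (S' ∪ g)) / Y.card))
        = a * (K0 * ∑ S' ∈ (Yᶜ).powersetCard (s + 1), load (thetaOn Y)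
          (X'.filter fun x => x.1 ∩ Yᶜ = S') T + (r * D + 1 : ℕ) * K2 * av) := by
      rw [← mul_sum, sum_add_distrib, ← mul_sum, ← mul_sum, hav]
      congr 3
      refine sum_congr rfl fun S' hS' => ?_
      rw [(mem_powersetCard.1 hS').2]
    rw [e]
    calc _ ≤ a * (K0 * (A1 * scale r Y Δ T) + (r * A1 + 1) * K2 * 2 ^ (r - 1) * scale r Y Δ T)
          + a * (Cl * scale r Y Δ T) := by
          refine add_le_add ?_ (hlog.trans (by gcongr))
          gcongr
      _ = _ := by ring
  · intro S' hS'B hS' w hw A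
    have hS'Y : Disjoint S' Y := disjoint_left.2 fun y hy => mem_compl.1 (hS'B hy)
    have hF : ∀ x ∈ X'.filter (fun x => x.1 ∩ Yᶜ = S'), x.1.card = r ∧ S' ⊆ x.1 ∧ x.1 ⊆ S' ∪ Y := by
      intro x hx
      obtain ⟨hx, hxS⟩ := mem_filter.1 hx
      exact ⟨hX'r x hx, hxS ▸ inter_subset_left, subset_union_of_inter_compl hxS.le⟩
    subst hK0
    obtain ⟨R₂, ℋ₂, u1, u2, u3, u4, u5⟩ := hP.top hr hqr (D := D) (S := S') (Y := Y) A hρ hS'Y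
      (by omega) (by omega) hm1 hmY hN hk hθ ha.le hYr haC (by rw [hS']; exact haG) haZ hF
      (by
        intro T hST hT
        rcases eq_or_ne (ldeg (X'.filter fun x => x.1 ∩ Yᶜ = S') T) 0 with h0 | h0
        · rw [h0]; exact Nat.zero_le _
        refine Nat.le_floor ?_
        obtain ⟨x, hx⟩ := card_pos.1 (Nat.pos_of_ne_zero h0)
        obtain ⟨hx, hTx⟩ := mem_filter.1 hx
        -- A test set of positive degree lies in some edge inside `S' ∪ Y`, so its part outside `Y`
        -- is exactly `S'`. Edges containing `T` have `kap` equal to 1, so the load bounds the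
        -- degree.
        have hTY : T \ Y = S' := by
          ext y
          rw [mem_sdiff]
          constructor
          · rintro ⟨hyT, hyY⟩
            exact (mem_union.1 ((hF x hx).2.2 (hTx hyT))).resolve_right hyY
          · exact fun hy => ⟨hST hy, disjoint_left.1 hS'Y hy⟩
        have h1 := hl T hT
        rw [scale, hTY, hS'] at h1
        refine le_trans ?_ h1
        refine le_trans ?_ (load_mono hθ.nonneg
          ((filter_subset (fun x => T ⊆ x.1) _).trans (filter_subset (fun x => x.1 ∩ Yᶜ = S') X')) T)
        unfold ldeg load
        rw [← nsmul_one]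
        refine card_nsmul_le_sum _ _ _ fun x hx => ?_
        rw [kap, sdiff_eq_empty_iff_subset.2 (mem_filter.1 hx).2, prod_empty]) w hw
    refine ⟨R₂, ℋ₂, u1.le hc, u2, u3, fun x hx => ?_, u5⟩
    have h2 := inter_compl_subset (u4 x hx)
    have := card_le_card h2
    exact ⟨h2, by omega⟩

end Levels
end RefineDown

/-! ### The remainder inside `Y`, and all levels together -/

namespace RefineDown
open Finset MultiHypergraph
section Assemble
variable {V : Type u} [DecidableEq V] [Fintype V]

/-- The remainder inside `Y` is replaced by parallel edges of bounded multiplicity. -/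
theorem Reaches.finish {q r c m : ℕ} {Y : Finset V} {X : Finset (Lab V)} {Δ K : ℝ}
    (hr : 1 ≤ r) (hqr : r < q) (hm : m = M q r) (hY : 1 ≤ Y.card) (hX : ∀ x ∈ X, x.1.card = r)
    (hXΔ : ∀ T : Finset V, T.card = r - 1 → (ldeg X T : ℝ) ≤ Δ) (hΔ0 : 0 ≤ Δ)
    (h : Reaches q r c Yᶜ X (thetaOn Y) (scale r Y Δ) 0 K) :
    ∃ R ℋ X', Ref q r (2 * c + 2 * 2 ^ (2 * m + 1)) ∅ X R ℋ X' ∧ Thin X ℋ ∧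
      (∀ x ∈ R, (x.1 \ Y).card ≤ r - 1) ∧ X' ⊆ R ∧ (∀ x ∈ X', x.1 ⊆ Y) ∧
      (∀ e, (X'.filter fun x => x.1 = e).card ≤ m) ∧
      ∀ T, T.card = r - 1 → Cost (kap (thetaOn Y) T) R ℋ
        ≤ (K + (2 ^ (2 * m + 1) + m : ℕ) * (2 ^ (r - 1) + K)) * scale r Y Δ T := by
  obtain ⟨R, ℋ, X₁, hR, hT, hX₁, hcnt, hs, hRB, hcost⟩ := h
  have hθ := weight_thetaOn Y
  have hm1 : 1 ≤ m := hm ▸ M_pos hqr.le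
  have hX₁r : ∀ x ∈ X₁, x.1.card = r := fun x hx => (mem_union.1 (hX₁ hx)).elim (hX x) (hR.unif x)
  have hX₁Y : ∀ x ∈ X₁, x.1 ⊆ Y := fun x hx => by
    have h1 := subset_union_of_inter_compl (card_eq_zero.1 (Nat.le_zero.1 (hs x hx))).subset
    simpa using h1
  -- The remainder may still contain edges of `X` and have large multiplicity. Regrouping parallel
  -- edges replaces it by new edges, so that it becomes disjoint from `X`.
  obtain ⟨R0, ℋ0, X0, hR0, -, hT0, hA0, hX0R, hmult, hcnt0, hRX, hcost0⟩ :=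
    exists_parallel (q := q) hm1 (fun t ht => hm ▸ ch_dvd_M ht) X₁ hX₁r (X ∪ R)
  refine ⟨R ∪ R0, ℋ ∪ ℋ0, X0, ?_, hT.union hT0 (hR0 ∅).sub
    (disjoint_of_subset_right subset_union_left hA0).symm, ?_, hX0R.trans subset_union_right, ?_,
    hmult, fun T hT => ?_⟩
  · refine hR.step hcnt (hR0 ∅) subset_rfl hX₁ (fun _ _ => empty_subset _)
      (fun x hx hn => absurd hx hn) hA0.symm (by omega) ?_ (fun x hx _ hn => absurd hx hn) subset_rfl
      (fun x _ h h' => absurd h h')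
    omega
  · intro x hx
    rcases mem_union.1 hx with hx | hx
    · rw [sdiff_eq_inter_compl]
      exact hRB x hx
    · obtain ⟨y, hy, hxy⟩ := hRX x hx
      rw [hxy, sdiff_eq_empty_iff_subset.2 (hX₁Y y hy)]
      exact Nat.zero_le _
  · intro x hx
    obtain ⟨y, hy, hxy⟩ := hRX x (hX0R hx)
    rw [hxy]
    exact hX₁Y y hy
  · have hκ : ∀ A, 0 ≤ kap (thetaOn Y) T A := fun A => kap_nonneg hθ.nonneg T A
    have h1 : load (thetaOn Y) X₁ T ≤ (2 ^ (r - 1) + K) * scale r Y Δ T := by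
      calc load (thetaOn Y) X₁ T ≤ load (thetaOn Y) (X ∪ R) T := load_mono hθ.nonneg hX₁ T
        _ ≤ load (thetaOn Y) X T + load (thetaOn Y) R T := load_union_le hθ.nonneg _ _ _
        _ ≤ 2 ^ (r - 1) * scale r Y Δ T + K * scale r Y Δ T :=
            add_le_add (load_thetaOn_le hY hr hX hXΔ hΔ0 hT)
              ((load_le_Cost hθ.nonneg R ℋ T).trans (hcost T hT))
        _ = _ := by ring
    calc Cost (kap (thetaOn Y) T) (R ∪ R0) (ℋ ∪ ℋ0)
        ≤ Cost (kap (thetaOn Y) T) R ℋ + Cost (kap (thetaOn Y) T) R0 ℋ0 := Cost_union_le hκ _ _ _ _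
      _ ≤ K * scale r Y Δ T + (2 ^ (2 * m + 1) + m : ℕ) * ((2 ^ (r - 1) + K) * scale r Y Δ T) :=
          add_le_add (hcost T hT) ((hcost0 _ hκ).trans
            (mul_le_mul_of_nonneg_left h1 (Nat.cast_nonneg _)))
      _ = _ := by ring

lemma stepConst_nonneg {r : ℕ} {K0 K2 Cl A : ℝ} (h0 : 0 ≤ K0) (h2 : 0 ≤ K2) (hCl : 0 ≤ Cl)
    (hA : 0 ≤ A) : 0 ≤ stepConst r K0 K2 Cl A := by
  unfold stepConst; positivity

theorem Reaches.all {q r c N C k m₀ : ℕ} (hr : 1 ≤ r) (hqr : r < q) (hP : Absorbs V q r N C k)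
    (hm₀ : m₀ = M q r) (hN1 : 1 ≤ N) (hE : Completes.{u} q r N)
    {ρ m : ℕ} {Y : Finset V} {a Δ Cl K0 K2 A0 : ℝ} (hρ : 1 ≤ ρ) (hmY : m ≤ Y.card)
    (hN : N ≤ m) (hk : m ≤ N * ρ ^ k) (ha : 0 < a) (hYr : 2 * r < Y.card)
    (hc : 2 ^ (m₀ * 2 ^ (r + N)) + 2 * (m₀ * 2 ^ (r + N)) ≤ c) (hc' : 2 * (2 * C) ≤ c)
    (hK0 : K0 = 2 ^ r * (1 + C) ^ (r + 1))
    (hK2 : K2 = 2 * (1 + 2 * K0) * (M q r * (2 * r * r) : ℕ))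
    (hA0 : A0 = 2 ^ r * ((2 ^ (m₀ * 2 ^ (r + N)) + m₀ * 2 ^ (r + N) : ℕ) * (N : ℝ) ^ r) * 2 ^ (r - 1)
      + Cl)
    (haR : a * ((2 ^ (m₀ * 2 ^ (r + N)) + m₀ * 2 ^ (r + N) : ℕ) * (N : ℝ) ^ r) * m₀ ≤ 1)
    (haC : a * (1 + C) ^ (r + 2) * (m * ρ ^ r) ≤ 1)
    (haG : ∀ s, s + 1 < r → a * (1 + C) ^ (r + 1) * (2 ^ (r - 1) *
      (1 + 2 * (M q r * (2 * r * r)) : ℕ) * ((Y.card : ℝ) / m) ^ (r - 1 - (s + 1))) ≤ 1)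
    (haZ : a * (1 + 2 * K0) * (2 ^ (r - 1) * (M q r * (2 * r * r) : ℕ)) ≤ 1)
    {X : Finset (Lab V)} (hX : ∀ x ∈ X, x.1.card = r)
    (hXm : ∀ e, (X.filter fun x => x.1 = e).card ≤ m₀)
    (hXΔ : ∀ T : Finset V, T.card = r - 1 → (ldeg X T : ℝ) ≤ Δ) (hΔ1 : 1 ≤ Δ) (hCl : 0 ≤ Cl)
    (hlog : r * Real.log (Fintype.card V) ≤ a * (Cl * Δ)) :
    Reaches q r c Yᶜ X (thetaOn Y) (scale r Y Δ) 0 ((stepConst r K0 K2 Cl)^[r - 1] A0) := by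
  have hK00 : 0 ≤ K0 := by rw [hK0]; positivity
  have hK20 : 0 ≤ K2 := by rw [hK2]; positivity
  have main : ∀ ℓ ≤ r - 1, 0 ≤ (stepConst r K0 K2 Cl)^[ℓ] A0 ∧
      Reaches q r c Yᶜ X (thetaOn Y) (scale r Y Δ) (r - 1 - ℓ) ((stepConst r K0 K2 Cl)^[ℓ] A0) := by
    intro ℓ
    induction ℓ with
    | zero =>
      intro _
      rw [Function.iterate_zero_apply, Nat.sub_zero, hA0]
      exact ⟨by positivity, Reaches.first hr hqr hm₀ hN1 hE (hN.trans hmY) ha hc haR hX hXm hXΔ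
        (zero_le_one.trans hΔ1) hCl hlog⟩
    | succ ℓ ih =>
      intro hℓ
      obtain ⟨h0, h1⟩ := ih (by omega)
      rw [Function.iterate_succ_apply']
      refine ⟨stepConst_nonneg hK00 hK20 hCl h0, ?_⟩
      have e : r - 1 - ℓ = r - 1 - (ℓ + 1) + 1 := by omega
      rw [e] at h1
      rw [hK2]
      rw [hK2] at h1 h0
      exact h1.step hr hqr hP hρ (by omega) (hN1.trans hN) hmY hN hk ha hYr hc' hK0 h0 haC
        (haG _ (by omega)) haZ hX hXΔ hΔ1 hCl hlog
  simpa using (main (r - 1) le_rfl).2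

end Assemble
end RefineDown

/-! ### Choice of the parameters -/

namespace RefineDown
open Finset MultiHypergraph
section Parameters

/-- The largest `r ^ 3`-th power below `n` gives windows of suitable sizes. -/
lemma exists_base {r N n : ℕ} (hr : 2 ≤ r) (hN : 1 ≤ N) (hn : N ^ r ^ 3 ≤ n) :
    ∃ b, 1 ≤ b ∧ b ^ r ^ 3 ≤ n ∧ N * b ^ ((r - 1) * r ^ 2 - r) ≤ n ∧
      N ≤ N * b ^ ((r - 1) * r ^ 2 - r) ∧
      N * b ^ ((r - 1) * r ^ 2 - r) * b ^ r = N * b ^ ((r - 1) * r ^ 2) ∧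
      ∀ s, s + 1 < r → ((n : ℝ) / (N * b ^ ((r - 1) * r ^ 2 - r) : ℕ)) ^ (r - 1 - (s + 1))
        ≤ (2 ^ r ^ 3) ^ (r - 2) * (b : ℝ) ^ ((r - 1) * r ^ 2) := by
  set k := (r - 1) * r ^ 2 - r with hk
  obtain ⟨t, rfl⟩ : ∃ t, r = t + 2 := ⟨r - 2, by omega⟩
  have e1 : t + 2 - 1 = t + 1 := rfl
  rw [e1] at hk ⊢
  have hkr : k + (t + 2) = (t + 1) * (t + 2) ^ 2 := by
    rw [hk]; refine Nat.sub_add_cancel ?_; nlinarith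
  have hk3 : k + ((t + 2) ^ 2 + (t + 2)) = (t + 2) ^ 3 := by
    have : (t + 2) ^ 3 = (t + 1) * (t + 2) ^ 2 + (t + 2) ^ 2 := by ring
    omega
  have h3 : (t + 2) ^ 3 ≠ 0 := by positivity
  -- Maximality gives n ≤ (b+1)^(r³) ≤ (2b)^(r³), and r³ = k + r² + r, so n over the window size is
  -- at most 2^(r³) b^(r²+r). Its (r-2)-nd power stays below b^((r-1)r²) up to a constant since
  -- (r+1)(r-2) ≤ r(r-1).
  set b := Nat.findGreatest (fun b => b ^ (t + 2) ^ 3 ≤ n) n with hb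
  have hNn : N ≤ n := (Nat.le_self_pow h3 N).trans hn
  have hNb : N ≤ b := Nat.le_findGreatest hNn hn
  have hb1 : 1 ≤ b := hN.trans hNb
  have hbn : b ^ (t + 2) ^ 3 ≤ n := Nat.findGreatest_spec (P := fun b => b ^ (t + 2) ^ 3 ≤ n) hNn hn
  have hbn' : n ≤ (b + 1) ^ (t + 2) ^ 3 := by
    by_contra! h
    have h1 : b + 1 ≤ n := (Nat.le_self_pow h3 _).trans h.le
    have := Nat.le_findGreatest (P := fun b => b ^ (t + 2) ^ 3 ≤ n) h1 h.le
    omega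
  have hmn : N * b ^ k ≤ n := by
    calc N * b ^ k ≤ b ^ (k + 1) := by rw [pow_succ']; gcongr
      _ ≤ b ^ (t + 2) ^ 3 := Nat.pow_le_pow_right hb1 (by omega)
      _ ≤ n := hbn
  have hbk : 1 ≤ b ^ k := Nat.one_le_pow _ _ hb1
  refine ⟨b, hb1, hbn, hmn, Nat.le_mul_of_pos_right _ hbk, by rw [mul_assoc, ← pow_add, hkr],
    fun s hs => ?_⟩
  have hb1' : (1 : ℝ) ≤ b := by exact_mod_cast hb1
  have hm0 : (0 : ℝ) < (N * b ^ k : ℕ) := by exact_mod_cast Nat.mul_pos hN hbk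
  have h1 : 1 ≤ (n : ℝ) / (N * b ^ k : ℕ) := by
    rw [le_div_iff₀ hm0, one_mul]; exact_mod_cast hmn
  have h2 : (n : ℝ) / (N * b ^ k : ℕ) ≤ 2 ^ (t + 2) ^ 3 * (b : ℝ) ^ ((t + 2) ^ 2 + (t + 2)) := by
    rw [div_le_iff₀ hm0]
    have : n ≤ 2 ^ (t + 2) ^ 3 * b ^ ((t + 2) ^ 2 + (t + 2)) * (N * b ^ k) := by
      calc n ≤ (b + 1) ^ (t + 2) ^ 3 := hbn'
        _ ≤ (2 * b) ^ (t + 2) ^ 3 := Nat.pow_le_pow_left (by omega) _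
        _ = 2 ^ (t + 2) ^ 3 * b ^ ((t + 2) ^ 2 + (t + 2)) * (1 * b ^ k) := by
          rw [mul_pow, ← hk3, pow_add b k]; ring
        _ ≤ _ := by gcongr
    exact_mod_cast this
  calc _ ≤ ((n : ℝ) / (N * b ^ k : ℕ)) ^ (t + 2 - 2) := pow_le_pow_right₀ h1 (by omega)
    _ ≤ (2 ^ (t + 2) ^ 3 * (b : ℝ) ^ ((t + 2) ^ 2 + (t + 2))) ^ (t + 2 - 2) := by gcongr
    _ = (2 ^ (t + 2) ^ 3) ^ (t + 2 - 2) * (b : ℝ) ^ (((t + 2) ^ 2 + (t + 2)) * t) := by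
        rw [mul_pow, ← pow_mul, ← pow_mul]; rfl
    _ ≤ _ := by
        refine mul_le_mul_of_nonneg_left (pow_le_pow_right₀ hb1' ?_) (by positivity)
        calc ((t + 2) ^ 2 + (t + 2)) * t = (t + 2) * (t * (t + 3)) := by ring
          _ ≤ (t + 2) * ((t + 1) * (t + 2)) := Nat.mul_le_mul_left _ (by nlinarith)
          _ = _ := by ring

/-- The exponents satisfy (r-1)r²/r³ = 1 - 1/r, which is the source of the exponent in `Δ`. -/
lemma pow_le_rpow {r b n : ℕ} (hr : 1 ≤ r) {v : ℝ} (h : b ^ r ^ 3 ≤ n) (hnv : (n : ℝ) ≤ v) :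
    (b : ℝ) ^ ((r - 1) * r ^ 2) ≤ v ^ (1 - 1 / (r : ℝ)) := by
  have hr0 : (1 : ℝ) ≤ r := by exact_mod_cast hr
  have hexp : 0 ≤ 1 - 1 / (r : ℝ) := by
    rw [sub_nonneg, div_le_one (by linarith)]; exact hr0
  have h1 : (b : ℝ) ^ r ^ 3 ≤ v := le_trans (by exact_mod_cast h) hnv
  refine le_trans (le_of_eq ?_) (Real.rpow_le_rpow (by positivity) h1 hexp)
  rw [← Real.rpow_natCast, ← Real.rpow_natCast, ← Real.rpow_mul (Nat.cast_nonneg _)]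
  congr 1
  push_cast [Nat.cast_sub hr]
  field_simp

theorem exists_lab_refiner {q r : ℕ} (hr : 2 ≤ r) (hqr : r < q)
    (hyp : ∀ r' q' : ℕ, 1 ≤ r' → r' ≤ r - 1 → r' < q' → MultiOmniTheorem.{u} q' r') :
    ∃ (c n₀ : ℕ) (K : ℝ), 1 ≤ n₀ ∧ ∀ (V : Type u) [DecidableEq V] [Fintype V] (Y : Finset V)
      (X : Finset (Lab V)) (Δ : ℝ), n₀ ≤ Y.card → (∀ x ∈ X, x.1.card = r) →
      (∀ e, (X.filter fun x => x.1 = e).card ≤ M q r) →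
      (∀ T : Finset V, T.card = r - 1 → (ldeg X T : ℝ) ≤ Δ) →
      (Fintype.card V : ℝ) ^ (1 - 1 / (r : ℝ)) * Real.log (Fintype.card V) ≤ Δ →
      1 ≤ Δ ∧ ∃ R ℋ X', Ref q r c ∅ X R ℋ X' ∧ Thin X ℋ ∧
        (∀ x ∈ R, (x.1 \ Y).card ≤ r - 1) ∧ X' ⊆ R ∧ (∀ x ∈ X', x.1 ⊆ Y) ∧
        (∀ e, (X'.filter fun x => x.1 = e).card ≤ M q r) ∧
        ∀ T, T.card = r - 1 → Cost (kap (thetaOn Y) T) R ℋ ≤ K * scale r Y Δ T := by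
  have hr1 : 1 ≤ r := by omega
  obtain ⟨N, hqN, hE⟩ := exists_completion hqr hyp
  have hN1 : 1 ≤ N := by omega
  obtain ⟨C, hP⟩ := exists_absorbs hr1 hqr hN1 hE ((r - 1) * r ^ 2 - r)
  set m₀ := M q r with hm₀
  set Gz : ℕ := m₀ * (2 * r * r) with hGz
  set Kc : ℝ := ((2 ^ (m₀ * 2 ^ (r + N)) + m₀ * 2 ^ (r + N) : ℕ) : ℝ) * (N : ℝ) ^ r with hKc
  set K0 : ℝ := 2 ^ r * (1 + C) ^ (r + 1) with hK0
  set c₁ : ℝ := (1 + C) ^ (r + 2) * N with hc₁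
  set c₂ : ℝ := (1 + C) ^ (r + 1) * (2 ^ (r - 1) * (1 + 2 * Gz : ℕ) * (2 ^ r ^ 3) ^ (r - 2)) with hc₂
  set c₃ : ℝ := (1 + 2 * K0) * (2 ^ (r - 1) * (Gz : ℕ)) with hc₃
  set c₄ : ℝ := Kc * m₀ with hc₄
  have p1 : 0 ≤ c₁ := by positivity
  have p2 : 0 ≤ c₂ := by positivity
  have p3 : 0 ≤ c₃ := by positivity
  have p4 : 0 ≤ c₄ := by positivity
  -- Dominates the constants of all four smallness conditions on `a`.
  set Ca : ℝ := 1 + c₁ + c₂ + c₃ + c₄ with hCa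
  have hCa0 : 0 < Ca := by positivity
  set c := 2 ^ (m₀ * 2 ^ (r + N)) + 2 * (m₀ * 2 ^ (r + N)) + 2 * (2 * C) with hc
  set K2 : ℝ := 2 * (1 + 2 * K0) * (Gz : ℕ) with hK2
  set Kf := (stepConst r K0 K2 (Ca * r))^[r - 1] (2 ^ r * Kc * 2 ^ (r - 1) + Ca * r) with hKf
  -- The threshold on |Y| serves three purposes: `N ^ r ^ 3` for `exists_base`, `2 * r` for the
  -- labelling of `Y`, and 3 to make log v at least 1.
  refine ⟨2 * c + 2 * 2 ^ (2 * m₀ + 1), N ^ r ^ 3 + 2 * r + 3,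
    Kf + (2 ^ (2 * m₀ + 1) + m₀ : ℕ) * (2 ^ (r - 1) + Kf), by omega, ?_⟩
  intro V _ _ Y X Δ hn hX hXm hXΔ hΔ
  have hnv : Y.card ≤ Fintype.card V := card_le_univ _
  have hv3 : (3 : ℝ) ≤ Fintype.card V := by
    have : 3 ≤ Fintype.card V := by omega
    exact_mod_cast this
  have hlog1 : 1 ≤ Real.log (Fintype.card V) := by
    rw [Real.le_log_iff_exp_le (by linarith)]
    linarith [Real.exp_one_lt_d9]
  obtain ⟨b, hb1, hbn, hmn, hNm, hmr, hG⟩ := exists_base hr hN1 (n := Y.card) (by omega)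
  have hpow := pow_le_rpow hr1 hbn (v := Fintype.card V) (by exact_mod_cast hnv)
  set B : ℝ := (b : ℝ) ^ ((r - 1) * r ^ 2) with hB
  have hB1 : 1 ≤ B := one_le_pow₀ (by exact_mod_cast hb1)
  have hΔB : B * Real.log (Fintype.card V) ≤ Δ := le_trans (by gcongr) hΔ
  have hΔ1 : 1 ≤ Δ := (one_le_mul_of_one_le_of_one_le hB1 hlog1).trans hΔB
  refine ⟨hΔ1, ?_⟩
  -- The largest scale on which every load stays at most 1: the window-dependent conditions involve
  -- `B`, the others only constants, and B ≥ 1.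
  set a : ℝ := 1 / (Ca * B) with ha
  have ha0 : 0 < a := by positivity
  have haB : ∀ K : ℝ, 0 ≤ K → K ≤ Ca → a * (K * B) ≤ 1 := fun K hK hKC => by
    calc a * (K * B) ≤ a * (Ca * B) := by gcongr
      _ = 1 := one_div_mul_cancel (by positivity)
  have ha1 : ∀ K : ℝ, 0 ≤ K → K ≤ Ca → a * K ≤ 1 := fun K hK hKC =>
    le_trans (mul_le_mul_of_nonneg_left (le_mul_of_one_le_right hK hB1) ha0.le) (haB K hK hKC)
  refine (Reaches.all (c := c) (k := (r - 1) * r ^ 2 - r) (m := N * b ^ ((r - 1) * r ^ 2 - r)) (a := a)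
    (Cl := Ca * r) (K0 := K0) (K2 := K2) hr1 hqr (hP V) hm₀ hN1 hE hb1 hmn hNm le_rfl ha0 (by omega)
    (Nat.le_add_right _ _) (Nat.le_add_left _ _) rfl rfl rfl ?_ ?_ ?_ ?_ hX hXm hXΔ hΔ1 (by positivity) ?_).finish hr1 hqr hm₀
    (by omega) hX hXΔ (by linarith)
  · rw [mul_assoc]; exact ha1 _ p4 (by linarith)
  · refine le_trans (le_of_eq ?_) (haB c₁ p1 (by linarith))
    have : ((N * b ^ ((r - 1) * r ^ 2 - r) : ℕ) : ℝ) * (b : ℝ) ^ r = N * B := by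
      rw [hB]; exact_mod_cast hmr
    rw [this, hc₁]; ring
  · intro s hs
    refine le_trans ?_ (haB c₂ p2 (by linarith))
    rw [mul_assoc]
    refine mul_le_mul_of_nonneg_left ?_ ha0.le
    calc _ ≤ (1 + C : ℝ) ^ (r + 1) * (2 ^ (r - 1) * (1 + 2 * Gz : ℕ) *
          ((2 ^ r ^ 3) ^ (r - 2) * B)) := by
          gcongr
          exact hG s hs
      _ = _ := by rw [hc₂]; ring
  · rw [mul_assoc]; exact ha1 _ p3 (by linarith)
  -- The logarithmic error: it suffices that B log v ≤ Δ, which follows from B ≤ v^(1-1/r).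
  · have : a * (Ca * r * Δ) = r * (Δ / B) := by rw [ha]; field_simp
    rw [this]
    refine mul_le_mul_of_nonneg_left ?_ (Nat.cast_nonneg _)
    rw [le_div_iff₀ (by positivity), mul_comm]
    exact hΔB

end Parameters
end RefineDown

/-! ### From labelled edges back to multi-hypergraphs -/

namespace RefineDown
open Finset MultiHypergraph
section Translation

lemma cast_sup_le {ι : Type*} {s : Finset ι} {f : ι → ℕ} {B : ℝ} (hB : 0 ≤ B)
    (h : ∀ i ∈ s, (f i : ℝ) ≤ B) : ((s.sup f : ℕ) : ℝ) ≤ B :=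
  (Nat.cast_le.2 (Finset.sup_le fun i hi => Nat.le_floor (h i hi))).trans (Nat.floor_le hB)

lemma deg_eq_ldeg {V E : Type u} [DecidableEq V] {G : MultiHypergraph V E} {φ : E → Lab V}
    (hφ : Function.Injective φ) (hG : ∀ e, (φ e).1 = G.edge e) (L : Finset E) (S : Finset V) :
    G.deg L S = ldeg (L.image φ) S := by
  unfold deg ldeg
  rw [filter_image, card_image_of_injective _ hφ]
  congr! 3 with e
  rw [hG]

/-- The multi-hypergraph of a set of labelled edges. -/
def ofLabels {V : Type u} (R : Finset (Lab V)) : MultiHypergraph V {x // x ∈ R} := ⟨fun x => x.1.1⟩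

/-- A refiner made of labelled edges is a refiner of multi-hypergraphs. -/
theorem Ref.exists_isMultiRefiner {V E : Type u} [DecidableEq V] [Fintype E] {q r c : ℕ}
    {X : MultiHypergraph V E} {φ : E → Lab V} (hφ : Function.Injective φ)
    (hX : ∀ e, (φ e).1 = X.edge e) (hXr : X.Uniform r) {R X' : Finset (Lab V)}
    {ℋ : Finset (Finset (Lab V))} (h : Ref q r c ∅ (univ.image φ) R ℋ X')
    (hT : Thin (univ.image φ) ℋ) (hX'R : X' ⊆ R) {Y : Finset V} (hY : ∀ x ∈ X', x.1 ⊆ Y) :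
    ∃ (X₁ : (X.union (ofLabels R)).Sub) (ℋ₁ : Finset (X.union (ofLabels R)).Sub),
      IsMultiRefiner q r X (ofLabels R) X₁ ℋ₁ ∧
      (∀ e, edgeCount ℋ₁ e ≤ c) ∧ (∀ H ∈ ℋ₁, H.verts.card ≤ c * r ∧ H.edges.card ≤ c) ∧
      (∀ S, refDeg ℋ₁ S ≤ (ℋ.filter fun H => S ⊆ verts H).card) ∧
      (∀ S, (X.union (ofLabels R)).deg X₁.edges S = ldeg X' S) ∧
      (∀ e ∈ X₁.edges, ((X.union (ofLabels R)).edge e).card = r) ∧ X₁.verts = Y := by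
  classical
  set ψ : E ⊕ {x // x ∈ R} → Lab V := Sum.elim φ Subtype.val with hψ
  have hXR := disjoint_left.1 h.disj
  have hψi : Function.Injective ψ := by
    refine hφ.sumElim Subtype.val_injective fun e x he => ?_
    exact hXR (mem_image_of_mem φ (mem_univ e)) (he ▸ x.2)
  have hψe : ∀ e, (ψ e).1 = (X.union (ofLabels R)).edge e := by
    rintro (e | x)
    exacts [hX e, rfl]
  have hψR : ∀ e, ψ e ∈ univ.image φ ∪ R := by
    rintro (e | x)
    exacts [mem_union_left _ (mem_image_of_mem φ (mem_univ e)), mem_union_right _ x.2]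
  have hcard : ∀ e, (ψ e).1.card = r := by
    rintro (e | x)
    exacts [(congrArg card (hX e)).trans (hXr e), h.unif _ x.2]
  set pre : Finset (Lab V) → Finset (E ⊕ {x // x ∈ R}) := fun H => univ.filter fun e => ψ e ∈ H
    with hpre
  have mem_pre : ∀ H e, e ∈ pre H ↔ ψ e ∈ H := fun H e => by simp [hpre]
  have image_pre : ∀ H, H ⊆ univ.image φ ∪ R → (pre H).image ψ = H := by
    intro H hH
    ext x
    rw [mem_image]
    constructor
    · rintro ⟨e, he, rfl⟩
      exact (mem_pre H e).1 he
    · intro hx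
      rcases mem_union.1 (hH hx) with hx' | hx'
      · obtain ⟨e, -, rfl⟩ := mem_image.1 hx'
        exact ⟨Sum.inl e, (mem_pre _ _).2 hx, rfl⟩
      · exact ⟨Sum.inr ⟨x, hx'⟩, (mem_pre _ _).2 hx, rfl⟩
  have disjSum_image : ∀ L : Finset E, ∀ e, e ∈ L.disjSum (univ : Finset {x // x ∈ R}) ↔
      ψ e ∈ L.image φ ∪ R := by
    rintro L (e | x)
    · rw [inl_mem_disjSum, mem_union, show ψ (Sum.inl e) = φ e from rfl, hφ.mem_finset_image]
      exact ⟨Or.inl, fun h' => h'.resolve_right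
        fun h'' => hXR (mem_image_of_mem φ (mem_univ e)) h''⟩
    · rw [inr_mem_disjSum]
      exact ⟨fun _ => mem_union_right _ x.2, fun _ => mem_univ _⟩
  set sub : Finset (Lab V) → (X.union (ofLabels R)).Sub := fun H =>
    ⟨verts H, pre H, fun e he => hψe e ▸ subset_verts ((mem_pre H e).1 he)⟩ with hsub
  refine ⟨⟨Y, pre X', fun e he => hψe e ▸ hY _ ((mem_pre X' e).1 he)⟩, ℋ.image sub, ?_, ?_, ?_, ?_,
    ?_, ?_, rfl⟩
  · refine ⟨fun x => h.unif _ x.2, ?_, ?_, ?_, ?_, ?_⟩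
    · intro S hS
      rw [deg_eq_ldeg (φ := Subtype.val) Subtype.val_injective (fun _ => rfl), univ_eq_attach,
        attach_image_val]
      exact h.rdiv S (empty_subset _) hS
    · intro H₁ hH₁ S hS
      obtain ⟨H, hH, rfl⟩ := mem_image.1 hH₁
      rw [deg_eq_ldeg hψi hψe, image_pre H (h.sub H hH)]
      exact h.hdiv H hH S (empty_subset _) hS
    · intro H₁ hH₁
      obtain ⟨H, hH, rfl⟩ := mem_image.1 hH₁
      refine (card_le_card_of_injOn φ (fun e he => ?_) hφ.injOn).trans (hT H hH)
      exact mem_inter.2 ⟨(mem_pre H _).1 (mem_toLeft.1 he), mem_image_of_mem φ (mem_univ e)⟩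
    -- The remainder consists of edges of `R` only, so it has no edge in common with `X`.
    · intro H₁ _
      refine disjoint_right.2 fun e he => ?_
      exact absurd (hX'R ((mem_pre X' _).1 (mem_toLeft.1 he)))
        (hXR (mem_image_of_mem φ (mem_univ e)))
    · intro L hL
      obtain ⟨Q, hQ, hQd, hQL, hQc⟩ := h.cover (L.image φ) (image_subset_image (subset_univ _))
        fun S _ hS => by rw [← deg_eq_ldeg hφ hX]; exact hL S hS
      refine ⟨Q.image sub, image_subset_image hQ, ?_, ?_, ?_⟩
      · intro H₁ hH₁ H₂ hH₂ hne
        obtain ⟨A, hA, rfl⟩ := mem_image.1 hH₁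
        obtain ⟨B, hB, rfl⟩ := mem_image.1 hH₂
        have hAB := hQd hA hB fun he => hne (by rw [he])
        exact disjoint_left.2 fun e he he' =>
          disjoint_left.1 hAB ((mem_pre A e).1 he) ((mem_pre B e).1 he')
      · intro e he heX'
        obtain ⟨H, hH, hxH⟩ := hQc (ψ e) ((disjSum_image L e).1 he) (empty_subset _)
          fun h' => heX' ((mem_pre X' e).2 h')
        exact ⟨sub H, mem_image_of_mem _ hH, (mem_pre H e).2 hxH⟩
      · intro H₁ hH₁ e he
        obtain ⟨H, hH, rfl⟩ := mem_image.1 hH₁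
        exact (disjSum_image L e).2 (hQL H hH ((mem_pre H e).1 he))
  · intro e
    refine le_trans ?_ (h.hcnt (ψ e))
    refine (card_le_card fun H₁ hH₁ => ?_).trans (card_image_le (f := sub))
    simp only [mem_filter] at hH₁
    obtain ⟨hH₁, heH⟩ := hH₁
    obtain ⟨H, hH, rfl⟩ := mem_image.1 hH₁
    exact mem_image_of_mem _ (mem_filter.2 ⟨hH, (mem_pre H e).1 heH⟩)
  · intro H₁ hH₁
    obtain ⟨H, hH, rfl⟩ := mem_image.1 hH₁
    have h1 := h.hcard H hH
    constructor
    · refine (card_biUnion_le_card_mul H _ r fun x hx => ?_).trans (Nat.mul_le_mul_right r h1)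
      rw [← image_pre H (h.sub H hH)] at hx
      obtain ⟨e, -, rfl⟩ := mem_image.1 hx
      exact (hcard e).le
    · rw [← card_image_of_injective _ hψi]
      show ((pre H).image ψ).card ≤ c
      rw [image_pre H (h.sub H hH)]
      exact h1
  · intro S
    refine (card_le_card fun H₁ hH₁ => ?_).trans (card_image_le (f := sub))
    simp only [mem_filter] at hH₁
    obtain ⟨hH₁, hSH⟩ := hH₁
    obtain ⟨H, hH, rfl⟩ := mem_image.1 hH₁
    exact mem_image_of_mem _ (mem_filter.2 ⟨hH, hSH⟩)
  · intro S
    rw [deg_eq_ldeg hψi hψe, image_pre X' (hX'R.trans subset_union_right)]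
  · intro e _
    rw [← hψe]
    exact hcard e

end Translation
end RefineDown

/-! ### The Refine Down Lemma -/

open RefineDown Finset in
theorem lemma3p9 (q r : ℕ) (hr : 2 ≤ r) (hqr : r < q) :
    ∃ C : ℕ, 1 ≤ C ∧
      ((∀ r' q' : ℕ, 1 ≤ r' → r' ≤ r - 1 → r' < q' →
          MultiHypergraph.MultiOmniTheorem.{u} q' r') →
        ∀ (V E : Type u) [Fintype V] [Fintype E] (X : MultiHypergraph V E) (Y : Finset V),
          X.Uniform r →
          X.MultiplicityLE Finset.univ r (MultiHypergraph.M q r) →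
          C ≤ Y.card →
          ∃ (F : Type u) (_ : Fintype F) (R : MultiHypergraph V F)
            (X' : (X.union R).Sub) (ℋ : Finset (X.union R).Sub),
            MultiHypergraph.IsMultiRefiner q r X R X' ℋ ∧
            MultiHypergraph.Refined (C : ℝ) ℋ ∧
            (MultiHypergraph.maxRefDeg ℋ r : ℝ) ≤
              C * ((Fintype.card V : ℝ) / Y.card) ^ (r.choose 2) * X.Delta r ∧
            R.Flat (r - 1) Y ∧
            ((X.union R).maxDeg X'.edges r : ℝ) ≤
              C * ((Fintype.card V : ℝ) / Y.card) ^ (r.choose 2) * X.Delta r ∧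
            (∀ e ∈ X'.edges, ((X.union R).edge e).card = r) ∧
            (X.union R).MultiplicityLE X'.edges r (MultiHypergraph.M q r) ∧
            X'.verts ⊆ Y) := by
  -- The constants come out of the omni-absorber hypothesis, although `C` is chosen before it; if
  -- the hypothesis fails, any `C` will do.
  by_cases hyp : ∀ r' q' : ℕ, 1 ≤ r' → r' ≤ r - 1 → r' < q' →
      MultiHypergraph.MultiOmniTheorem.{u} q' r'
  swap
  · exact ⟨1, le_rfl, fun h => absurd h hyp⟩
  obtain ⟨c, n₀, K, hn₀, main⟩ := exists_lab_refiner hr hqr hyp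
  refine ⟨n₀ + c + c * r + ⌈K⌉₊, by omega, fun _ V E _ _ X Y hXr hXm hCY => ?_⟩
  classical
  set C := n₀ + c + c * r + ⌈K⌉₊ with hC
  set φ : E → Lab V := fun e => (X.edge e, (Fintype.equivFin E e).1) with hφ
  have hφi : Function.Injective φ := fun e e' he =>
    (Fintype.equivFin E).injective (Fin.ext (congrArg Prod.snd he))
  have hdeg := fun S => deg_eq_ldeg hφi (fun _ => rfl) (G := X) univ S
  have hXr' : ∀ x ∈ univ.image φ, x.1.card = r := by
    intro x hx
    obtain ⟨e, -, rfl⟩ := mem_image.1 hx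
    exact hXr e
  have hmult : ∀ (Z : Finset (Lab V)) (S : Finset V), S.card = r → (∀ x ∈ Z, x.1.card = r) →
      ldeg Z S = (Z.filter fun x => x.1 = S).card := by
    intro Z S hS hZ
    unfold ldeg
    congr 1
    refine filter_congr fun x hx => ⟨fun h => ?_, fun h => h.ge⟩
    exact (eq_of_subset_of_card_le h (by rw [hS, hZ x hx])).symm
  obtain ⟨hΔ1, R, ℋ, X', hR, hT, hflat, hX'R, hX'Y, hX'm, hcost⟩ := main V Y (univ.image φ) (X.Delta r)
    (by omega) hXr' (by
      intro S
      by_cases hS : S.card = r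
      · rw [← hmult _ S hS hXr', ← hdeg]
        exact hXm S hS
      · rw [filter_false_of_mem fun x hx he => hS (by rw [← he, hXr' x hx]), card_empty]
        exact Nat.zero_le _)
    (by
      intro T hT
      rw [← hdeg]
      refine le_trans (Nat.cast_le.2 ?_) (le_max_left _ _)
      exact le_sup (f := fun S => X.deg univ S) (mem_powersetCard.2 ⟨subset_univ _, hT⟩))
    (le_max_right _ _)
  have hcost' : ∀ T, T.card = r - 1 → Cost (kap (thetaOn Y) T) R ℋ
      ≤ C * ((Fintype.card V : ℝ) / Y.card) ^ (r.choose 2) * X.Delta r := by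
    intro T hT
    have h1 := one_le_ratio (V := V) (Y := Y) (by omega)
    have hK : K ≤ C := (Nat.le_ceil K).trans (by rw [hC]; exact_mod_cast Nat.le_add_left _ _)
    -- The exponent obtained is at most r-1, which is at most `r.choose 2` because r ≥ 2.
    have hexp : r - 1 - (T \ Y).card ≤ r.choose 2 := by
      refine (Nat.sub_le _ _).trans ?_
      obtain ⟨t, rfl⟩ : ∃ t, r = t + 2 := ⟨r - 2, by omega⟩
      rw [Nat.choose_succ_succ, Nat.choose_one_right]
      exact Nat.le_add_right _ _
    refine (hcost T hT).trans ?_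
    unfold scale
    calc _ ≤ (C : ℝ) * (X.Delta r * ((Fintype.card V : ℝ) / Y.card) ^ (r.choose 2)) := by
          gcongr
      _ = _ := by ring
  have hB0 : 0 ≤ C * ((Fintype.card V : ℝ) / Y.card) ^ (r.choose 2) * X.Delta r := by positivity
  have hκ : ∀ T A, 0 ≤ kap (thetaOn Y) T A := fun T A => kap_nonneg (weight_thetaOn Y).nonneg T A
  have hκ1 : ∀ T A : Finset V, T ⊆ A → 1 ≤ kap (thetaOn Y) T A := fun T A h => by
    rw [kap, sdiff_eq_empty_iff_subset.2 h, prod_empty]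
  obtain ⟨X₁, ℋ₁, h1, h2, h3, h4, h5, h6, h7⟩ :=
    hR.exists_isMultiRefiner hφi (fun _ => rfl) hXr hT hX'R hX'Y
  refine ⟨_, inferInstance, _, X₁, ℋ₁, h1, ⟨fun e => ?_, fun H hH => ⟨?_, ?_⟩⟩, ?_, ?_, ?_, h6, ?_, h7.le⟩
  · exact_mod_cast (h2 e).trans (by omega)
  · exact_mod_cast (h3 H hH).1.trans (by omega)
  · exact_mod_cast (h3 H hH).2.trans (by omega)
  · refine cast_sup_le hB0 fun T hT => le_trans ?_ (hcost' T (mem_powersetCard.1 hT).2)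
    refine (Nat.cast_le.2 (h4 T)).trans ?_
    -- A member whose vertex set contains `T` has `kap` equal to 1, so the cost at `T` bounds the
    -- refinement degree.
    calc ((ℋ.filter fun H => T ⊆ verts H).card : ℝ)
        ≤ ∑ H ∈ ℋ.filter (fun H => T ⊆ verts H), kap (thetaOn Y) T (verts H) := by
          rw [← nsmul_one]
          exact card_nsmul_le_sum _ _ _ fun H hH => hκ1 _ _ (mem_filter.1 hH).2
      _ ≤ ∑ H ∈ ℋ, kap (thetaOn Y) T (verts H) :=
          sum_le_sum_of_subset_of_nonneg (filter_subset _ _) fun _ _ _ => hκ _ _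
      _ ≤ _ := le_add_of_nonneg_right (sum_nonneg fun _ _ => hκ _ _)
  · intro e
    convert hflat e.1 e.2
    rfl
  · refine cast_sup_le hB0 fun T hT => le_trans ?_ (hcost' T (mem_powersetCard.1 hT).2)
    rw [h5]
    calc (ldeg X' T : ℝ) ≤ ∑ x ∈ X'.filter (fun x => T ⊆ x.1), kap (thetaOn Y) T x.1 := by
          rw [← nsmul_one]
          exact card_nsmul_le_sum _ _ _ fun x hx => hκ1 _ _ (mem_filter.1 hx).2
      _ ≤ load (thetaOn Y) R T :=
          sum_le_sum_of_subset_of_nonneg ((filter_subset _ _).trans hX'R) fun _ _ _ => hκ _ _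
      _ ≤ _ := load_le_Cost (weight_thetaOn Y).nonneg _ _ _
  · intro S hS
    rw [h5, hmult X' S hS fun x hx => hR.unif x (hX'R hx)]
    exact hX'm S
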